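/- Let $q\ge 1$, let $\lambda\in\mathbb{C}$ be a primitive $q$-th root of unity and put $\lambda_t=(1+t)\lambda$ for real $t$ near $0$. For $a\in\mathbb{C}$ let $H_{a,t}(x,y)=(x^2+c+ay,\,ax)$, where $c=c_t(a)=(1-a^2)\kappa-\kappa^2$ with $\kappa=\frac{\lambda_t}{2}-\frac{a^2}{2\lambda_t}$; this is the unique $c$ for which the map has a fixed point with one eigenvalue $\lambda_t$. That fixed point is $\mathbf q_{a,t}=(\kappa,a\kappa)$, and its other eigenvalue is $\nu_{a,t}=-a^2/\lambda_t$. Let $p_t(x)=x^2+\frac{\lambda_t}{2}-\frac{\lambda_t^2}{4}$, with fixed point $\alpha_t=\lambda_t/2$ of multiplier $\lambda_t$. Write $\mathbb{D}_s(z)$ for the closed disk of radius $s$ about $z$ and $\mathbb{D}_s=\mathbb{D}_s(0)$. Let $W^{ss}(\mathbf q_{a,t})$ be the strong stable manifold: for $a\neq 0$ the set of $z\in\mathbb{C}^2$ for which $|\nu_{a,t}|^{-n}\,\mathrm{dist}(H_{a,t}^{n}(z),\mathbf q_{a,t})$ has a finite limit as $n\to\infty$, and $\{\alpha_t\}\times\mathbb{C}$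 for $a=0$. For $r>0$ let $W^{ss}_{loc}(\mathbf q_{a,t})$ be the component of $\mathbf q_{a,t}$ in $W^{ss}(\mathbf q_{a,t})\cap(\mathbb{D}_r\times\mathbb{D}_r)$ along the immersed curve $W^{ss}(\mathbf q_{a,t})$, i.e. the path component. Theorem. Let $r>3$. There are constants $\delta,\delta',\rho,\rho'>0$ and $K,M,N\ge 0$ and, for all $a\in\mathbb{C}$ and $t\in\mathbb{R}$ with $|a|<\delta$, $|t|<\delta'$, a map $\phi_{a,t}$ on the tube $B=\mathbb{D}_{\rho'}(\alpha_t)\times\mathbb{D}_r$ such that: (1) $W^{ss}_{loc}(\mathbf q_{a,t})\subset \mathrm{int}\,\mathbb{D}_{\rho'}(\alpha_t)\times\mathbb{D}_r$; the map $\phi_{a,t}$ is injective and holomorphic on $B$ with holomorphic inverse on $\phi_{a,t}(B)$ (in each case up to the boundary); $\phi_{a,t}(B)\subset\mathbb{D}_\rho\times\mathbb{D}_{r+K|a|}$; and $\phi_{a,t}(\mathbf q_{a,t})=(0,0)$. (2) There are a holomorphic map $\widetilde H_{a,t}:\mathbb{D}_\rho\times\mathbb{D}_{r+K|a|}\to\mathbb{C}^2$,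 a constant $C_{a,t}\in\mathbb{C}$, a holomorphic function $h_{a,t}$ on $\mathbb{D}_\rho\times\mathbb{D}_{r+K|a|}$ and holomorphic functions $a_{2q+2},a_{2q+3},\dots$ on $\mathbb{D}_{r+K|a|}$ (depending on $a,t$) such that $\phi_{a,t}(H_{a,t}(z))=\widetilde H_{a,t}(\phi_{a,t}(z))$ whenever $z$ and $H_{a,t}(z)$ lie in $B$, and $\widetilde H_{a,t}(x,y)=(x_1,y_1)$ with $$x_1=\lambda_t\big(x+x^{q+1}+C_{a,t}x^{2q+1}+a_{2q+2}(y)x^{2q+2}+a_{2q+3}(y)x^{2q+3}+\cdots\big),\qquad y_1=\nu_{a,t}y+x\,h_{a,t}(x,y)$$ on $\mathbb{D}_\rho\times\mathbb{D}_{r+K|a|}$, the series being convergent there; moreover $|x\,h_{a,t}(x,y)|\le M|a|$ there. (3) $\phi_{a,t}(z)$ is jointly real-analytic in $(a,t,z)$ and, for each fixed $t$, jointly holomorphic in $(a,z)$. (4) There are maps $\phi_t$ and constants $C_t\in\mathbb{C}$ $(|t|<\delta')$ such that $\phi_{a,t}(x,y)\to(\phi_t(x),y)$ as $a\to0$, uniformly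 in $|t|<\delta'$ and $(x,y)\in B$. Here $\phi_t:\mathbb{D}_{\rho'}(\alpha_t)\to\mathbb{D}_\rho$ is injective and holomorphic with holomorphic inverse on its image (up to the boundary), $\phi_t(\alpha_t)=0$, and $\phi_t$ is a normalizing chart for $p_t$: $\phi_t\circ p_t\circ\phi_t^{-1}(x)=\lambda_t\big(x+x^{q+1}+C_tx^{2q+1}+E_t(x)\big)$ for $x\in\phi_t\big(\mathbb{D}_{\rho'}(\alpha_t)\cap p_t^{-1}(\mathbb{D}_{\rho'}(\alpha_t))\big)$, with $|\lambda_tE_t(x)|\le N|x|^{2q+2}$. -/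

import Mathlib

open Set Filter Topology Metric

namespace SemiParabolicHenon

/-- The Hénon map `H_{c,a}(x, y) = (x² + c + a y, a x)` of `ℂ²`. -/
def henon (c a : ℂ) (z : ℂ × ℂ) : ℂ × ℂ := (z.1 ^ 2 + c + a * z.2, a * z.1)

/-- `z` is a fixed point of `H_{c,a}` whose derivative there has the eigenvalue `lam`. -/
def IsFixedPtWithEigenvalue (c a lam : ℂ) (z : ℂ × ℂ) : Prop :=
  henon c a z = z ∧
    Module.End.HasEigenvalue
      ((fderiv ℂ (henon c a) z : ℂ × ℂ →L[ℂ] ℂ × ℂ) : Module.End ℂ (ℂ × ℂ)) lam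

/-- The parameter curve `P_lam`: the parameters `(c, a)` for which the Hénon map has a fixed point
with one eigenvalue `lam`. -/
def paramCurve (lam : ℂ) : Set (ℂ × ℂ) :=
  {s | ∃ z : ℂ × ℂ, IsFixedPtWithEigenvalue s.1 s.2 lam z}

/-- The second eigenvalue at the fixed point: the Jacobian of the Hénon map is `-a²`. -/
noncomputable def nu (lam a : ℂ) : ℂ := -a ^ 2 / lam

/-- The fixed point of the Hénon map on `P_lam` that has the eigenvalue `lam`
(see `isFixedPtWithEigenvalue_iff`). -/
noncomputable def fixedPt (lam a : ℂ) : ℂ × ℂ :=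
  (lam / 2 - a ^ 2 / (2 * lam), a * (lam / 2 - a ^ 2 / (2 * lam)))

/-- The value of `c` on `P_lam`, as a function of `a` (see `mem_paramCurve_iff`). -/
noncomputable def cParam (lam a : ℂ) : ℂ :=
  (1 - a ^ 2) * (lam / 2 - a ^ 2 / (2 * lam)) - (lam / 2 - a ^ 2 / (2 * lam)) ^ 2

/-- The Hénon map with parameters `(c, a) ∈ P_lam`. -/
noncomputable def henonOn (lam a : ℂ) : ℂ × ℂ → ℂ × ℂ := henon (cParam lam a) a

/-- The quadratic polynomial `x² + lam/2 - lam²/4`, whose fixed point `lam/2` has multiplier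
`lam`. -/
noncomputable def quadPoly (lam x : ℂ) : ℂ := x ^ 2 + (lam / 2 - lam ^ 2 / 4)

/-- The multiplier `lam_t = (1 + t) lam`. -/
noncomputable def lamT (lam : ℂ) (t : ℝ) : ℂ := (1 + (t : ℂ)) * lam

lemma fderiv_henon_apply (c a : ℂ) (z v : ℂ × ℂ) :
    fderiv ℂ (henon c a) z v = (2 * z.1 * v.1 + a * v.2, a * v.1) := by
  have h1 : HasFDerivAt (fun z : ℂ × ℂ => z.1) (ContinuousLinearMap.fst ℂ ℂ ℂ) z := hasFDerivAt_fst
  have h2 : HasFDerivAt (fun z : ℂ × ℂ => z.2) (ContinuousLinearMap.snd ℂ ℂ ℂ) z := hasFDerivAt_snd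
  have h : HasFDerivAt (henon c a) _ z :=
    (((h1.pow 2).add_const c).add (h2.const_mul a)).prodMk (h1.const_mul a)
  rw [h.fderiv]
  simp

lemma hasEigenvalue_iff (c a m : ℂ) (z : ℂ × ℂ) :
    Module.End.HasEigenvalue
      ((fderiv ℂ (henon c a) z : ℂ × ℂ →L[ℂ] ℂ × ℂ) : Module.End ℂ (ℂ × ℂ)) m ↔
      m ^ 2 - 2 * z.1 * m - a ^ 2 = 0 := by
  constructor
  · intro h
    obtain ⟨v, hv⟩ := h.exists_hasEigenvector
    have h1 := hv.apply_eq_smul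
    have h0 := hv.2
    rw [ContinuousLinearMap.coe_coe, fderiv_henon_apply, Prod.ext_iff] at h1
    obtain ⟨e1, e2⟩ := h1
    simp only [Prod.smul_fst, Prod.smul_snd, smul_eq_mul] at e1 e2
    by_cases hv1 : v.1 = 0
    · have hv2 : v.2 ≠ 0 := fun hv2 => h0 (Prod.ext hv1 hv2)
      have ha : a = 0 := by simpa [hv1, hv2] using e1
      have hm : m = 0 := by simpa [hv1, hv2] using e2
      simp [ha, hm]
    · have : (m ^ 2 - 2 * z.1 * m - a ^ 2) * v.1 = 0 := by linear_combination -m * e1 - a * e2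
      exact (mul_eq_zero.mp this).resolve_right hv1
  · intro h
    by_cases h0 : m = 0 ∧ a = 0
    · obtain ⟨rfl, rfl⟩ := h0
      refine Module.End.hasEigenvalue_of_hasEigenvector (x := ((0 : ℂ), (1 : ℂ))) ?_
      refine Module.End.hasEigenvector_iff.mpr ⟨Module.End.mem_eigenspace_iff.mpr ?_, by simp⟩
      rw [ContinuousLinearMap.coe_coe, fderiv_henon_apply]
      simp
    · refine Module.End.hasEigenvalue_of_hasEigenvector (x := (m, a)) ?_
      refine Module.End.hasEigenvector_iff.mpr ⟨Module.End.mem_eigenspace_iff.mpr ?_, ?_⟩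
      · rw [ContinuousLinearMap.coe_coe, fderiv_henon_apply]
        ext
        · simp only [Prod.smul_fst, smul_eq_mul]
          linear_combination -h
        · simp only [Prod.smul_snd, smul_eq_mul]
          ring
      · intro h'
        rw [Prod.ext_iff] at h'
        exact h0 h'

/-- For `lam ≠ 0`, the Hénon map `H_{c,a}` has at most one fixed point with eigenvalue `lam`, and
one exists exactly when `c = cParam lam a`; it is then `fixedPt lam a`. -/
lemma isFixedPtWithEigenvalue_iff {c a lam : ℂ} (hl : lam ≠ 0) (z : ℂ × ℂ) :
    IsFixedPtWithEigenvalue c a lam z ↔ c = cParam lam a ∧ z = fixedPt lam a := by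
  rw [IsFixedPtWithEigenvalue, hasEigenvalue_iff]
  obtain ⟨x, y⟩ := z
  simp only [henon, fixedPt, cParam, Prod.mk.injEq]
  constructor
  · rintro ⟨⟨h1, h2⟩, h3⟩
    have hx : x = lam / 2 - a ^ 2 / (2 * lam) := by
      field_simp
      linear_combination -h3
    rw [← hx]
    exact ⟨by linear_combination h1 + a * h2, rfl, h2.symm⟩
  · rintro ⟨hc, hx, hy⟩
    rw [← hx] at hc hy
    refine ⟨⟨by rw [hc, hy]; ring, hy.symm⟩, ?_⟩
    rw [hx]
    field_simp
    ring

lemma mem_paramCurve_iff {c a lam : ℂ} (hl : lam ≠ 0) :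
    (c, a) ∈ paramCurve lam ↔ c = cParam lam a := by
  simp [paramCurve, isFixedPtWithEigenvalue_iff hl]

/-- The eigenvalues at the fixed point are exactly `lam` and `nu lam a`. -/
lemma hasEigenvalue_fixedPt_iff {a lam : ℂ} (hl : lam ≠ 0) (m : ℂ) :
    Module.End.HasEigenvalue
      ((fderiv ℂ (henonOn lam a) (fixedPt lam a) : ℂ × ℂ →L[ℂ] ℂ × ℂ) : Module.End ℂ (ℂ × ℂ)) m ↔
      m = lam ∨ m = nu lam a := by
  rw [henonOn, hasEigenvalue_iff]
  have : m ^ 2 - 2 * (fixedPt lam a).1 * m - a ^ 2 = (m - lam) * (m - nu lam a) := by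
    simp only [fixedPt, nu]
    field_simp
    ring
  rw [this, mul_eq_zero, sub_eq_zero, sub_eq_zero]

open Classical in
/-- The strong stable manifold of the fixed point: the points `z` for which
`|ν|⁻ⁿ dist(Hⁿ z, fixedPt)` has a finite limit. In the degenerate case `a = 0`, where `ν = 0`, it is
by convention the vertical line through the fixed point. -/
noncomputable def strongStable (lam a : ℂ) : Set (ℂ × ℂ) :=
  if a = 0 then {z | z.1 = (fixedPt lam a).1}
  else {z | ∃ L : ℝ, Tendsto
    (fun n : ℕ => (‖nu lam a‖⁻¹) ^ n * dist ((henonOn lam a)^[n] z) (fixedPt lam a)) atTop (𝓝 L)}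

/-- The local strong stable manifold relative to the polydisk `|x| ≤ r, |y| ≤ r`: the component of
the fixed point in the part of the strong stable manifold in this polydisk. The strong stable
manifold is an injectively immersed curve that may accumulate on itself, and "component" refers to
the curve: two points are in the same component if a path in the curve joins them inside the
polydisk. -/
noncomputable def localStrongStable (lam a : ℂ) (r : ℝ) : Set (ℂ × ℂ) :=
  pathComponentIn (strongStable lam a ∩ closedBall (0 : ℂ) r ×ˢ closedBall (0 : ℂ) r)
    (fixedPt lam a)

/-- The tube `B = 𝔻_{ρ'}(lam/2) × 𝔻_r` (closed disks). -/
def tube (lam : ℂ) (ρ' r : ℝ) : Set (ℂ × ℂ) :=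
  closedBall (lam / 2) ρ' ×ˢ closedBall (0 : ℂ) r

/-- `f` is a coordinate transformation on `B`: it is holomorphic at every point of `B`, and it has
on `f(B)` an inverse that is holomorphic at every point of `f(B)`. -/
def IsCoordinateChange {E : Type*} [NormedAddCommGroup E] [NormedSpace ℂ E]
    (f : E → E) (B : Set E) : Prop :=
  AnalyticOnNhd ℂ f B ∧ ∃ g : E → E, AnalyticOnNhd ℂ g (f '' B) ∧ LeftInvOn g f B

/-- On `|x| ≤ ρ, |y| ≤ s` the map `F` is holomorphic and of the form
`F(x, y) = (lam (x + x^{q+1} + C x^{2q+1} + a_{2q+2}(y) x^{2q+2} + ⋯), μ y + x h(x, y))`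
with holomorphic `h` and `a_{2q+2}, a_{2q+3}, …`. -/
def IsNormalForm (q : ℕ) (lam μ C : ℂ) (ρ s : ℝ) (h : ℂ × ℂ → ℂ) (F : ℂ × ℂ → ℂ × ℂ) : Prop :=
  AnalyticOnNhd ℂ F (closedBall (0 : ℂ) ρ ×ˢ closedBall (0 : ℂ) s) ∧
  AnalyticOnNhd ℂ h (closedBall (0 : ℂ) ρ ×ˢ closedBall (0 : ℂ) s) ∧
  ∃ A : ℕ → ℂ → ℂ, (∀ k, AnalyticOnNhd ℂ (A k) (closedBall (0 : ℂ) s)) ∧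
    ∀ x ∈ closedBall (0 : ℂ) ρ, ∀ y ∈ closedBall (0 : ℂ) s, ∃ R : ℂ,
      HasSum (fun k : ℕ => A (2 * q + 2 + k) y * x ^ (2 * q + 2 + k)) R ∧
      F (x, y) = (lam * (x + x ^ (q + 1) + C * x ^ (2 * q + 1) + R), μ * y + x * h (x, y))

/-- `f` is a one-dimensional normalizing chart on `𝔻_{ρ'}(lam/2)`, with values in `𝔻_ρ`, for the
polynomial `quadPoly lam`: in the coordinate `f` this polynomial takes the form
`x ↦ lam (x + x^{q+1} + C x^{2q+1} + O(x^{2q+2}))`, with the constant `N` in the error term. -/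
def IsNormalizingChart (q : ℕ) (lam C : ℂ) (ρ ρ' N : ℝ) (f : ℂ → ℂ) : Prop :=
  IsCoordinateChange f (closedBall (lam / 2) ρ') ∧
  MapsTo f (closedBall (lam / 2) ρ') (closedBall 0 ρ) ∧
  f (lam / 2) = 0 ∧
  ∀ x ∈ closedBall (lam / 2) ρ', quadPoly lam x ∈ closedBall (lam / 2) ρ' →
    ‖f (quadPoly lam x) - lam * (f x + f x ^ (q + 1) + C * f x ^ (2 * q + 1))‖
      ≤ N * ‖f x‖ ^ (2 * q + 2)

end SemiParabolicHenon

/-! ### Joint holomorphy from continuity and holomorphy along complex lines (Osgood's lemma). -/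

namespace SemiParabolicHenon

/-! The multiplier λ_t is replaced by an independent complex variable l near λ, and every object is
a germ of a holomorphic function of (a, l, x, y) along a compact set: a = 0, l = λ, the transverse
coordinate fixed, |y| at most a radius slightly larger than r. Uniform constants then come from
compactness, and real analyticity in t from substituting l = λ_t. At a = 0 the map degenerates to
the quadratic polynomial and ν = 0. Hence Y ↦ νY sends a neighbourhood of the whole disk close to
one point, and a functional equation solved near that point extends along the disk by applying the
equation once or twice.

The chart is built in three stages. First, the strong stable manifolds are parametrized so that the
dynamics on them is Y ↦ νY (`exists_eta`) and are straightened to lines ξ = 0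
(`exists_straightening`). Second, the transverse coordinate ξ is corrected order by order: the
multiplier along ξ = 0 is made constant, then the coefficients of orders 2, …, 2q + 1 are treated.
Each correction is an equation u(Y) - l^k u(νY) = R(Y); it is solved by a geometric series if R(0) =
0 (`exists_cohomological`). The remaining value at Y = 0 depends on (a, l) only and is removed by
dividing by l - l^(k+1), unless λ^k = 1 (`exists_solution`). So only the terms of orders q + 1 and
2q + 1 survive. Third, the coordinate is rescaled to make the coefficient of order q + 1 equal to l,
which needs this coefficient to be nonzero at (0, λ).

The nonvanishing concerns the polynomial λz + z² alone. Otherwise its q-th iterate would be z +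
O(z^(q+2)), giving more than q attracting petals. Every petal meets the orbit of the critical value
(`no_free_petal`), and two petals met by one orbit differ by a power of λ (`petal_direction`), so
there are at most q (`not_isBigO_quad_iterate`).

For the inclusion of the local strong stable manifold in the tube, an orbit in the strong stable
manifold eventually lies in the straightened disk: its transverse coordinate loses at most a factor
2 per step, while its distance to the fixed point is O(|ν|^n) with |ν| < 1/4
(`eventually_chart_eq_zero`). Sorting the points of a path by the time of entry into the disk cuts
the path into countably many disjoint closed sets, so by Sierpiński's theorem the path never leaves
the disk (`pathComponentIn_subset_disk`). -/

/-- On `E`, continuous maps that are holomorphic along every complex line are analytic. -/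
def LineAnalytic (E : Type) [NormedAddCommGroup E] [NormedSpace ℂ E] : Prop :=
  ∀ (F : Type) [NormedAddCommGroup F] [NormedSpace ℂ F] [CompleteSpace F] (f : E → F) (U : Set E),
    IsOpen U → ContinuousOn f U →
    (∀ z ∈ U, ∀ v : E, DifferentiableAt ℂ (fun s : ℂ => f (z + s • v)) 0) → AnalyticOnNhd ℂ f U

lemma lineAnalytic_complex : LineAnalytic ℂ := by
  intro F _ _ _ f U hU hc hd
  refine DifferentiableOn.analyticOnNhd (fun z hz => ?_) hU
  have h := hd z hz 1
  have h2 : DifferentiableAt ℂ (fun s : ℂ => f (z + (s - z) • (1 : ℂ))) z := by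
    have h3 : DifferentiableAt ℂ (fun s : ℂ => s - z) z := by fun_prop
    have h4 : DifferentiableAt ℂ (fun s : ℂ => f (z + s • (1 : ℂ))) (z - z) := by simpa using h
    exact DifferentiableAt.comp (f := fun s : ℂ => s - z)
      (g := fun s : ℂ => f (z + s • (1 : ℂ))) z h4 h3
  have h5 : (fun s : ℂ => f (z + (s - z) • (1 : ℂ))) = f := by
    funext s; simp
  rw [h5] at h2
  exact h2.differentiableWithinAt

/-- A continuous map into `C(S, F)` all of whose evaluations are holomorphic is holomorphic. -/
lemma differentiableAt_of_eval {S : Type} [TopologicalSpace S] [CompactSpace S] {F : Type}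
    [NormedAddCommGroup F] [NormedSpace ℂ F] [CompleteSpace F] {g : ℂ → C(S, F)} {ε : ℝ}
    (hε : 0 < ε) (hc : ContinuousOn g (closedBall 0 ε))
    (hd : ∀ p : S, DifferentiableOn ℂ (fun s => g s p) (closedBall 0 ε)) :
    DifferentiableAt ℂ g 0 := by
  lift ε to NNReal using hε.le
  have hint : CircleIntegrable g 0 ε :=
    (hc.mono sphere_subset_closedBall).circleIntegrable hε.le
  have hps := hasFPowerSeriesOn_cauchy_integral hint hε
  -- Cauchy's formula for the function-valued `g` is an identity in C(S, F), so it may be checked at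
  -- each point p, where it is the formula for g(·)(p).
  have key : ∀ w ∈ ball (0 : ℂ) ε,
      (2 * (Real.pi : ℂ) * Complex.I)⁻¹ • ∮ z in C(0, ε), (z - w)⁻¹ • g z = g w := by
    intro w hw
    ext p
    have h1 := (hd p).circleIntegral_sub_inv_smul hw
    have hint2 : CircleIntegrable (fun z => (z - w)⁻¹ • g z) 0 ε := by
      apply ContinuousOn.circleIntegrable hε.le
      refine ContinuousOn.smul (ContinuousOn.inv₀ (f := fun z : ℂ => z - w) (by fun_prop) ?_)
        (hc.mono sphere_subset_closedBall)
      intro z hz h0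
      rw [sub_eq_zero] at h0
      rw [h0, mem_sphere] at hz
      rw [mem_ball] at hw
      linarith
    have h2 : (∮ z in C(0, ε), (z - w)⁻¹ • g z) p = ∮ z in C(0, ε), (z - w)⁻¹ • g z p := by
      have := ContinuousLinearMap.intervalIntegral_comp_comm (𝕜 := ℂ)
        (ContinuousMap.evalCLM ℂ p : C(S, F) →L[ℂ] F) (hint2.out)
      simp only [circleIntegral]
      exact this.symm
    rw [ContinuousMap.smul_apply, h2, h1, smul_smul, inv_mul_cancel₀ Complex.two_pi_I_ne_zero,
      one_smul]
  have hA := hps.analyticAt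
  refine (hA.congr ?_).differentiableAt
  filter_upwards [ball_mem_nhds (0 : ℂ) (show (0 : ℝ) < ε from hε)] with w hw using key w hw

/-- By Cauchy's formula in the first variable, f(x, w) is a continuous bilinear pairing of the
kernel ζ ↦ (ζ - x)⁻¹ with the restriction f(·, w) to a circle. The kernel is analytic in x because
inversion in a Banach algebra is, and the restriction is analytic in w by the hypothesis on E with
target C(S, F). This is why `LineAnalytic` quantifies over all complete targets. -/
lemma LineAnalytic.prod {E : Type} [NormedAddCommGroup E] [NormedSpace ℂ E]
    (hE : LineAnalytic E) : LineAnalytic (ℂ × E) := by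
  intro F _ _ _ f U hU hc hd
  rintro ⟨x₀, w₀⟩ hz
  obtain ⟨ε, hε, hεU⟩ : ∃ ε > 0, closedBall (x₀, w₀) ε ⊆ U :=
    nhds_basis_closedBall.mem_iff.mp (hU.mem_nhds hz)
  rw [← closedBall_prod_same] at hεU
  let S := sphere x₀ ε
  let cm : ℝ → S := fun θ => ⟨circleMap x₀ ε θ, circleMap_mem_sphere x₀ hε.le θ⟩
  have hcm : Continuous cm := by
    refine Continuous.subtype_mk (continuous_circleMap _ _) _
  -- the family of restrictions to the circle
  let B : Set E := ball w₀ ε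
  have hcurry : Continuous (fun q : B × S => f (q.2.1, q.1.1)) := by
    refine hc.comp_continuous (by fun_prop) ?_
    rintro ⟨w, ζ⟩
    exact hεU ⟨sphere_subset_closedBall ζ.2, ball_subset_closedBall w.2⟩
  let G : C(B, C(S, F)) := ContinuousMap.curry ⟨_, hcurry⟩
  classical
  let fh : E → C(S, F) := fun w => if h : w ∈ B then G ⟨w, h⟩ else 0
  have hfh : ∀ w (hw : w ∈ B) (ζ : S), fh w ζ = f (ζ.1, w) := by
    intro w hw ζ
    simp only [fh, dif_pos hw]
    rfl
  have hfhc : ContinuousOn fh B := by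
    rw [continuousOn_iff_continuous_domRestrict]
    refine G.continuous.congr ?_
    intro w
    simp only [fh, domRestrict_apply, dif_pos w.2]
  have hfha : AnalyticOnNhd ℂ fh B := by
    refine hE _ fh B isOpen_ball hfhc ?_
    intro w hw v
    have hpre : ∃ η > 0, ∀ s ∈ closedBall (0 : ℂ) η, w + s • v ∈ B := by
      have hcont : Continuous (fun s : ℂ => w + s • v) := by fun_prop
      have : (fun s : ℂ => w + s • v) ⁻¹' B ∈ 𝓝 (0 : ℂ) :=
        (isOpen_ball.preimage hcont).mem_nhds (by simpa [B] using hw)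
      exact nhds_basis_closedBall.mem_iff.mp this
    obtain ⟨η, hη, hηB⟩ := hpre
    refine differentiableAt_of_eval hη (hfhc.comp (by fun_prop) hηB) ?_
    intro ζ s hs
    have hws := hηB s hs
    have h1 := hd (ζ.1, w + s • v) (hεU ⟨sphere_subset_closedBall ζ.2, ball_subset_closedBall hws⟩)
      (0, v)
    have h2 : DifferentiableAt ℂ (fun u : ℂ => f ((ζ.1, w + s • v) + (u - s) • (0, v))) s := by
      have h3 : DifferentiableAt ℂ (fun u : ℂ => u - s) s := by fun_prop
      have h4 : DifferentiableAt ℂ (fun u : ℂ => f ((ζ.1, w + s • v) + u • (0, v))) (s - s) := by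
        simpa using h1
      exact DifferentiableAt.comp (f := fun u : ℂ => u - s)
        (g := fun u : ℂ => f ((ζ.1, w + s • v) + u • (0, v))) s h4 h3
    refine (h2.differentiableWithinAt (s := closedBall 0 η)).congr_of_eventuallyEq_of_mem ?_ hs
    filter_upwards [self_mem_nhdsWithin] with u hu
    rw [hfh _ (hηB u hu)]
    congr 1
    simp [sub_smul]
  -- the Cauchy integral as a bilinear map
  let L : C(S, ℂ) →ₗ[ℂ] C(S, F) →ₗ[ℂ] F := LinearMap.mk₂ ℂ
    (fun k g => ∫ θ in (0 : ℝ)..2 * Real.pi, deriv (circleMap x₀ ε) θ • k (cm θ) • g (cm θ))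
    (fun k k' g => by
      simp only [ContinuousMap.add_apply, add_smul, smul_add]
      refine intervalIntegral.integral_add ?_ ?_ <;>
      · refine Continuous.intervalIntegrable ?_ _ _
        simp only [deriv_circleMap]
        fun_prop)
    (fun c k g => by
      simp only [ContinuousMap.smul_apply, smul_assoc]
      rw [← intervalIntegral.integral_smul]
      congr 1; funext θ; rw [smul_comm])
    (fun k g g' => by
      simp only [ContinuousMap.add_apply, smul_add]
      refine intervalIntegral.integral_add ?_ ?_ <;>
      · refine Continuous.intervalIntegrable ?_ _ _
        simp only [deriv_circleMap]
        fun_prop)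
    (fun c k g => by
      simp only [ContinuousMap.smul_apply]
      rw [← intervalIntegral.integral_smul]
      congr 1; funext θ; rw [smul_comm (k _) c, smul_comm _ c])
  let Lc : C(S, ℂ) →L[ℂ] C(S, F) →L[ℂ] F := LinearMap.mkContinuous₂ L (ε * (2 * Real.pi)) (by
    intro k g
    have : ‖∫ θ in (0 : ℝ)..2 * Real.pi, deriv (circleMap x₀ ε) θ • k (cm θ) • g (cm θ)‖
        ≤ (ε * ‖k‖ * ‖g‖) * |2 * Real.pi - 0| := by
      refine intervalIntegral.norm_integral_le_of_norm_le_const ?_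
      intro θ _
      rw [norm_smul, norm_smul, deriv_circleMap]
      have h1 : ‖circleMap 0 ε θ * Complex.I‖ = ε := by simp [abs_of_pos hε]
      rw [h1, mul_assoc]
      gcongr
      · exact k.norm_coe_le_norm _
      · exact g.norm_coe_le_norm _
    rw [sub_zero, abs_of_pos (by positivity)] at this
    calc _ ≤ _ := this
      _ = _ := by ring)
  -- the Cauchy kernel
  let idS : C(S, ℂ) := ⟨fun ζ => ζ.1, continuous_subtype_val⟩
  let kk : ℂ → C(S, ℂ) := fun x => Ring.inverse (idS - algebraMap ℂ C(S, ℂ) x)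
  have hunit : ∀ x ∈ ball x₀ ε, ∃ u : (C(S, ℂ))ˣ, (u : C(S, ℂ)) = idS - algebraMap ℂ C(S, ℂ) x ∧
      ∀ ζ : S, (↑u⁻¹ : C(S, ℂ)) ζ = (ζ.1 - x)⁻¹ := by
    intro x hx
    have hne : ∀ ζ : S, ζ.1 - x ≠ 0 := by
      intro ζ h0
      rw [sub_eq_zero] at h0
      have := ζ.2
      rw [h0, mem_sphere] at this
      rw [mem_ball] at hx
      linarith
    let inv : C(S, ℂ) := ⟨fun ζ => (ζ.1 - x)⁻¹, by
      exact Continuous.inv₀ (by fun_prop) hne⟩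
    refine ⟨⟨idS - algebraMap ℂ C(S, ℂ) x, inv, ?_, ?_⟩, rfl, fun ζ => rfl⟩
    · ext ζ; exact mul_inv_cancel₀ (hne ζ)
    · ext ζ; exact inv_mul_cancel₀ (hne ζ)
  have hkk : ∀ x ∈ ball x₀ ε, ∀ ζ : S, kk x ζ = (ζ.1 - x)⁻¹ := by
    intro x hx ζ
    obtain ⟨u, hu, hu2⟩ := hunit x hx
    simp only [kk, ← hu, Ring.inverse_unit, hu2]
  have hkka : AnalyticAt ℂ kk x₀ := by
    obtain ⟨u, hu, -⟩ := hunit x₀ (mem_ball_self hε)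
    have h1 : AnalyticAt ℂ Ring.inverse (idS - algebraMap ℂ C(S, ℂ) x₀) := hu ▸ analyticAt_inverse u
    have h2 : AnalyticAt ℂ (fun x : ℂ => idS - algebraMap ℂ C(S, ℂ) x) x₀ := by
      refine analyticAt_const.sub ?_
      exact (ContinuousLinearMap.analyticAt
        (LinearMap.toContinuousLinearMap (Algebra.linearMap ℂ C(S, ℂ))) x₀)
    exact AnalyticAt.fun_comp (f := fun x : ℂ => idS - algebraMap ℂ C(S, ℂ) x) h1 h2
  have hrep : ∀ z ∈ ball x₀ ε ×ˢ B,
      (2 * (Real.pi : ℂ) * Complex.I)⁻¹ • Lc (kk z.1) (fh z.2) = f z := by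
    rintro ⟨x, w⟩ ⟨hx, hw⟩
    have hdx : DifferentiableOn ℂ (fun ζ => f (ζ, w)) (closedBall x₀ ε) := by
      intro ζ hζ
      have h1 := hd (ζ, w) (hεU ⟨hζ, ball_subset_closedBall hw⟩) (1, 0)
      have h3 : DifferentiableAt ℂ (fun u : ℂ => u - ζ) ζ := by fun_prop
      have h4 : DifferentiableAt ℂ (fun u : ℂ => f ((ζ, w) + u • (1, 0))) (ζ - ζ) := by
        simpa using h1
      have h5 := DifferentiableAt.comp (f := fun u : ℂ => u - ζ)
        (g := fun u : ℂ => f ((ζ, w) + u • (1, 0))) ζ h4 h3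
      have h6 : (fun u : ℂ => f ((ζ, w) + u • (1, 0))) ∘ (fun u : ℂ => u - ζ) =
          fun ζ => f (ζ, w) := by
        funext u; simp
      rw [h6] at h5
      exact h5.differentiableWithinAt
    have h1 := hdx.circleIntegral_sub_inv_smul hx
    have h2 : Lc (kk x) (fh w) = ∮ ζ in C(x₀, ε), (ζ - x)⁻¹ • f (ζ, w) := by
      have h3 : Lc (kk x) (fh w) = ∫ θ in (0 : ℝ)..2 * Real.pi,
          deriv (circleMap x₀ ε) θ • kk x (cm θ) • fh w (cm θ) := rfl
      rw [h3, circleIntegral]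
      congr 1
      funext θ
      rw [hkk x hx, hfh w hw]
    simp only
    rw [h2, h1, smul_smul, inv_mul_cancel₀ Complex.two_pi_I_ne_zero, one_smul]
  have hA : AnalyticAt ℂ (fun z : ℂ × E =>
      (2 * (Real.pi : ℂ) * Complex.I)⁻¹ • Lc (kk z.1) (fh z.2)) (x₀, w₀) := by
    refine AnalyticAt.fun_const_smul ?_
    have h1 : AnalyticAt ℂ (fun z : ℂ × E => kk z.1) (x₀, w₀) :=
      AnalyticAt.fun_comp (g := kk) (f := fun z : ℂ × E => z.1) hkka analyticAt_fst
    have h2 : AnalyticAt ℂ (fun z : ℂ × E => fh z.2) (x₀, w₀) :=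
      AnalyticAt.fun_comp (g := fh) (f := fun z : ℂ × E => z.2)
        (hfha w₀ (mem_ball_self hε)) analyticAt_snd
    exact (Lc.analyticAt_bilinear (kk x₀, fh w₀)).comp₂ h1 h2
  refine hA.congr ?_
  filter_upwards [prod_mem_nhds (ball_mem_nhds x₀ hε) (ball_mem_nhds w₀ hε)] with z hz'
    using hrep z hz'

end SemiParabolicHenon

/-! ### Limits, division by a linear form, and inverses of analytic maps along compact sets. -/

namespace SemiParabolicHenon

@[fun_prop]
lemma analyticAt_fst_comp {E F G : Type*} [NormedAddCommGroup E] [NormedSpace ℂ E]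
    [NormedAddCommGroup F] [NormedSpace ℂ F] [NormedAddCommGroup G] [NormedSpace ℂ G]
    {f : E → F × G} {z : E} (hf : AnalyticAt ℂ f z) : AnalyticAt ℂ (fun z => (f z).1) z :=
  analyticAt_fst.comp hf

@[fun_prop]
lemma analyticAt_snd_comp {E F G : Type*} [NormedAddCommGroup E] [NormedSpace ℂ E]
    [NormedAddCommGroup F] [NormedSpace ℂ F] [NormedAddCommGroup G] [NormedSpace ℂ G]
    {f : E → F × G} {z : E} (hf : AnalyticAt ℂ f z) : AnalyticAt ℂ (fun z => (f z).2) z :=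
  analyticAt_snd.comp hf

@[fun_prop]
lemma analyticAt_prodMk {E F G : Type*} [NormedAddCommGroup E] [NormedSpace ℂ E]
    [NormedAddCommGroup F] [NormedSpace ℂ F] [NormedAddCommGroup G] [NormedSpace ℂ G]
    {f : E → F} {g : E → G} {z : E} (hf : AnalyticAt ℂ f z) (hg : AnalyticAt ℂ g z) :
    AnalyticAt ℂ (fun z => (f z, g z)) z :=
  hf.prod hg

section Tools

variable {E : Type} [NormedAddCommGroup E] [NormedSpace ℂ E]
  {F : Type} [NormedAddCommGroup F] [NormedSpace ℂ F]

/-- Weierstrass' theorem holds on each complex line, and the limit is continuous, so `LineAnalytic`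
upgrades it to joint analyticity. -/
lemma LineAnalytic.of_tendstoLocallyUniformlyOn [CompleteSpace F] (hE : LineAnalytic E)
    {f : ℕ → E → F} {g : E → F} {U : Set E} (hU : IsOpen U) (hf : ∀ n, AnalyticOnNhd ℂ (f n) U)
    (h : TendstoLocallyUniformlyOn f g atTop U) : AnalyticOnNhd ℂ g U := by
  refine hE F g U hU (h.continuousOn (Eventually.of_forall fun n => (hf n).continuousOn).frequently)
    fun z hz v => ?_
  have hcont : Continuous (fun s : ℂ => z + s • v) := by fun_prop
  have hV : IsOpen ((fun s : ℂ => z + s • v) ⁻¹' U) := hU.preimage hcont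
  have h1 : TendstoLocallyUniformlyOn (fun n => f n ∘ fun s : ℂ => z + s • v)
      (g ∘ fun s : ℂ => z + s • v) atTop ((fun s : ℂ => z + s • v) ⁻¹' U) :=
    h.comp _ (fun s hs => hs) hcont.continuousOn
  have h2 := h1.differentiableOn (Eventually.of_forall fun n s hs => by
    have h3 : DifferentiableAt ℂ (fun s : ℂ => z + s • v) s := by fun_prop
    exact (DifferentiableAt.comp (f := fun s : ℂ => z + s • v) s
      (hf n _ hs).differentiableAt h3).differentiableWithinAt) hV
  exact h2.differentiableAt (hV.mem_nhds (by simpa using hz))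

lemma LineAnalytic.exists_limit [CompleteSpace F] (hE : LineAnalytic E)
    {f : ℕ → E → F} {U : Set E} (hU : IsOpen U) (hf : ∀ n, AnalyticOnNhd ℂ (f n) U)
    {b : ℕ → ℝ} (hb : Summable b) (h : ∀ n, ∀ z ∈ U, ‖f (n + 1) z - f n z‖ ≤ b n) :
    ∃ g : E → F, AnalyticOnNhd ℂ g U ∧ ∀ z ∈ U, Tendsto (fun n => f n z) atTop (𝓝 (g z)) := by
  have h1 := tendstoUniformlyOn_tsum_nat hb (f := fun n z => f (n + 1) z - f n z) h
  have h2 : ∀ n z, ∑ i ∈ Finset.range n, (f (i + 1) z - f i z) = f n z - f 0 z := fun n z =>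
    Finset.sum_range_sub (fun i => f i z) n
  simp only [h2] at h1
  let d : E → F := fun z => ∑' n, (f (n + 1) z - f n z)
  have hd : AnalyticOnNhd ℂ d U :=
    hE.of_tendstoLocallyUniformlyOn hU (fun n => (hf n).sub (hf 0)) h1.tendstoLocallyUniformlyOn
  refine ⟨fun z => d z + f 0 z, hd.add (hf 0), fun z hz => ?_⟩
  have h3 := (h1.tendsto_at hz).add_const (f 0 z)
  simpa using h3

/-- The quotient of `f` by the linear form `L`, extended to the hyperplane `L = 0` by the derivative
in the direction `e`. -/
noncomputable def quot (L : E →L[ℂ] ℂ) (e : E) (f : E → ℂ) (z : E) : ℂ :=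
  open Classical in if L z = 0 then fderiv ℂ f z e else (L z)⁻¹ * f z

lemma mul_quot {L : E →L[ℂ] ℂ} {e : E} {f : E → ℂ} {z : E} (h : L z = 0 → f z = 0) :
    f z = L z * quot L e f z := by
  unfold quot
  split_ifs with h0
  · rw [h h0, h0, zero_mul]
  · rw [mul_inv_cancel_left₀ h0]

/-- Strict differentiability compares z with its projection z - L(z)e to the hyperplane, where f
vanishes: f(z) - L(z) f'(z₀)e is o(L(z)) uniformly near z₀. -/
lemma continuousAt_quot {L : E →L[ℂ] ℂ} {e : E} (he : L e = 1) {f : E → ℂ} {z₀ : E}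
    (hf : AnalyticAt ℂ f z₀) (h0 : ∀ᶠ z in 𝓝 z₀, L z = 0 → f z = 0) :
    ContinuousAt (quot L e f) z₀ := by
  by_cases hz₀ : L z₀ = 0
  swap
  · have h1 : ContinuousAt (fun z => (L z)⁻¹ * f z) z₀ :=
      (L.continuous.continuousAt.inv₀ hz₀).mul hf.continuousAt
    refine h1.congr ?_
    filter_upwards [L.continuous.continuousAt.eventually_ne hz₀] with z hz
    simp [quot, hz]
  have hq0 : quot L e f z₀ = fderiv ℂ f z₀ e := by simp [quot, hz₀]
  rw [ContinuousAt, hq0, Metric.tendsto_nhds]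
  intro ε hε
  have hd := hf.hasStrictFDerivAt
  have hc : ContinuousAt (fun z => fderiv ℂ f z e) z₀ :=
    (hf.fderiv.continuousAt).clm_apply continuousAt_const
  have hC : 0 < ε / (2 * (‖e‖ + 1)) := by positivity
  have h1 := hd.isLittleO.def hC
  -- points `z` and their projections to the hyperplane
  have hp : Tendsto (fun z : E => (z, z - L z • e)) (𝓝 z₀) (𝓝 (z₀, z₀)) := by
    have : Continuous (fun z : E => (z, z - L z • e)) := by fun_prop
    have h := this.tendsto z₀
    simpa [hz₀] using h
  have hp0 : ∀ᶠ z in 𝓝 z₀, L (z - L z • e) = 0 → f (z - L z • e) = 0 := by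
    have : Continuous (fun z : E => z - L z • e) := by fun_prop
    have h := this.tendsto z₀
    simp only [hz₀, zero_smul, sub_zero] at h
    exact h.eventually h0
  filter_upwards [hp.eventually h1, hp0, (Metric.tendsto_nhds.mp hc) ε hε] with z hz1 hz2 hz3
  unfold quot
  split_ifs with hLz
  · exact hz3
  · have h3 : f (z - L z • e) = 0 := hz2 (by simp [he])
    simp only [h3, sub_zero, sub_sub_cancel, map_smul, norm_smul, smul_eq_mul] at hz1
    have hpos : 0 < ‖L z‖ := norm_pos_iff.mpr hLz
    have h4 : (L z)⁻¹ * f z - fderiv ℂ f z₀ e = (L z)⁻¹ * (f z - L z * fderiv ℂ f z₀ e) := by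
      rw [mul_sub, inv_mul_cancel_left₀ hLz]
    rw [dist_eq_norm, h4, norm_mul, norm_inv]
    calc ‖L z‖⁻¹ * ‖f z - L z * fderiv ℂ f z₀ e‖
        ≤ ‖L z‖⁻¹ * (ε / (2 * (‖e‖ + 1)) * (‖L z‖ * ‖e‖)) := by gcongr
      _ = ε * (‖e‖ / (2 * (‖e‖ + 1))) := by field_simp
      _ < ε * 1 := by
        gcongr
        rw [div_lt_one (by positivity)]
        linarith [norm_nonneg e]
      _ = ε := mul_one ε

/-- As the quotient is continuous, it suffices to look at complex lines. On a line parallel to the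
hyperplane it is a derivative of f or a constant multiple of f; on a transverse line its only
possible singularity is isolated, hence removable. -/
lemma analyticAt_quot (hE : LineAnalytic E) {L : E →L[ℂ] ℂ} {e : E} (he : L e = 1) {f : E → ℂ}
    {z₀ : E} (hf : AnalyticAt ℂ f z₀) (h0 : ∀ᶠ z in 𝓝 z₀, L z = 0 → f z = 0) :
    AnalyticAt ℂ (quot L e f) z₀ := by
  have hev : ∀ᶠ z in 𝓝 z₀, AnalyticAt ℂ f z ∧ ∀ᶠ w in 𝓝 z, L w = 0 → f w = 0 :=
    hf.eventually_analyticAt.and h0.eventually_nhds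
  obtain ⟨U, hU, hUo, hzU⟩ := _root_.eventually_nhds_iff.mp hev
  refine hE ℂ (quot L e f) U hUo
    (fun z hz => (continuousAt_quot he (hU z hz).1 (hU z hz).2).continuousWithinAt)
    (fun z hz v => ?_) z₀ hzU
  have hcl : Continuous (fun s : ℂ => z + s • v) := by fun_prop
  have hAl : ∀ s : ℂ, AnalyticAt ℂ (fun s : ℂ => z + s • v) s := by intro s; fun_prop
  by_cases hLv : L v = 0
  · have hL : ∀ s : ℂ, L (z + s • v) = L z := by intro s; simp [hLv]
    have hfz : AnalyticAt ℂ f (z + (0 : ℂ) • v) := by simpa using (hU z hz).1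
    by_cases hLz : L z = 0
    · have h1 : (fun s : ℂ => quot L e f (z + s • v)) =
          fun s : ℂ => fderiv ℂ f (z + s • v) e := by
        funext s; simp [quot, hL, hLz]
      rw [h1]
      have h2 : AnalyticAt ℂ (fun s : ℂ => fderiv ℂ f (z + s • v)) 0 :=
        AnalyticAt.fun_comp (f := fun s : ℂ => z + s • v) hfz.fderiv (hAl 0)
      exact h2.differentiableAt.clm_apply (differentiableAt_const e)
    · have h1 : (fun s : ℂ => quot L e f (z + s • v)) =
          fun s : ℂ => (L z)⁻¹ * f (z + s • v) := by
        funext s; simp [quot, hL, hLz]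
      rw [h1]
      exact (AnalyticAt.fun_comp (f := fun s : ℂ => z + s • v) hfz
        (hAl 0)).differentiableAt.const_mul _
  · -- the line is transverse to the hyperplane: removable singularity
    have hV : ∀ᶠ s in 𝓝 (0 : ℂ), z + s • v ∈ U :=
      hcl.continuousAt.eventually_mem (by simpa using hUo.mem_nhds hz)
    have hne : ∀ᶠ s in 𝓝[≠] (0 : ℂ), L (z + s • v) ≠ 0 := by
      by_cases hLz : L z = 0
      · filter_upwards [self_mem_nhdsWithin] with s hs
        simpa [hLz, hLv] using hs
      · have : ContinuousAt (fun s : ℂ => L (z + s • v)) 0 := by fun_prop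
        exact (this.eventually_ne (by simpa using hLz)).filter_mono nhdsWithin_le_nhds
    have hA : AnalyticAt ℂ (fun s : ℂ => quot L e f (z + s • v)) 0 := by
      apply Complex.analyticAt_of_differentiable_on_punctured_nhds_of_continuousAt
      · filter_upwards [hne, hV.filter_mono nhdsWithin_le_nhds] with s hs hsU
        have h1 : DifferentiableAt ℂ (fun s : ℂ => (L (z + s • v))⁻¹ * f (z + s • v)) s := by
          have h2 : DifferentiableAt ℂ (fun s : ℂ => f (z + s • v)) s :=
            (AnalyticAt.fun_comp (f := fun s : ℂ => z + s • v) (hU _ hsU).1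
              (hAl s)).differentiableAt
          have h3 : DifferentiableAt ℂ (fun s : ℂ => L (z + s • v)) s := by fun_prop
          exact (h3.fun_inv hs).fun_mul h2
        refine h1.congr_of_eventuallyEq ?_
        have : ContinuousAt (fun s : ℂ => L (z + s • v)) s := by fun_prop
        filter_upwards [this.eventually_ne hs] with u hu
        simp only [quot, if_neg hu]
      · have h1 : ContinuousAt (quot L e f) (z + (0 : ℂ) • v) := by
          simpa using continuousAt_quot he (hU z hz).1 (hU z hz).2
        exact ContinuousAt.comp (f := fun s : ℂ => z + s • v) h1 hcl.continuousAt
    exact hA.differentiableAt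

/-- Division by a linear form along a set. -/
lemma exists_eq_mul (hE : LineAnalytic E) {L : E →L[ℂ] ℂ} {e : E} (he : L e = 1) {f : E → ℂ}
    {K : Set E} (hf : AnalyticOnNhd ℂ f K) (h0 : ∀ᶠ z in 𝓝ˢ K, L z = 0 → f z = 0) :
    ∃ g : E → ℂ, AnalyticOnNhd ℂ g K ∧ ∀ᶠ z in 𝓝ˢ K, f z = L z * g z :=
  ⟨quot L e f, fun z hz => analyticAt_quot hE he (hf z hz) (eventually_nhdsSet_iff_forall.mp h0 z hz),
    h0.mono fun _ hz => mul_quot hz⟩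

lemma isBigO_nhdsSet {α G : Type*} [TopologicalSpace α] [NormedAddCommGroup G] {K : Set α}
    (hK : IsCompact K) {f : α → G} {g : α → ℂ} (h : ∀ z ∈ K, f =O[𝓝 z] g) : f =O[𝓝ˢ K] g := by
  have : ∃ C : ℝ, ∀ᶠ z in 𝓝ˢ K, ‖f z‖ ≤ C * ‖g z‖ := by
    refine hK.induction_on (p := fun s => ∃ C : ℝ, ∀ᶠ z in 𝓝ˢ s, ‖f z‖ ≤ C * ‖g z‖) ⟨0, by simp⟩
      ?_ ?_ ?_
    · rintro s t hst ⟨C, hC⟩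
      exact ⟨C, hC.filter_mono (nhdsSet_mono hst)⟩
    · rintro s t ⟨C, hC⟩ ⟨D, hD⟩
      refine ⟨max C D, ?_⟩
      rw [nhdsSet_union, eventually_sup]
      constructor
      · filter_upwards [hC] with z hz using hz.trans (by gcongr; exact le_max_left _ _)
      · filter_upwards [hD] with z hz using hz.trans (by gcongr; exact le_max_right _ _)
    · intro z hz
      obtain ⟨C, hC⟩ := (h z hz).bound
      obtain ⟨t, ht, hto, hzt⟩ := _root_.eventually_nhds_iff.mp hC
      exact ⟨t, mem_nhdsWithin_of_mem_nhds (hto.mem_nhds hzt), C,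
        mem_of_superset hto.mem_nhdsSet_self fun w hw => ht w hw⟩
  exact this.elim fun C hC => Asymptotics.IsBigO.of_bound C hC

lemma isBigO_one_of_analyticOnNhd {K : Set E} (hK : IsCompact K) {f : E → F}
    (hf : AnalyticOnNhd ℂ f K) : f =O[𝓝ˢ K] (fun _ => (1 : ℂ)) :=
  isBigO_nhdsSet hK fun z hz => (hf z hz).continuousAt.isBigO_one ℂ

/-- The inverse of an analytic map near a compact set on which it is injective and immersive. -/
lemma exists_analytic_inverse [FiniteDimensional ℂ E] {f : E → E} {K : Set E}
    (hK : IsCompact K) (hf : AnalyticOnNhd ℂ f K) (hinj : InjOn f K)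
    (hd : ∀ z ∈ K, ∀ v, fderiv ℂ f z v = 0 → v = 0) :
    ∃ g : E → E, AnalyticOnNhd ℂ g (f '' K) ∧ (∀ᶠ z in 𝓝ˢ K, g (f z) = z) ∧
      ∀ᶠ w in 𝓝ˢ (f '' K), f (g w) = w := by
  have : CompleteSpace E := FiniteDimensional.complete ℂ E
  have key : ∀ z ∈ K, ∃ i : E ≃L[ℂ] E, fderiv ℂ f z = (i : E →L[ℂ] E) := by
    intro z hz
    have hker : LinearMap.ker ((fderiv ℂ f z : E →L[ℂ] E) : E →ₗ[ℂ] E) = ⊥ :=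
      LinearMap.ker_eq_bot'.mpr fun v hv => hd z hz v hv
    refine ⟨(LinearEquiv.ofInjectiveEndo _ (LinearMap.ker_eq_bot.mp hker)).toContinuousLinearEquiv, ?_⟩
    ext v
    rfl
  have hloc : ∀ z ∈ K, ∃ u ∈ 𝓝 z, InjOn f u := by
    intro z hz
    obtain ⟨i, hi⟩ := key z hz
    have hs := (hf z hz).hasStrictFDerivAt
    rw [hi] at hs
    exact ⟨_, (hs.toOpenPartialHomeomorph f).open_source.mem_nhds
      (hs.mem_toOpenPartialHomeomorph_source), (hs.toOpenPartialHomeomorph f).injOn⟩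
  -- Injectivity on the compact set together with local injectivity gives injectivity on a full
  -- neighbourhood, so a single inverse serves there.
  obtain ⟨t, ht, htinj⟩ := hinj.exists_mem_nhdsSet hK (fun z hz => (hf z hz).continuousAt) hloc
  have : Nonempty E := ⟨0⟩
  let g := Function.invFunOn f t
  have hleft : ∀ z ∈ t, g (f z) = z := fun z hz => htinj.leftInvOn_invFunOn hz
  have hmain : ∀ z ∈ K, AnalyticAt ℂ g (f z) ∧ ∀ᶠ w in 𝓝 (f z), f (g w) = w := by
    intro z hz
    obtain ⟨i, hi⟩ := key z hz
    have hs := (hf z hz).hasStrictFDerivAt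
    rw [hi] at hs
    let e := hs.toOpenPartialHomeomorph f
    have hze : z ∈ e.source := hs.mem_toOpenPartialHomeomorph_source
    have hez : e z = f z := rfl
    have hsymm : e.symm (f z) = z := e.left_inv hze
    have hfz : f z ∈ e.target := e.map_source hze
    have hA : AnalyticAt ℂ e.symm (f z) :=
      e.analyticAt_symm (i := i) hfz (by rw [hsymm]; exact hf z hz) (by rw [hsymm]; exact hi)
    have htz : t ∈ 𝓝 z := (mem_nhdsSet_iff_forall.mp ht) z hz
    have hev : ∀ᶠ w in 𝓝 (f z), e.symm w ∈ t ∧ f (e.symm w) = w := by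
      refine (hA.continuousAt.eventually_mem (by rw [hsymm]; exact htz)).and ?_
      filter_upwards [e.open_target.mem_nhds hfz] with w hw using e.right_inv hw
    have heq : ∀ᶠ w in 𝓝 (f z), e.symm w = g w := by
      filter_upwards [hev] with w hw
      conv_rhs => rw [← hw.2]
      exact (hleft _ hw.1).symm
    refine ⟨hA.congr heq, ?_⟩
    filter_upwards [hev, heq] with w h1 h2
    rw [← h2, h1.2]
  refine ⟨g, ?_, ?_, ?_⟩
  · rintro _ ⟨z, hz, rfl⟩
    exact (hmain z hz).1
  · exact mem_of_superset ht hleft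
  · rw [eventually_nhdsSet_iff_forall]
    rintro _ ⟨z, hz, rfl⟩
    exact (hmain z hz).2

end Tools

end SemiParabolicHenon

/-! ### Linear cohomological equations and the linearizing parametrization of the strong stable
manifolds. -/

namespace SemiParabolicHenon

lemma lineAnalytic_three : LineAnalytic (ℂ × ℂ × ℂ) := lineAnalytic_complex.prod.prod

lemma lineAnalytic_four : LineAnalytic (ℂ × ℂ × ℂ × ℂ) := lineAnalytic_complex.prod.prod.prod

/-- The compact set `a = 0`, `l = lam`, `|Y| ≤ r` of the space of triples `(a, l, Y)`. -/
def disk₃ (lam : ℂ) (r : ℝ) : Set (ℂ × ℂ × ℂ) := {0} ×ˢ {lam} ×ˢ closedBall 0 r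

lemma mem_disk₃ {lam : ℂ} {r : ℝ} {z : ℂ × ℂ × ℂ} :
    z ∈ disk₃ lam r ↔ z.1 = 0 ∧ z.2.1 = lam ∧ ‖z.2.2‖ ≤ r := by
  simp [disk₃, mem_prod]

/-- The linear model `Y ↦ ν Y` of the dynamics on the strong stable manifold. -/
noncomputable def contr (z : ℂ × ℂ × ℂ) : ℂ × ℂ × ℂ := (z.1, z.2.1, nu z.2.1 z.1 * z.2.2)

lemma analyticAt_nu {E : Type*} [NormedAddCommGroup E] [NormedSpace ℂ E] {f g : E → ℂ} {z : E}
    (hf : AnalyticAt ℂ f z) (hg : AnalyticAt ℂ g z) (h : f z ≠ 0) :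
    AnalyticAt ℂ (fun z => nu (f z) (g z)) z := by
  unfold nu
  exact ((hg.pow 2).neg).div hf h

lemma analyticAt_contr {z : ℂ × ℂ × ℂ} (h : z.2.1 ≠ 0) : AnalyticAt ℂ contr z := by
  have h1 : AnalyticAt ℂ (fun z : ℂ × ℂ × ℂ => nu z.2.1 z.1) z :=
    analyticAt_nu (by fun_prop) (by fun_prop) h
  unfold contr
  exact analyticAt_fst.prod ((analyticAt_fst.comp analyticAt_snd).prod
    (h1.mul (analyticAt_snd.comp analyticAt_snd)))

lemma contr_mem {lam : ℂ} {r : ℝ} {z : ℂ × ℂ × ℂ} (hz : z ∈ disk₃ lam r) :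
    contr z = (0, lam, 0) := by
  obtain ⟨h1, h2, -⟩ := mem_disk₃.mp hz
  simp [contr, h1, h2, nu]

lemma tendsto_contr {lam : ℂ} (hl : lam ≠ 0) {r : ℝ} :
    Tendsto contr (𝓝ˢ (disk₃ lam r)) (𝓝 (0, lam, 0)) := by
  intro s hs
  rw [mem_map, mem_nhdsSet_iff_forall]
  intro z hz
  have h := (analyticAt_contr (z := z) ((mem_disk₃.mp hz).2.1 ▸ hl)).continuousAt
  exact h (by rw [contr_mem hz]; exact hs)

lemma nu_zero (l : ℂ) : nu l 0 = 0 := by simp [nu]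

lemma norm_nu_mul_le {l a Y : ℂ} (h : ‖nu l a‖ ≤ 1) : ‖nu l a * Y‖ ≤ ‖Y‖ := by
  rw [norm_mul]
  exact mul_le_of_le_one_left (norm_nonneg _) h

/-- A ball around `(0, lam, 0)` on which `Y ↦ ν Y` is a self-map. -/
lemma contr_mem_ball {lam : ℂ} {ε : ℝ} {z : ℂ × ℂ × ℂ} (hν : ‖nu z.2.1 z.1‖ ≤ 1)
    (hz : z ∈ ball ((0 : ℂ), lam, (0 : ℂ)) ε) : contr z ∈ ball ((0 : ℂ), lam, (0 : ℂ)) ε := by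
  simp only [mem_ball, Prod.dist_eq, sup_lt_iff, contr, dist_zero_right] at hz ⊢
  exact ⟨hz.1, hz.2.1, (norm_nu_mul_le hν).trans_lt hz.2.2⟩

/-- The solution is u = ∑ l^(kn) R∘`contr`^n. Since |R| ≤ C|Y| and |l^k ν| < 1/2 near (0, λ, 0), the
terms are bounded by C 2^(-n)|Y| on a small ball. The condition R = 0 at Y = 0 is essential: without
it there is no decay when |l^k| = 1. -/
lemma exists_cohomological {lam : ℂ} (hl : lam ≠ 0) {r : ℝ} (hr : 0 ≤ r) (k : ℕ)
    {R : ℂ × ℂ × ℂ → ℂ} (hR : AnalyticOnNhd ℂ R (disk₃ lam r))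
    (hR0 : ∀ᶠ z in 𝓝ˢ (disk₃ lam r), z.2.2 = 0 → R z = 0) :
    ∃ u : ℂ × ℂ × ℂ → ℂ, AnalyticOnNhd ℂ u (disk₃ lam r) ∧
      (∀ᶠ z in 𝓝ˢ (disk₃ lam r), u z - z.2.1 ^ k * u (contr z) = R z) ∧
      ∀ᶠ z in 𝓝ˢ (disk₃ lam r), z.2.2 = 0 → u z = 0 := by
  set z₀ : ℂ × ℂ × ℂ := (0, lam, 0) with hz₀
  have hz₀K : z₀ ∈ disk₃ lam r := mem_disk₃.mpr ⟨rfl, rfl, by simpa [z₀] using hr⟩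
  have hRz : AnalyticAt ℂ R z₀ := hR z₀ hz₀K
  -- the bound `|R| ≤ C |Y|`
  obtain ⟨C, hC0, hC⟩ : ∃ C ≥ 0, ∀ᶠ z in 𝓝 z₀, ‖R z‖ ≤ C * ‖z.2.2‖ := by
    obtain ⟨g, hg, hRg⟩ := exists_eq_mul lineAnalytic_three
      (L := (ContinuousLinearMap.snd ℂ ℂ ℂ).comp (ContinuousLinearMap.snd ℂ ℂ (ℂ × ℂ)))
      (e := (0, 0, 1)) (by simp) hR hR0
    have hb := (hg z₀ hz₀K).continuousAt.norm.eventually_le_const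
      (show ‖g z₀‖ < ‖g z₀‖ + 1 by linarith)
    refine ⟨‖g z₀‖ + 1, by positivity, ?_⟩
    filter_upwards [hb, eventually_nhdsSet_iff_forall.mp hRg z₀ hz₀K] with z h1 h2
    rw [h2, norm_mul, mul_comm]
    gcongr
    simp
  have hνan : AnalyticAt ℂ (fun z : ℂ × ℂ × ℂ => nu z.2.1 z.1) z₀ :=
    analyticAt_nu (by fun_prop) (by fun_prop) hl
  have hν1 : ∀ᶠ z in 𝓝 z₀, ‖nu z.2.1 z.1‖ < 1 :=
    hνan.continuousAt.norm.eventually_lt_const (by simp [z₀, nu])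
  have hν2 : ∀ᶠ z in 𝓝 z₀, ‖z.2.1 ^ k * nu z.2.1 z.1‖ < 1 / 2 := by
    have : ContinuousAt (fun z : ℂ × ℂ × ℂ => z.2.1 ^ k * nu z.2.1 z.1) z₀ :=
      ContinuousAt.mul (by fun_prop) hνan.continuousAt
    exact this.norm.eventually_lt_const (by simp [z₀, nu])
  have hl0 : ∀ᶠ z in 𝓝 z₀, z.2.1 ≠ 0 := by
    have : ContinuousAt (fun z : ℂ × ℂ × ℂ => z.2.1) z₀ := by fun_prop
    exact this.eventually_ne hl
  obtain ⟨ε, hε, hball⟩ := Metric.eventually_nhds_iff_ball.mp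
    ((hν1.and hν2).and (hl0.and (hC.and
      (hRz.eventually_analyticAt.and (eventually_nhdsSet_iff_forall.mp hR0 z₀ hz₀K)))))
  set U := ball z₀ ε
  have hmU : ∀ z ∈ U, contr z ∈ U := fun z hz => contr_mem_ball (hball z hz).1.1.le hz
  -- the successive approximations
  let f : ℕ → ℂ × ℂ × ℂ → ℂ := fun n => Nat.rec (fun _ => 0)
    (fun _ g z => R z + z.2.1 ^ k * g (contr z)) n
  have hfs : ∀ n z, f (n + 1) z = R z + z.2.1 ^ k * f n (contr z) := fun n z => rfl
  have hfa : ∀ n, AnalyticOnNhd ℂ (f n) U := by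
    intro n
    induction n with
    | zero => exact analyticOnNhd_const
    | succ n ih =>
      intro z hz
      have h1 : AnalyticAt ℂ (fun z => f n (contr z)) z :=
        AnalyticAt.fun_comp (ih _ (hmU z hz)) (analyticAt_contr (hball z hz).2.1)
      have h2 : AnalyticAt ℂ (fun z : ℂ × ℂ × ℂ => z.2.1 ^ k) z := by fun_prop
      exact (hball z hz).2.2.2.1.add (h2.mul h1)
  have hd : ∀ n, ∀ z ∈ U, ‖f (n + 1) z - f n z‖ ≤ C * (1 / 2) ^ n * ‖z.2.2‖ := by
    intro n
    induction n with
    | zero =>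
      intro z hz
      have : f (0 + 1) z - f 0 z = R z := by
        rw [hfs 0]; simp [f]
      rw [this]
      simpa using (hball z hz).2.2.1
    | succ n ih =>
      intro z hz
      have : f (n + 1 + 1) z - f (n + 1) z =
          z.2.1 ^ k * (f (n + 1) (contr z) - f n (contr z)) := by
        rw [hfs (n + 1), hfs n]; ring
      rw [this, norm_mul]
      calc ‖z.2.1 ^ k‖ * ‖f (n + 1) (contr z) - f n (contr z)‖
          ≤ ‖z.2.1 ^ k‖ * (C * (1 / 2) ^ n * ‖nu z.2.1 z.1 * z.2.2‖) := by
            gcongr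
            exact ih _ (hmU z hz)
        _ = C * (1 / 2) ^ n * ‖z.2.1 ^ k * nu z.2.1 z.1‖ * ‖z.2.2‖ := by
            rw [norm_mul, norm_mul]; ring
        _ ≤ C * (1 / 2) ^ n * (1 / 2) * ‖z.2.2‖ := by
            gcongr
            exact (hball z hz).1.2.le
        _ = _ := by ring
  have hY : ∀ z ∈ U, ‖z.2.2‖ ≤ ε := by
    intro z hz
    simp only [U, z₀, mem_ball, Prod.dist_eq, sup_lt_iff, dist_zero_right] at hz
    exact hz.2.2.le
  obtain ⟨v, hva, hvt⟩ := lineAnalytic_three.exists_limit isOpen_ball hfa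
    (b := fun n => C * (1 / 2) ^ n * ε)
    ((summable_geometric_two.mul_left C).mul_right ε) (fun n z hz => (hd n z hz).trans (by
      gcongr
      exact hY z hz))
  have hveq : ∀ z ∈ U, v z = R z + z.2.1 ^ k * v (contr z) := by
    intro z hz
    have h1 := (hvt z hz).comp (tendsto_add_atTop_nat 1)
    have h2 := ((hvt _ (hmU z hz)).const_mul (z.2.1 ^ k)).const_add (R z)
    exact tendsto_nhds_unique h1 h2
  have hv0 : ∀ z ∈ U, z.2.2 = 0 → v z = 0 := by
    intro z hz hz0
    have : ∀ n, ∀ z ∈ U, z.2.2 = 0 → f n z = 0 := by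
      intro n
      induction n with
      | zero => intros; rfl
      | succ n ih =>
        intro z hz hz0
        rw [hfs, (hball z hz).2.2.2.2 hz0, ih _ (hmU z hz) (by simp [contr, hz0])]
        simp
    refine tendsto_nhds_unique (hvt z hz) ?_
    simp [this _ z hz hz0]
  have hUn : U ∈ 𝓝 z₀ := ball_mem_nhds z₀ hε
  have hcU : ∀ᶠ z in 𝓝ˢ (disk₃ lam r), contr z ∈ U := (tendsto_contr hl).eventually_mem hUn
  -- The series is only controlled on the ball U. As `contr` maps a neighbourhood of the whole disk
  -- into U, the equation itself defines u on that neighbourhood.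
  refine ⟨fun z => R z + z.2.1 ^ k * v (contr z), ?_, ?_, ?_⟩
  · intro z hz
    have h1 : AnalyticAt ℂ (fun z => v (contr z)) z := by
      refine AnalyticAt.fun_comp ?_ (analyticAt_contr ((mem_disk₃.mp hz).2.1 ▸ hl))
      rw [contr_mem hz]
      exact hva z₀ (mem_ball_self hε)
    have h2 : AnalyticAt ℂ (fun z : ℂ × ℂ × ℂ => z.2.1 ^ k) z := by fun_prop
    exact (hR z hz).add (h2.mul h1)
  · filter_upwards [hcU] with z hz
    rw [hveq _ hz]
    ring
  · filter_upwards [hcU, hR0] with z hz hz2 hz0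
    rw [hz2 hz0, hv0 _ hz (by simp [contr, hz0])]
    simp

/-- The right-hand side of the functional equation of the linearizing parametrization. -/
noncomputable def etaOp (g : ℂ × ℂ × ℂ → ℂ) (z : ℂ × ℂ × ℂ) : ℂ :=
  ((z.2.1 + nu z.2.1 z.1) * g (contr z) - nu z.2.1 z.1 * g (contr (contr z))) / z.2.1
    - z.1 / z.2.1 ^ 2 * z.2.2 * g (contr z) ^ 2

lemma analyticAt_etaOp {g : ℂ × ℂ × ℂ → ℂ} {z : ℂ × ℂ × ℂ} (hz : z.2.1 ≠ 0)
    (h1 : AnalyticAt ℂ g (contr z)) (h2 : AnalyticAt ℂ g (contr (contr z))) :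
    AnalyticAt ℂ (etaOp g) z := by
  have hν : AnalyticAt ℂ (fun z : ℂ × ℂ × ℂ => nu z.2.1 z.1) z :=
    analyticAt_nu (by fun_prop) (by fun_prop) hz
  have h3 : AnalyticAt ℂ (fun z => g (contr z)) z := AnalyticAt.fun_comp h1 (analyticAt_contr hz)
  have h4 : AnalyticAt ℂ (fun z => g (contr (contr z))) z :=
    AnalyticAt.fun_comp (g := g) (f := fun z => contr (contr z)) h2
      (AnalyticAt.fun_comp (g := contr) (f := contr) (analyticAt_contr hz) (analyticAt_contr hz))
  have h5 : AnalyticAt ℂ (fun z : ℂ × ℂ × ℂ => z.2.1) z := by fun_prop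
  have h6 : AnalyticAt ℂ (fun z : ℂ × ℂ × ℂ => z.1) z := by fun_prop
  have h7 : AnalyticAt ℂ (fun z : ℂ × ℂ × ℂ => z.2.2) z := by fun_prop
  exact ((((h5.add hν).mul h3).sub (hν.mul h4)).div h5 hz).sub
    (((h6.div (h5.pow 2) (pow_ne_zero 2 hz)).mul h7).mul (h3.pow 2))

/-- With κ the first coordinate of the fixed point, put P(Y) = (κ - (a/l) Y η(νY), aκ + Y η(Y)). In
H(P(Y)) = P(νY) the second coordinate is automatic because ν = -a²/l. The first one, divided by aY,
becomes η = `etaOp` η, which still makes sense at a = 0. The operator does not contract constants,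
but differences of iterates are O(Y), and evaluating them at νY gains the factor |ν| ≤ 1/32. -/
lemma exists_eta {lam : ℂ} (hl : ‖lam‖ = 1) (r : ℝ) :
    ∃ η : ℂ × ℂ × ℂ → ℂ, AnalyticOnNhd ℂ η (disk₃ lam r) ∧
      (∀ᶠ z in 𝓝ˢ (disk₃ lam r), η z = etaOp η z) ∧
      (∀ᶠ z in 𝓝ˢ (disk₃ lam r), z.2.2 = 0 → η z = 1) ∧
      ∀ᶠ z in 𝓝ˢ (disk₃ lam r), z.1 = 0 → η z = 1 := by
  have hl0 : lam ≠ 0 := by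
    rintro rfl
    simp at hl
  set z₀ : ℂ × ℂ × ℂ := (0, lam, 0) with hz₀
  set U := ball z₀ (1 / 8 : ℝ)
  have hU : ∀ z ∈ U, ‖z.1‖ ≤ 1 / 8 ∧ 7 / 8 ≤ ‖z.2.1‖ ∧ ‖z.2.1‖ ≤ 9 / 8 ∧ ‖z.2.2‖ ≤ 1 / 8 := by
    intro z hz
    simp only [U, z₀, mem_ball, Prod.dist_eq, sup_lt_iff, dist_zero_right] at hz
    rw [dist_eq_norm] at hz
    have h1 := norm_sub_norm_le z.2.1 lam
    have h2 := norm_sub_norm_le lam z.2.1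
    rw [norm_sub_rev] at h2
    exact ⟨hz.1.le, by linarith, by linarith, hz.2.2.le⟩
  have hne : ∀ z ∈ U, z.2.1 ≠ 0 := fun z hz h0 => by
    have := (hU z hz).2.1
    rw [h0] at this
    norm_num at this
  have hν : ∀ z ∈ U, ‖nu z.2.1 z.1‖ ≤ 1 / 32 := by
    intro z hz
    obtain ⟨h1, h2, -, -⟩ := hU z hz
    rw [nu, norm_div, norm_neg, norm_pow, div_le_iff₀ (by linarith)]
    nlinarith [norm_nonneg z.1]
  have hmU : ∀ z ∈ U, contr z ∈ U := fun z hz =>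
    contr_mem_ball ((hν z hz).trans (by norm_num)) hz
  have hinv : ∀ z ∈ U, ‖z.2.1‖⁻¹ ≤ 2 := by
    intro z hz
    obtain ⟨-, h2, -, -⟩ := hU z hz
    rw [inv_le_comm₀ (by linarith) (by norm_num)]
    linarith
  let f : ℕ → ℂ × ℂ × ℂ → ℂ := fun n => Nat.rec (fun _ => 1) (fun _ g => etaOp g) n
  have hfs : ∀ n, f (n + 1) = etaOp (f n) := fun n => rfl
  have hfa : ∀ n, AnalyticOnNhd ℂ (f n) U := by
    intro n
    induction n with
    | zero => exact analyticOnNhd_const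
    | succ n ih =>
      intro z hz
      rw [hfs]
      exact analyticAt_etaOp (hne z hz) (ih _ (hmU z hz)) (ih _ (hmU _ (hmU z hz)))
  -- The two bounds support each other: the distance to 1, a partial sum of the geometric series of
  -- increments, keeps the iterates bounded by 2, which controls the quadratic term in the next
  -- increment.
  have hd : ∀ n, (∀ z ∈ U, ‖f n z - 1‖ ≤ (2 - 2 * (1 / 2) ^ n) * ‖z.2.2‖) ∧
      ∀ z ∈ U, ‖f (n + 1) z - f n z‖ ≤ (1 / 2) ^ n * ‖z.2.2‖ := by
    intro n
    induction n with
    | zero =>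
      refine ⟨fun z hz => by simp [f], fun z hz => ?_⟩
      have : f (0 + 1) z - f 0 z = -(z.1 / z.2.1 ^ 2 * z.2.2) := by
        have := hne z hz
        have h1 : ∀ z, f 0 z = 1 := fun z => rfl
        rw [hfs 0]
        simp only [etaOp, h1]
        field_simp
        ring
      rw [this, norm_neg, norm_mul, norm_div, norm_pow, div_eq_mul_inv, ← inv_pow]
      have h1 := hinv z hz
      have h2 := (hU z hz).1
      have h0 : 0 ≤ ‖z.2.1‖⁻¹ := by positivity
      calc ‖z.1‖ * ‖z.2.1‖⁻¹ ^ 2 * ‖z.2.2‖ ≤ 1 / 8 * 2 ^ 2 * ‖z.2.2‖ := by gcongr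
        _ ≤ (1 / 2) ^ 0 * ‖z.2.2‖ := by
          gcongr; norm_num
    | succ n ih =>
      obtain ⟨ih1, ih2⟩ := ih
      have hb : ∀ n, (∀ z ∈ U, ‖f n z - 1‖ ≤ (2 - 2 * (1 / 2) ^ n) * ‖z.2.2‖) →
          ∀ z ∈ U, ‖f n z‖ ≤ 2 := by
        intro n h z hz
        have h1 := h z hz
        have h2 := (hU z hz).2.2.2
        have h3 : ‖f n z‖ ≤ ‖f n z - 1‖ + 1 := by
          have := norm_add_le (f n z - 1) 1
          simpa using this
        have h4 : (0 : ℝ) < (1 / 2) ^ n := by positivity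
        nlinarith [norm_nonneg z.2.2]
      have hA : ∀ z ∈ U, ‖f (n + 1) z - 1‖ ≤ (2 - 2 * (1 / 2) ^ (n + 1)) * ‖z.2.2‖ := by
        intro z hz
        have h1 := norm_add_le (f (n + 1) z - f n z) (f n z - 1)
        rw [sub_add_sub_cancel] at h1
        have h2 := ih1 z hz
        have h3 := ih2 z hz
        rw [pow_succ]
        linarith
      refine ⟨hA, fun z hz => ?_⟩
      have e : f (n + 1 + 1) z - f (n + 1) z =
          ((z.2.1 + nu z.2.1 z.1) * (f (n + 1) (contr z) - f n (contr z))
            - nu z.2.1 z.1 * (f (n + 1) (contr (contr z)) - f n (contr (contr z)))) * z.2.1⁻¹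
          - z.1 * z.2.1⁻¹ ^ 2 * z.2.2 * ((f (n + 1) (contr z) - f n (contr z)) *
            (f (n + 1) (contr z) + f n (contr z))) := by
        rw [congrFun (hfs (n + 1)) z, congrFun (hfs n) z]
        simp only [etaOp]
        have := hne z hz
        field_simp
        ring
      obtain ⟨u1, u2, u3, u4⟩ := hU z hz
      have hν' := hν z hz
      set ν := nu z.2.1 z.1
      have d1 : ‖f (n + 1) (contr z) - f n (contr z)‖ ≤ (1 / 2) ^ n * (1 / 32 * ‖z.2.2‖) := by
        refine (ih2 _ (hmU z hz)).trans ?_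
        simp only [contr, norm_mul]
        gcongr
      have d2 : ‖f (n + 1) (contr (contr z)) - f n (contr (contr z))‖ ≤
          (1 / 2) ^ n * (1 / 32 * ‖z.2.2‖) := by
        refine (ih2 _ (hmU _ (hmU z hz))).trans ?_
        simp only [contr, norm_mul]
        refine mul_le_mul_of_nonneg_left ?_ (by positivity)
        calc ‖nu z.2.1 z.1‖ * (‖nu z.2.1 z.1‖ * ‖z.2.2‖) ≤ 1 * (1 / 32 * ‖z.2.2‖) := by
              gcongr
              exact hν'.trans (by norm_num)
          _ = _ := one_mul _
      have d3 : ‖f (n + 1) (contr z) + f n (contr z)‖ ≤ 4 := by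
        refine (norm_add_le _ _).trans ?_
        have := hb (n + 1) hA _ (hmU z hz)
        have := hb n ih1 _ (hmU z hz)
        linarith
      have hi := hinv z hz
      have hsum : ‖z.2.1 + ν‖ ≤ 9 / 8 + 1 / 32 := (norm_add_le _ _).trans (by linarith)
      rw [e]
      refine (norm_sub_le _ _).trans ?_
      rw [norm_mul, norm_mul, norm_mul, norm_mul, norm_mul, norm_pow, norm_inv]
      set Q := (1 / 2 : ℝ) ^ n * (1 / 32 * ‖z.2.2‖) with hQ
      have hQ0 : 0 ≤ Q := by positivity
      have t1 : ‖(z.2.1 + ν) * (f (n + 1) (contr z) - f n (contr z))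
            - ν * (f (n + 1) (contr (contr z)) - f n (contr (contr z)))‖ ≤
          (9 / 8 + 1 / 32) * Q + 1 / 32 * Q := by
        refine (norm_sub_le _ _).trans ?_
        rw [norm_mul, norm_mul]
        gcongr
      calc _ ≤ ((9 / 8 + 1 / 32) * Q + 1 / 32 * Q) * 2 + 1 / 8 * 2 ^ 2 * (1 / 8) * (Q * 4) := by
            gcongr
        _ ≤ 16 * Q := by linarith
        _ = (1 / 2) ^ (n + 1) * ‖z.2.2‖ := by rw [hQ]; ring
  obtain ⟨v, hva, hvt⟩ := lineAnalytic_three.exists_limit isOpen_ball hfa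
    (b := fun n => (1 / 2) ^ n) summable_geometric_two (fun n z hz => ((hd n).2 z hz).trans (by
      have := (hU z hz).2.2.2
      exact mul_le_of_le_one_right (by positivity) (by linarith)))
  have hveq : ∀ z ∈ U, v z = etaOp v z := by
    intro z hz
    have h1 := (hvt z hz).comp (tendsto_add_atTop_nat 1)
    have h2 := hvt _ (hmU z hz)
    have h3 := hvt _ (hmU _ (hmU z hz))
    have h4 : Tendsto (fun n => etaOp (f n) z) atTop (𝓝 (etaOp v z)) :=
      (((h2.const_mul _).sub (h3.const_mul _)).div_const _).sub ((h2.pow 2).const_mul _)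
    exact tendsto_nhds_unique h1 h4
  have hv0 : ∀ z ∈ U, z.2.2 = 0 → v z = 1 := by
    intro z hz hz0
    refine tendsto_nhds_unique (hvt z hz) ?_
    have : ∀ n, f n z = 1 := by
      intro n
      have := (hd n).1 z hz
      rw [hz0, norm_zero, mul_zero, norm_le_zero_iff, sub_eq_zero] at this
      exact this
    simp [this]
  have hzU : z₀ ∈ U := mem_ball_self (by norm_num)
  have hcU : ∀ᶠ z in 𝓝ˢ (disk₃ lam r), contr z ∈ U :=
    (tendsto_contr hl0).eventually_mem (ball_mem_nhds z₀ (by norm_num))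
  have hlU : ∀ᶠ z in 𝓝ˢ (disk₃ lam r), z.2.1 ≠ 0 := by
    rw [eventually_nhdsSet_iff_forall]
    intro z hz
    have : ContinuousAt (fun z : ℂ × ℂ × ℂ => z.2.1) z := by fun_prop
    exact this.eventually_ne ((mem_disk₃.mp hz).2.1 ▸ hl0)
  -- `etaOp v` evaluates v only at the first and second images under `contr`, which lie in U for all
  -- points near the disk; so it extends v along the disk.
  refine ⟨etaOp v, ?_, ?_, ?_, ?_⟩
  · intro z hz
    have hz1 := contr_mem hz
    have hz2 : contr (contr z) = z₀ := by
      rw [hz1]; simp [contr, nu, z₀]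
    exact analyticAt_etaOp ((mem_disk₃.mp hz).2.1 ▸ hl0) (by rw [hz1]; exact hva z₀ hzU)
      (by rw [hz2]; exact hva z₀ hzU)
  · filter_upwards [hcU] with z hz
    simp only [etaOp]
    have h1 := hveq _ hz
    have h2 := hveq _ (hmU _ hz)
    simp only [etaOp] at h1 h2
    rw [← h1, ← h2]
  · filter_upwards [hcU, hlU] with z hz hz1 hz0
    have h1 := hv0 _ hz (by simp [contr, hz0])
    have h2 := hv0 _ (hmU _ hz) (by simp [contr, hz0])
    rw [etaOp, h1, h2, hz0]
    field_simp
    ring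
  · filter_upwards [hcU, hlU] with z hz hz1 hz0
    have h1 := hv0 _ hz (by simp [contr, hz0, nu])
    have h2 := hv0 _ (hmU _ hz) (by simp [contr, hz0, nu])
    rw [etaOp, h1, h2, hz0, nu_zero]
    field_simp
    ring

end SemiParabolicHenon

/-! ### Straightening of the strong stable manifolds. -/

namespace SemiParabolicHenon

lemma tendsto_nhdsSet_of_mapsTo {α β : Type*} [TopologicalSpace α] [TopologicalSpace β]
    {f : α → β} {K : Set α} {K' : Set β} (hc : ∀ z ∈ K, ContinuousAt f z) (hm : MapsTo f K K') :
    Tendsto f (𝓝ˢ K) (𝓝ˢ K') := by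
  intro s hs
  rw [mem_map, mem_nhdsSet_iff_forall]
  intro z hz
  exact hc z hz (mem_nhdsSet_iff_forall.mp hs _ (hm hz))

/-- The compact set `a = 0`, `l = lam`, `x = x₀`, `|y| ≤ r` of the space of quadruples
`(a, l, x, y)`. -/
def cyl (lam x₀ : ℂ) (r : ℝ) : Set (ℂ × ℂ × ℂ × ℂ) := {0} ×ˢ {lam} ×ˢ {x₀} ×ˢ closedBall 0 r

lemma isCompact_cyl (lam x₀ : ℂ) (r : ℝ) : IsCompact (cyl lam x₀ r) :=
  isCompact_singleton.prod (isCompact_singleton.prod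
    (isCompact_singleton.prod (isCompact_closedBall 0 r)))

lemma mem_cyl {lam x₀ : ℂ} {r : ℝ} {z : ℂ × ℂ × ℂ × ℂ} :
    z ∈ cyl lam x₀ r ↔ z.1 = 0 ∧ z.2.1 = lam ∧ z.2.2.1 = x₀ ∧ ‖z.2.2.2‖ ≤ r := by
  simp [cyl, mem_prod]

/-- Forgetting the coordinate `x`. -/
def dropX (z : ℂ × ℂ × ℂ × ℂ) : ℂ × ℂ × ℂ := (z.1, z.2.1, z.2.2.2)

@[fun_prop]
lemma analyticAt_dropX (z : ℂ × ℂ × ℂ × ℂ) : AnalyticAt ℂ dropX z := by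
  unfold dropX; fun_prop

lemma mapsTo_dropX (lam x₀ : ℂ) (r : ℝ) : MapsTo dropX (cyl lam x₀ r) (disk₃ lam r) := by
  intro z hz
  rw [mem_cyl] at hz
  exact mem_disk₃.mpr ⟨hz.1, hz.2.1, hz.2.2.2⟩

lemma tendsto_dropX (lam x₀ : ℂ) (r : ℝ) :
    Tendsto dropX (𝓝ˢ (cyl lam x₀ r)) (𝓝ˢ (disk₃ lam r)) :=
  tendsto_nhdsSet_of_mapsTo (fun z _ => (analyticAt_dropX z).continuousAt) (mapsTo_dropX lam x₀ r)

lemma eventually_ne_zero_cyl {lam : ℂ} (hl : lam ≠ 0) (x₀ : ℂ) (r : ℝ) :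
    ∀ᶠ z in 𝓝ˢ (cyl lam x₀ r), z.2.1 ≠ 0 := by
  rw [eventually_nhdsSet_iff_forall]
  intro z hz
  have : ContinuousAt (fun z : ℂ × ℂ × ℂ × ℂ => z.2.1) z := by fun_prop
  exact this.eventually_ne ((mem_cyl.mp hz).2.1 ▸ hl)

/-- The family of all Hénon maps `henonOn l a` as one map. -/
noncomputable def henonFam (z : ℂ × ℂ × ℂ × ℂ) : ℂ × ℂ × ℂ × ℂ :=
  (z.1, z.2.1, henonOn z.2.1 z.1 z.2.2)

lemma analyticAt_henonFam {z : ℂ × ℂ × ℂ × ℂ} (hz : z.2.1 ≠ 0) : AnalyticAt ℂ henonFam z := by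
  unfold henonFam henonOn henon cParam
  have h2 : AnalyticAt ℂ (fun z : ℂ × ℂ × ℂ × ℂ => z.1 ^ 2 / (2 * z.2.1)) z :=
    AnalyticAt.div (by fun_prop) (by fun_prop) (by simpa using hz)
  fun_prop

lemma henonFam_mem {lam : ℂ} {x₀ : ℂ} (hx : x₀ = lam / 2) {r : ℝ} {z : ℂ × ℂ × ℂ × ℂ}
    (hz : z ∈ cyl lam x₀ r) : henonFam z = (0, lam, lam / 2, 0) := by
  obtain ⟨h1, h2, h3, -⟩ := mem_cyl.mp hz
  simp only [henonFam, henonOn, henon, cParam, h1, h2, h3, hx]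
  ext <;> simp

/-- A map preserving the parameters (a, l) has its kernel directions inside the fibre, so
immersivity may be tested on fibre directions only. -/
lemma injective_fderiv_of_fibered {f : ℂ × ℂ × ℂ × ℂ → ℂ × ℂ × ℂ × ℂ} {z : ℂ × ℂ × ℂ × ℂ}
    (hf : AnalyticAt ℂ f z) (h1 : ∀ᶠ w in 𝓝 z, (f w).1 = w.1 ∧ (f w).2.1 = w.2.1)
    (h2 : ∀ v : ℂ × ℂ, HasDerivAt (fun s : ℂ => f (z + s • (0, 0, v))) 0 0 → v = 0) :
    ∀ v, fderiv ℂ f z v = 0 → v = 0 := by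
  intro v hv
  have hd := hf.differentiableAt.hasFDerivAt
  have e1 : fderiv ℂ (fun w => (f w).1) z = fderiv ℂ (fun w : ℂ × ℂ × ℂ × ℂ => w.1) z :=
    Filter.EventuallyEq.fderiv_eq (h1.mono fun w hw => hw.1)
  have e2 : fderiv ℂ (fun w => (f w).2.1) z = fderiv ℂ (fun w : ℂ × ℂ × ℂ × ℂ => w.2.1) z :=
    Filter.EventuallyEq.fderiv_eq (h1.mono fun w hw => hw.2)
  rw [hd.fst.fderiv, hasFDerivAt_fst.fderiv] at e1
  rw [hd.snd.fst.fderiv, (hasFDerivAt_snd.fst).fderiv] at e2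
  have f1 := congrArg (fun L => L v) e1
  have f2 := congrArg (fun L => L v) e2
  simp only [ContinuousLinearMap.comp_apply, hv] at f1 f2
  have hv' : v = (0, 0, v.2.2) := by
    ext
    · simpa using f1.symm
    · simpa using f2.symm
    · rfl
    · rfl
  have hl : HasDerivAt (fun s : ℂ => z + s • v) v 0 := by
    simpa using ((hasDerivAt_id (0 : ℂ)).smul_const v).const_add z
  have hd0 : HasFDerivAt f (fderiv ℂ f z) (z + (0 : ℂ) • v) := by simpa using hd
  have h3 := hd0.comp_hasDerivAt (0 : ℂ) hl
  rw [hv] at h3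
  have h4 := h2 v.2.2 (by rw [← hv']; exact h3)
  rw [hv', h4]
  rfl

/-- The straightening of the strong stable manifolds: coordinates `(ξ, Y)` in which they are the
lines `ξ = 0`, with linear dynamics `Y ↦ ν Y`. -/
noncomputable def straight (η : ℂ × ℂ × ℂ → ℂ) (z : ℂ × ℂ × ℂ × ℂ) : ℂ × ℂ × ℂ × ℂ :=
  (z.1, z.2.1,
    (fixedPt z.2.1 z.1).1 - z.1 / z.2.1 * z.2.2.2 * η (contr (dropX z)) + z.2.2.1,
    (fixedPt z.2.1 z.1).2 + z.2.2.2 * η (dropX z))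

lemma analyticAt_straight {η : ℂ × ℂ × ℂ → ℂ} {z : ℂ × ℂ × ℂ × ℂ} (hz : z.2.1 ≠ 0)
    (h1 : AnalyticAt ℂ η (dropX z)) (h2 : AnalyticAt ℂ η (contr (dropX z))) :
    AnalyticAt ℂ (straight η) z := by
  have e1 : AnalyticAt ℂ (fun z => η (dropX z)) z := AnalyticAt.fun_comp h1 (analyticAt_dropX z)
  have e2 : AnalyticAt ℂ (fun z => η (contr (dropX z))) z :=
    AnalyticAt.fun_comp (g := η) (f := fun z => contr (dropX z)) h2
      (AnalyticAt.fun_comp (analyticAt_contr hz) (analyticAt_dropX z))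
  have e3 : AnalyticAt ℂ (fun z : ℂ × ℂ × ℂ × ℂ => z.1 ^ 2 / (2 * z.2.1)) z :=
    AnalyticAt.div (by fun_prop) (by fun_prop) (by simpa using hz)
  have e4 : AnalyticAt ℂ (fun z : ℂ × ℂ × ℂ × ℂ => z.1 / z.2.1) z :=
    AnalyticAt.div (by fun_prop) (by fun_prop) hz
  have e5 : AnalyticAt ℂ (fun z : ℂ × ℂ × ℂ × ℂ => z.2.1 / 2 - z.1 ^ 2 / (2 * z.2.1)) z :=
    AnalyticAt.sub (by fun_prop) e3
  have e6 : AnalyticAt ℂ (fun z : ℂ × ℂ × ℂ × ℂ => z.1) z := by fun_prop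
  have e7 : AnalyticAt ℂ (fun z : ℂ × ℂ × ℂ × ℂ => z.2.2.1) z := by fun_prop
  have e8 : AnalyticAt ℂ (fun z : ℂ × ℂ × ℂ × ℂ => z.2.2.2) z := by fun_prop
  have e9 : AnalyticAt ℂ (fun z : ℂ × ℂ × ℂ × ℂ => z.2.1) z := by fun_prop
  exact e6.prod (e9.prod (((e5.sub ((e4.mul e8).mul e2)).add e7).prod
    ((e6.mul e5).add (e8.mul e1))))

/-- The invariance of the strong stable manifold and the linear dynamics on it. -/
lemma henonFam_straight {η : ℂ × ℂ × ℂ → ℂ} {a l Y : ℂ} (hl : l ≠ 0)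
    (h : η (a, l, Y) = etaOp η (a, l, Y)) :
    henonFam (straight η (a, l, 0, Y)) = straight η (a, l, 0, nu l a * Y) := by
  have h' : η (a, l, Y) = ((l + nu l a) * η (contr (a, l, Y)) -
      nu l a * η (contr (contr (a, l, Y)))) / l - a / l ^ 2 * Y * η (contr (a, l, Y)) ^ 2 := h
  have hν : a ^ 2 = -(nu l a * l) := by
    rw [nu, div_mul_cancel₀ _ hl]; ring
  have hc : contr (a, l, Y) = (a, l, nu l a * Y) := rfl
  simp only [henonFam, straight, henonOn, henon, cParam, fixedPt, dropX]
  rw [← hc, h']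
  set A := η (contr (a, l, Y))
  set B := η (contr (contr (a, l, Y)))
  set ν := nu l a
  ext
  · rfl
  · rfl
  · simp only
    field_simp
    linear_combination (4 * A * Y * a) * hν
  · simp only
    field_simp
    linear_combination (-2 * Y * A) * hν


lemma straight_zero {η : ℂ × ℂ × ℂ → ℂ} {l ξ Y : ℂ} (h : η (0, l, Y) = 1) :
    straight η (0, l, ξ, Y) = (0, l, l / 2 + ξ, Y) := by
  simp [straight, fixedPt, dropX, h]

/-- Coordinates in which the strong stable manifolds are straight and their dynamics is linear. -/
lemma exists_straightening {lam : ℂ} (hlam : ‖lam‖ = 1) {r : ℝ} (hr : 0 ≤ r) :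
    ∃ Ψ Φ F : ℂ × ℂ × ℂ × ℂ → ℂ × ℂ × ℂ × ℂ,
      AnalyticOnNhd ℂ Ψ (cyl lam 0 r) ∧ AnalyticOnNhd ℂ Φ (cyl lam (lam / 2) r) ∧
      AnalyticOnNhd ℂ F (cyl lam 0 r) ∧
      (∀ z, (Ψ z).1 = z.1 ∧ (Ψ z).2.1 = z.2.1) ∧
      (∀ᶠ z in 𝓝ˢ (cyl lam 0 r), Φ (Ψ z) = z) ∧
      (∀ᶠ z in 𝓝ˢ (cyl lam (lam / 2) r), Ψ (Φ z) = z) ∧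
      (∀ᶠ z in 𝓝ˢ (cyl lam (lam / 2) r), F (Φ z) = Φ (henonFam z)) ∧
      (∀ᶠ z in 𝓝ˢ (cyl lam 0 r), Ψ (F z) = henonFam (Ψ z)) ∧
      (∀ᶠ z in 𝓝ˢ (cyl lam 0 r), z.1 = 0 → Ψ z = (0, z.2.1, z.2.1 / 2 + z.2.2.1, z.2.2.2)) ∧
      (∀ a l, Ψ (a, l, 0, 0) = (a, l, fixedPt l a)) ∧
      (∀ᶠ z in 𝓝ˢ (cyl lam 0 r), z.2.2.1 = 0 →
        F z = (z.1, z.2.1, 0, nu z.2.1 z.1 * z.2.2.2)) ∧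
      (∀ᶠ z in 𝓝ˢ (cyl lam 0 r), z.1 = 0 →
        F z = (0, z.2.1, z.2.1 * z.2.2.1 + z.2.2.1 ^ 2, 0)) ∧
      ∀ᶠ z in 𝓝ˢ (cyl lam 0 r), z.2.2.2 = 0 →
        HasDerivAt (fun ξ => (F (z.1, z.2.1, ξ, 0)).2.2.1) z.2.1 0 := by
  have hl0 : lam ≠ 0 := by
    rintro rfl
    simp at hlam
  obtain ⟨η, hηa, hηeq, hη0, hηa0⟩ := exists_eta hlam r
  set K := cyl lam 0 r with hK
  set K' := cyl lam (lam / 2) r with hK'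
  have hz₀ : ((0 : ℂ), lam, (0 : ℂ), (0 : ℂ)) ∈ K := mem_cyl.mpr ⟨rfl, rfl, rfl, by simpa using hr⟩
  have hz₁ : ((0 : ℂ), lam, lam / 2, (0 : ℂ)) ∈ K' :=
    mem_cyl.mpr ⟨rfl, rfl, rfl, by simpa using hr⟩
  have hd₀ : ((0 : ℂ), lam, (0 : ℂ)) ∈ disk₃ lam r := mem_disk₃.mpr ⟨rfl, rfl, by simpa using hr⟩
  have hdrop := tendsto_dropX lam 0 r
  have hne := eventually_ne_zero_cyl hl0 0 r
  have hΨa : AnalyticOnNhd ℂ (straight η) K := by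
    intro z hz
    have hz' := mapsTo_dropX _ _ _ hz
    refine analyticAt_straight ((mem_cyl.mp hz).2.1 ▸ hl0) (hηa _ hz') ?_
    rw [contr_mem hz']
    exact hηa _ hd₀
  have hΨ0 : ∀ᶠ z in 𝓝ˢ K, z.1 = 0 →
      straight η z = (0, z.2.1, z.2.1 / 2 + z.2.2.1, z.2.2.2) := by
    filter_upwards [hdrop.eventually hηa0] with z hz hz0
    obtain ⟨a, l, ξ, Y⟩ := z
    obtain rfl : a = 0 := hz0
    exact straight_zero (hz rfl)
  have hΨK : ∀ z ∈ K, straight η z = (0, lam, lam / 2, z.2.2.2) := by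
    intro z hz
    obtain ⟨h1, h2, h3, -⟩ := mem_cyl.mp hz
    have := hΨ0.self_of_nhdsSet z hz h1
    rw [this, h2, h3, add_zero]
  have hΨmaps : MapsTo (straight η) K K' := by
    intro z hz
    rw [hΨK z hz]
    exact mem_cyl.mpr ⟨rfl, rfl, rfl, (mem_cyl.mp hz).2.2.2⟩
  have himg : straight η '' K = K' := by
    refine Subset.antisymm hΨmaps.image_subset ?_
    rintro ⟨a, l, x, y⟩ hw
    obtain ⟨h1, h2, h3, h4⟩ := mem_cyl.mp hw
    simp only at h1 h2 h3 h4
    subst h1 h2 h3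
    have : ((0 : ℂ), l, (0 : ℂ), y) ∈ K := mem_cyl.mpr ⟨rfl, rfl, rfl, h4⟩
    exact ⟨_, this, hΨK _ this⟩
  have hinj : InjOn (straight η) K := by
    intro z hz w hw h
    rw [hΨK z hz, hΨK w hw] at h
    obtain ⟨a1, a2, a3, -⟩ := mem_cyl.mp hz
    obtain ⟨b1, b2, b3, -⟩ := mem_cyl.mp hw
    simp only [Prod.mk.injEq, true_and] at h
    ext
    · rw [a1, b1]
    · rw [a2, b2]
    · rw [a3, b3]
    · exact h
  -- Fibre directions stay in the slice a = 0, where the straightening is the translation (ξ, Y) ↦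
  -- (l/2 + ξ, Y); its fibre derivative is the identity.
  obtain ⟨Φ, hΦa, hΦΨ, hΨΦ⟩ := exists_analytic_inverse (isCompact_cyl lam 0 r) hΨa hinj (by
    intro z hz
    refine injective_fderiv_of_fibered (hΨa z hz) (Eventually.of_forall fun w => ⟨rfl, rfl⟩) ?_
    intro v hv
    obtain ⟨h1, h2, h3, -⟩ := mem_cyl.mp hz
    have hc : ContinuousAt (fun s : ℂ => z + s • ((0 : ℂ), (0 : ℂ), v)) 0 := by fun_prop
    have hev : ∀ᶠ s in 𝓝 (0 : ℂ), straight η (z + s • ((0 : ℂ), (0 : ℂ), v)) =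
        (0, lam, lam / 2 + s * v.1, z.2.2.2 + s * v.2) := by
      have h4 := hc.eventually (p := fun w : ℂ × ℂ × ℂ × ℂ => w.1 = 0 →
        straight η w = (0, w.2.1, w.2.1 / 2 + w.2.2.1, w.2.2.2))
        (by simpa using eventually_nhdsSet_iff_forall.mp hΨ0 z hz)
      filter_upwards [h4] with s hs
      rw [hs (by simp [h1])]
      simp [h2, h3]
    have h5 : HasDerivAt (fun s : ℂ => ((0 : ℂ), lam, lam / 2 + s * v.1, z.2.2.2 + s * v.2))
        ((0 : ℂ), (0 : ℂ), v.1, v.2) 0 := by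
      have e1 : HasDerivAt (fun s : ℂ => lam / 2 + s * v.1) v.1 0 := by
        simpa using ((hasDerivAt_id (0 : ℂ)).mul_const v.1).const_add (lam / 2)
      have e2 : HasDerivAt (fun s : ℂ => z.2.2.2 + s * v.2) v.2 0 := by
        simpa using ((hasDerivAt_id (0 : ℂ)).mul_const v.2).const_add z.2.2.2
      exact (hasDerivAt_const _ _).prodMk ((hasDerivAt_const _ _).prodMk (e1.prodMk e2))
    have h6 := (hv.congr_of_eventuallyEq (hev.mono fun s hs => hs.symm)).unique h5
    simp only [Prod.ext_iff, Prod.fst_zero, Prod.snd_zero] at h6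
    exact Prod.ext h6.2.2.1.symm h6.2.2.2.symm)
  rw [himg] at hΦa hΨΦ
  have hΨt : Tendsto (straight η) (𝓝ˢ K) (𝓝ˢ K') :=
    tendsto_nhdsSet_of_mapsTo (fun z hz => (hΨa z hz).continuousAt) hΨmaps
  have hHt : Tendsto henonFam (𝓝ˢ K') (𝓝ˢ K') := by
    refine tendsto_nhdsSet_of_mapsTo
      (fun z hz => (analyticAt_henonFam ((mem_cyl.mp hz).2.1 ▸ hl0)).continuousAt) ?_
    intro z hz
    rw [henonFam_mem rfl hz]
    exact hz₁
  have hFa : AnalyticOnNhd ℂ (fun z => Φ (henonFam (straight η z))) K := by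
    intro z hz
    have hz' := hΨmaps hz
    have h1 : AnalyticAt ℂ (fun z => henonFam (straight η z)) z :=
      AnalyticAt.fun_comp (analyticAt_henonFam ((mem_cyl.mp hz').2.1 ▸ hl0)) (hΨa z hz)
    refine AnalyticAt.fun_comp (g := Φ) (f := fun z => henonFam (straight η z)) ?_ h1
    rw [henonFam_mem rfl hz']
    exact hΦa _ hz₁
  have hΨF : ∀ᶠ z in 𝓝ˢ K, straight η (Φ (henonFam (straight η z))) =
      henonFam (straight η z) := (hHt.comp hΨt).eventually hΨΦ
  have hΨs : ∀ a l, straight η (a, l, 0, 0) = (a, l, fixedPt l a) := by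
    intro a l
    simp [straight]
  have hF0 : ∀ᶠ z in 𝓝ˢ K, z.2.2.1 = 0 → Φ (henonFam (straight η z)) =
      (z.1, z.2.1, 0, nu z.2.1 z.1 * z.2.2.2) := by
    have ht : Tendsto (fun z : ℂ × ℂ × ℂ × ℂ => (z.1, z.2.1, (0 : ℂ), nu z.2.1 z.1 * z.2.2.2))
        (𝓝ˢ K) (𝓝ˢ K) := by
      refine tendsto_nhdsSet_of_mapsTo (fun z hz => ?_) (fun z hz => ?_)
      · have hν : AnalyticAt ℂ (fun z : ℂ × ℂ × ℂ × ℂ => nu z.2.1 z.1) z :=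
          analyticAt_nu (by fun_prop) (by fun_prop) ((mem_cyl.mp hz).2.1 ▸ hl0)
        have : AnalyticAt ℂ (fun z : ℂ × ℂ × ℂ × ℂ =>
          (z.1, z.2.1, (0 : ℂ), nu z.2.1 z.1 * z.2.2.2)) z := by fun_prop
        exact this.continuousAt
      · obtain ⟨h1, h2, -, -⟩ := mem_cyl.mp hz
        rw [h1, h2]
        exact mem_cyl.mpr ⟨rfl, rfl, rfl, by simpa [nu] using hr⟩
    filter_upwards [hdrop.eventually hηeq, ht.eventually hΦΨ, hne] with z h1 h2 h3 h0
    obtain ⟨a, l, ξ, Y⟩ := z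
    simp only at h0 h2 h3
    subst h0
    rw [henonFam_straight h3 h1, h2]
  refine ⟨straight η, Φ, fun z => Φ (henonFam (straight η z)), hΨa, hΦa, hFa,
    fun z => ⟨rfl, rfl⟩, hΦΨ, hΨΦ, ?_, hΨF, hΨ0, hΨs, hF0, ?_, ?_⟩
  · filter_upwards [hΨΦ] with z hz
    rw [hz]
  · have ht : Tendsto (fun z : ℂ × ℂ × ℂ × ℂ =>
        (z.1, z.2.1, z.2.1 * z.2.2.1 + z.2.2.1 ^ 2, (0 : ℂ))) (𝓝ˢ K) (𝓝ˢ K) := by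
      refine tendsto_nhdsSet_of_mapsTo (fun z hz => by fun_prop) (fun z hz => ?_)
      obtain ⟨h1, h2, h3, -⟩ := mem_cyl.mp hz
      exact mem_cyl.mpr ⟨h1, h2, by simp [h3], by simpa using hr⟩
    filter_upwards [hΨ0, ht.eventually hΨ0, ht.eventually hΦΨ] with z h1 h2 h3 h0
    obtain ⟨a, l, ξ, Y⟩ := z
    simp only at h0 h1 h2 h3
    subst h0
    rw [h2 rfl] at h3
    rw [h1 rfl, ← h3]
    congr 1
    simp only [henonFam, henonOn, henon, cParam]
    ext <;> simp
    ring
  · have ht : Tendsto (fun z : ℂ × ℂ × ℂ × ℂ => (z.1, z.2.1, (0 : ℂ), (0 : ℂ))) (𝓝ˢ K) (𝓝ˢ K) := by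
      refine tendsto_nhdsSet_of_mapsTo (fun z hz => by fun_prop) (fun z hz => ?_)
      obtain ⟨h1, h2, -, -⟩ := mem_cyl.mp hz
      exact mem_cyl.mpr ⟨h1, h2, rfl, by simpa using hr⟩
    have hFan : ∀ᶠ z in 𝓝ˢ K, AnalyticAt ℂ (fun z => Φ (henonFam (straight η z))) z :=
      eventually_nhdsSet_iff_forall.mpr fun z hz => (hFa z hz).eventually_analyticAt
    have hΨF2 : ∀ᶠ z in 𝓝ˢ K, ∀ᶠ w in 𝓝 z, straight η (Φ (henonFam (straight η w))) =
        henonFam (straight η w) := eventually_nhdsSet_iff_forall.mpr fun z hz =>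
      (eventually_nhdsSet_iff_forall.mp hΨF z hz).eventually_nhds
    have hηan : ∀ᶠ z in 𝓝ˢ (disk₃ lam r), AnalyticAt ℂ η z :=
      eventually_nhdsSet_iff_forall.mpr fun z hz => (hηa z hz).eventually_analyticAt
    filter_upwards [ht.eventually hΨF2, ht.eventually hF0,
      ht.eventually hFan, ht.eventually (hdrop.eventually hη0),
      ht.eventually (hdrop.eventually hηan), hne] with z h1 h2 h3 h4 h5 hl hY
    obtain ⟨a, l, ξ', Y⟩ := z
    simp only at h1 h2 h3 h4 h5 hl ⊢
    set F : ℂ × ℂ × ℂ × ℂ → ℂ × ℂ × ℂ × ℂ := fun z => Φ (henonFam (straight η z)) with hF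
    have hFw : F (a, l, 0, 0) = (a, l, 0, 0) := by
      have := h2 trivial
      rwa [mul_zero] at this
    have hcurve : HasDerivAt (fun ξ : ℂ => (a, l, ξ, (0 : ℂ))) ((0 : ℂ), (0 : ℂ), (1 : ℂ), (0 : ℂ)) 0 :=
      (hasDerivAt_const _ _).prodMk ((hasDerivAt_const _ _).prodMk
        ((hasDerivAt_id _).prodMk (hasDerivAt_const _ _)))
    have hFd := HasFDerivAt.comp_hasDerivAt (f := fun ξ : ℂ => (a, l, ξ, (0 : ℂ))) (l := F)
      (0 : ℂ) h3.differentiableAt.hasFDerivAt hcurve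
    set v := fderiv ℂ F (a, l, 0, 0) ((0 : ℂ), (0 : ℂ), (1 : ℂ), (0 : ℂ)) with hv
    have hd1 : HasDerivAt (fun ξ : ℂ => (F (a, l, ξ, 0)).2.2.1) v.2.2.1 0 := hFd.snd.snd.fst
    have hd2 : HasDerivAt (fun ξ : ℂ => (F (a, l, ξ, 0)).2.2.2) v.2.2.2 0 := hFd.snd.snd.snd
    have hev : ∀ᶠ ξ in 𝓝 (0 : ℂ), straight η (F (a, l, ξ, 0)) =
        henonFam (straight η (a, l, ξ, 0)) :=
      hcurve.continuousAt.eventually (p := fun w => straight η (F w) = henonFam (straight η w)) h1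
    have hη1 : η (a, l, 0) = 1 := h4 rfl
    -- the second coordinate
    have hηd : HasDerivAt (fun ξ : ℂ => η (dropX (F (a, l, ξ, 0))))
        (fderiv ℂ η (a, l, 0) (fderiv ℂ dropX (a, l, 0, 0) v)) 0 := by
      have e1 : HasFDerivAt dropX (fderiv ℂ dropX (a, l, 0, 0)) (F (a, l, 0, 0)) := by
        rw [hFw]; exact (analyticAt_dropX _).differentiableAt.hasFDerivAt
      have e2 := HasFDerivAt.comp_hasDerivAt (f := fun ξ : ℂ => F (a, l, ξ, (0 : ℂ))) (l := dropX)
        (0 : ℂ) e1 hFd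
      have e3 : HasFDerivAt η (fderiv ℂ η (a, l, 0)) (dropX (F (a, l, 0, 0))) := by
        rw [hFw]; exact h5.differentiableAt.hasFDerivAt
      exact HasFDerivAt.comp_hasDerivAt (f := fun ξ : ℂ => dropX (F (a, l, ξ, (0 : ℂ)))) (l := η)
        (0 : ℂ) e3 e2
    have hcd : HasDerivAt (fun ξ : ℂ => η (contr (dropX (F (a, l, ξ, 0)))))
        (fderiv ℂ η (a, l, 0) (fderiv ℂ (fun z => contr (dropX z)) (a, l, 0, 0) v)) 0 := by
      have e0 : AnalyticAt ℂ (fun z => contr (dropX z)) (a, l, 0, 0) :=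
        AnalyticAt.fun_comp (analyticAt_contr hl) (analyticAt_dropX _)
      have e1 : HasFDerivAt (fun z => contr (dropX z))
          (fderiv ℂ (fun z => contr (dropX z)) (a, l, 0, 0)) (F (a, l, 0, 0)) := by
        rw [hFw]; exact e0.differentiableAt.hasFDerivAt
      have e2 := HasFDerivAt.comp_hasDerivAt (f := fun ξ : ℂ => F (a, l, ξ, (0 : ℂ)))
        (l := fun z => contr (dropX z)) (0 : ℂ) e1 hFd
      have e3 : HasFDerivAt η (fderiv ℂ η (a, l, 0)) (contr (dropX (F (a, l, 0, 0)))) := by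
        rw [hFw]
        have : contr (dropX (a, l, 0, 0)) = (a, l, 0) := by simp [contr, dropX]
        rw [this]
        exact h5.differentiableAt.hasFDerivAt
      exact HasFDerivAt.comp_hasDerivAt (f := fun ξ : ℂ => contr (dropX (F (a, l, ξ, (0 : ℂ)))))
        (l := η) (0 : ℂ) e3 e2
    have hηF : η (dropX (F (a, l, 0, 0))) = 1 := by rw [hFw]; exact hη1
    have hηcF : η (contr (dropX (F (a, l, 0, 0)))) = 1 := by
      rw [hFw]
      simpa [contr, dropX] using hη1
    have hpres : ∀ᶠ ξ in 𝓝 (0 : ℂ), (F (a, l, ξ, 0)).1 = a ∧ (F (a, l, ξ, 0)).2.1 = l := by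
      filter_upwards [hev] with ξ hξ
      exact ⟨congrArg (fun z : ℂ × ℂ × ℂ × ℂ => z.1) hξ,
        congrArg (fun z : ℂ × ℂ × ℂ × ℂ => z.2.1) hξ⟩
    -- Let v be the derivative of F in the ξ-direction at the origin. Differentiating Ψ∘F = H∘Ψ
    -- there, where η = 1, the second coordinates give v₂ = a. The first ones then give v₁ - a²/l =
    -- 2κ, and 2κ = l - a²/l, so v₁ = l.
    have hv2 : v.2.2.2 = a := by
      have e1 := hd2.mul hηd
      rw [hFw] at e1
      have e2 : HasDerivAt (fun ξ : ℂ => a * ξ) a 0 := by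
        simpa using (hasDerivAt_id (0 : ℂ)).const_mul a
      have e3 := e2.unique (e1.congr_of_eventuallyEq ?_)
      · have e4 : η (dropX (a, l, 0, 0)) = 1 := hη1
        rw [e4] at e3
        simpa using e3.symm
      · filter_upwards [hev, hpres] with ξ hξ hp
        have := congrArg (fun z : ℂ × ℂ × ℂ × ℂ => z.2.2.2) hξ
        simp only [straight, henonFam, henonOn, henon, fixedPt, hp.1, hp.2] at this
        simp only [Pi.mul_apply]
        linear_combination -this
    have hv1 : v.2.2.1 = l := by
      have e1 := (hd1.sub ((hd2.mul hcd).const_mul (a / l)))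
      have e2 : HasDerivAt (fun ξ : ℂ => 2 * (fixedPt l a).1 * ξ + ξ ^ 2)
          (2 * (fixedPt l a).1) 0 := by
        simpa using ((hasDerivAt_id' (0 : ℂ)).const_mul (2 * (fixedPt l a).1)).fun_add
          ((hasDerivAt_id' (0 : ℂ)).fun_pow 2)
      have e3 := e2.unique (e1.congr_of_eventuallyEq ?_)
      · rw [hηcF, hFw, hv2] at e3
        simp only [fixedPt] at e3
        field_simp at e3
        have e4 : l * v.2.2.1 = l * l := by linear_combination -e3
        exact mul_left_cancel₀ hl e4
      · filter_upwards [hev, hpres] with ξ hξ hp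
        have := congrArg (fun z : ℂ × ℂ × ℂ × ℂ => z.2.2.1) hξ
        simp only [straight, henonFam, henonOn, henon, cParam, fixedPt, hp.1, hp.2] at this
        simp only [Pi.sub_apply, Pi.mul_apply, fixedPt]
        linear_combination -this
    rw [hv1] at hd1
    exact hd1

end SemiParabolicHenon

/-! ### Divisibility by powers of the transverse coordinate, and the cohomological equation with
resonance. -/

namespace SemiParabolicHenon

/-- `G` is divisible by the `k`-th power of the coordinate `ξ` near `a = 0`, `l = lam`, `ξ = 0`,
`|Y| ≤ r`. -/
def DivBy (lam : ℂ) (r : ℝ) (k : ℕ) (G : ℂ × ℂ × ℂ × ℂ → ℂ) : Prop :=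
  ∃ e : ℂ × ℂ × ℂ × ℂ → ℂ, AnalyticOnNhd ℂ e (cyl lam 0 r) ∧
    ∀ᶠ z in 𝓝ˢ (cyl lam 0 r), G z = z.2.2.1 ^ k * e z

namespace DivBy

variable {lam : ℂ} {r : ℝ} {j k : ℕ} {G H : ℂ × ℂ × ℂ × ℂ → ℂ}

lemma of_analytic (h : AnalyticOnNhd ℂ G (cyl lam 0 r)) : DivBy lam r 0 G :=
  ⟨G, h, Eventually.of_forall fun z => by simp⟩

lemma add (hG : DivBy lam r k G) (hH : DivBy lam r k H) : DivBy lam r k (fun z => G z + H z) := by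
  obtain ⟨e, he, h1⟩ := hG
  obtain ⟨f, hf, h2⟩ := hH
  refine ⟨fun z => e z + f z, he.add hf, ?_⟩
  filter_upwards [h1, h2] with z a b
  rw [a, b]; ring

lemma mul (hG : DivBy lam r j G) (hH : DivBy lam r k H) :
    DivBy lam r (j + k) (fun z => G z * H z) := by
  obtain ⟨e, he, h1⟩ := hG
  obtain ⟨f, hf, h2⟩ := hH
  refine ⟨fun z => e z * f z, he.mul hf, ?_⟩
  filter_upwards [h1, h2] with z a b
  rw [a, b]; ring

lemma neg (hG : DivBy lam r k G) : DivBy lam r k (fun z => -G z) := by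
  obtain ⟨e, he, h1⟩ := hG
  exact ⟨fun z => -e z, he.neg, h1.mono fun z a => by simp only [a]; ring⟩

lemma sub (hG : DivBy lam r k G) (hH : DivBy lam r k H) : DivBy lam r k (fun z => G z - H z) := by
  simpa only [sub_eq_add_neg] using hG.add hH.neg

lemma congr (hG : DivBy lam r k G) (h : ∀ᶠ z in 𝓝ˢ (cyl lam 0 r), H z = G z) :
    DivBy lam r k H := by
  obtain ⟨e, he, h1⟩ := hG
  refine ⟨e, he, ?_⟩
  filter_upwards [h, h1] with z a b
  rw [a, b]

lemma mono (hG : DivBy lam r k G) (hjk : j ≤ k) : DivBy lam r j G := by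
  obtain ⟨e, he, h1⟩ := hG
  refine ⟨fun z => z.2.2.1 ^ (k - j) * e z, fun z hz => ?_, ?_⟩
  · have : AnalyticAt ℂ (fun z : ℂ × ℂ × ℂ × ℂ => z.2.2.1 ^ (k - j)) z := by fun_prop
    exact this.mul (he z hz)
  · filter_upwards [h1] with z a
    rw [a, ← mul_assoc, ← pow_add, Nat.add_sub_cancel' hjk]

lemma pow (hG : DivBy lam r 1 G) (n : ℕ) : DivBy lam r n (fun z => G z ^ n) := by
  obtain ⟨e, he, h1⟩ := hG
  refine ⟨fun z => e z ^ n, he.pow n, ?_⟩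
  filter_upwards [h1] with z a
  rw [a]; ring

lemma zero : DivBy lam r k (fun _ => 0) :=
  ⟨fun _ => 0, analyticOnNhd_const, Eventually.of_forall fun z => by simp⟩

lemma sum {ι : Type*} {s : Finset ι} {G : ι → ℂ × ℂ × ℂ × ℂ → ℂ}
    (h : ∀ i ∈ s, DivBy lam r k (G i)) : DivBy lam r k (fun z => ∑ i ∈ s, G i z) := by
  classical
  induction s using Finset.induction_on with
  | empty => simpa using zero
  | insert i s hi ih =>
    simp only [Finset.sum_insert hi]
    exact (h i (Finset.mem_insert_self i s)).add
      (ih fun i' hi' => h i' (Finset.mem_insert_of_mem hi'))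

/-- Each extra factor in the factorization of G^(n+1) - H^(n+1) contributes one power of ξ. Thus a
change of coordinate of order j alters its (n+1)-st power only at order j + n. -/
lemma pow_sub_pow (hG : DivBy lam r 1 G) (hH : DivBy lam r 1 H)
    (hd : DivBy lam r j (fun z => G z - H z)) (n : ℕ) :
    DivBy lam r (j + n) (fun z => G z ^ (n + 1) - H z ^ (n + 1)) := by
  induction n with
  | zero => simpa using hd
  | succ n ih =>
    have h1 : DivBy lam r (j + (n + 1)) (fun z => G z * (G z ^ (n + 1) - H z ^ (n + 1))) :=
      (hG.mul ih).mono (by omega)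
    have h2 : DivBy lam r (j + (n + 1)) (fun z => (G z - H z) * H z ^ (n + 1)) :=
      hd.mul (hH.pow (n + 1))
    exact (h1.add h2).congr (Eventually.of_forall fun z => by ring)

end DivBy

section NormalForm

variable {lam : ℂ} {r : ℝ}

/-- Functions vanishing on the line `ξ = 0` are divisible by `ξ`. -/
lemma DivBy.of_vanish {G : ℂ × ℂ × ℂ × ℂ → ℂ} (hG : AnalyticOnNhd ℂ G (cyl lam 0 r))
    (h : ∀ᶠ z in 𝓝ˢ (cyl lam 0 r), z.2.2.1 = 0 → G z = 0) : DivBy lam r 1 G := by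
  obtain ⟨e, he, h1⟩ := exists_eq_mul lineAnalytic_four
    (L := (ContinuousLinearMap.fst ℂ ℂ ℂ).comp ((ContinuousLinearMap.snd ℂ ℂ (ℂ × ℂ)).comp
      (ContinuousLinearMap.snd ℂ ℂ (ℂ × ℂ × ℂ)))) (e := (0, 0, 1, 0)) (by simp) hG h
  exact ⟨e, he, h1.mono fun z hz => by rw [hz]; simp⟩

/-- Inserting `ξ = 0`. -/
def zeroX (z : ℂ × ℂ × ℂ) : ℂ × ℂ × ℂ × ℂ := (z.1, z.2.1, 0, z.2.2)

@[fun_prop]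
lemma analyticAt_zeroX (z : ℂ × ℂ × ℂ) : AnalyticAt ℂ zeroX z := by
  unfold zeroX; fun_prop

lemma mapsTo_zeroX (lam : ℂ) (r : ℝ) : MapsTo zeroX (disk₃ lam r) (cyl lam 0 r) := by
  intro z hz
  obtain ⟨h1, h2, h3⟩ := mem_disk₃.mp hz
  exact mem_cyl.mpr ⟨h1, h2, rfl, h3⟩

lemma tendsto_zeroX (lam : ℂ) (r : ℝ) :
    Tendsto zeroX (𝓝ˢ (disk₃ lam r)) (𝓝ˢ (cyl lam 0 r)) :=
  tendsto_nhdsSet_of_mapsTo (fun z _ => (analyticAt_zeroX z).continuousAt) (mapsTo_zeroX lam r)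

/-- Inserting `Y = 0`. -/
def zeroY (z : ℂ × ℂ × ℂ × ℂ) : ℂ × ℂ × ℂ × ℂ := (z.1, z.2.1, z.2.2.1, 0)

@[fun_prop]
lemma analyticAt_zeroY (z : ℂ × ℂ × ℂ × ℂ) : AnalyticAt ℂ zeroY z := by
  unfold zeroY; fun_prop

lemma mapsTo_zeroY (hr : 0 ≤ r) : MapsTo zeroY (cyl lam 0 r) (cyl lam 0 r) := by
  intro z hz
  obtain ⟨h1, h2, h3, -⟩ := mem_cyl.mp hz
  exact mem_cyl.mpr ⟨h1, h2, h3, by simpa [zeroY] using hr⟩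

lemma tendsto_zeroY (hr : 0 ≤ r) :
    Tendsto zeroY (𝓝ˢ (cyl lam 0 r)) (𝓝ˢ (cyl lam 0 r)) :=
  tendsto_nhdsSet_of_mapsTo (fun z _ => (analyticAt_zeroY z).continuousAt) (mapsTo_zeroY hr)

/-- Inserting `Y = 0` in the space of triples. -/
def zeroY₃ (z : ℂ × ℂ × ℂ) : ℂ × ℂ × ℂ := (z.1, z.2.1, 0)

@[fun_prop]
lemma analyticAt_zeroY₃ (z : ℂ × ℂ × ℂ) : AnalyticAt ℂ zeroY₃ z := by
  unfold zeroY₃; fun_prop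

lemma mapsTo_zeroY₃ (hr : 0 ≤ r) : MapsTo zeroY₃ (disk₃ lam r) (disk₃ lam r) := by
  intro z hz
  obtain ⟨h1, h2, -⟩ := mem_disk₃.mp hz
  exact mem_disk₃.mpr ⟨h1, h2, by simpa [zeroY₃] using hr⟩

lemma tendsto_zeroY₃ (hr : 0 ≤ r) :
    Tendsto zeroY₃ (𝓝ˢ (disk₃ lam r)) (𝓝ˢ (disk₃ lam r)) :=
  tendsto_nhdsSet_of_mapsTo (fun z _ => (analyticAt_zeroY₃ z).continuousAt) (mapsTo_zeroY₃ hr)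

/-- An identity between continuous functions in the slice `a = 0` extends from `ξ ≠ 0` to all
`ξ`. -/
lemma eventually_eq_zero_of_ne {g : ℂ × ℂ × ℂ × ℂ → ℂ} (hg : AnalyticOnNhd ℂ g (cyl lam 0 r))
    (h : ∀ᶠ z in 𝓝ˢ (cyl lam 0 r), z.1 = 0 → z.2.2.1 ≠ 0 → g z = 0) :
    ∀ᶠ z in 𝓝ˢ (cyl lam 0 r), z.1 = 0 → g z = 0 := by
  have h1 : ∀ᶠ z in 𝓝ˢ (cyl lam 0 r), ∀ᶠ w in 𝓝 z, w.1 = 0 → w.2.2.1 ≠ 0 → g w = 0 :=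
    eventually_nhdsSet_iff_forall.mpr fun z hz =>
      (eventually_nhdsSet_iff_forall.mp h z hz).eventually_nhds
  have h2 : ∀ᶠ z in 𝓝ˢ (cyl lam 0 r), AnalyticAt ℂ g z :=
    eventually_nhdsSet_iff_forall.mpr fun z hz => (hg z hz).eventually_analyticAt
  filter_upwards [h, h1, h2] with z h h1 h2 hz
  by_cases hξ : z.2.2.1 = 0
  swap
  · exact h hz hξ
  have hc : Tendsto (fun s : ℂ => z + s • ((0 : ℂ), (0 : ℂ), (1 : ℂ), (0 : ℂ))) (𝓝[≠] 0) (𝓝 z) := by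
    have : Continuous (fun s : ℂ => z + s • ((0 : ℂ), (0 : ℂ), (1 : ℂ), (0 : ℂ))) := by fun_prop
    have h3 := this.tendsto 0
    simp only [zero_smul, add_zero] at h3
    exact h3.mono_left nhdsWithin_le_nhds
  have h4 := h2.continuousAt.tendsto.comp hc
  refine tendsto_nhds_unique h4 (tendsto_const_nhds.congr' ?_)
  filter_upwards [hc.eventually h1, self_mem_nhdsWithin] with s hs hs0
  exact (hs (by simp [hz]) (by simpa [hξ] using hs0)).symm

/-- Solving the cohomological equation of order `k + 1`, with a resonant term that depends on the
parameters only. -/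
lemma exists_solution (hl : lam ≠ 0) (hr : 0 ≤ r) (k : ℕ) {f : ℂ × ℂ × ℂ → ℂ}
    (hf : AnalyticOnNhd ℂ f (disk₃ lam r))
    (hf0 : ∀ᶠ z in 𝓝ˢ (disk₃ lam r), z.1 = 0 → f z = f (zeroY₃ z)) :
    ∃ (u : ℂ × ℂ × ℂ → ℂ) (c : ℂ × ℂ → ℂ), AnalyticOnNhd ℂ u (disk₃ lam r) ∧
      AnalyticAt ℂ c (0, lam) ∧ (lam ^ k ≠ 1 → c = 0) ∧
      (∀ᶠ z in 𝓝ˢ (disk₃ lam r), z.2.1 * u z - z.2.1 ^ (k + 1) * u (contr z) =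
        f z - c (z.1, z.2.1)) ∧
      ∀ᶠ z in 𝓝ˢ (disk₃ lam r), z.1 = 0 → u z = u (zeroY₃ z) := by
  have hne : ∀ᶠ z in 𝓝ˢ (disk₃ lam r), z.2.1 ≠ 0 := by
    rw [eventually_nhdsSet_iff_forall]
    intro z hz
    have : ContinuousAt (fun z : ℂ × ℂ × ℂ => z.2.1) z := by fun_prop
    exact this.eventually_ne ((mem_disk₃.mp hz).2.1 ▸ hl)
  have hf0a : AnalyticOnNhd ℂ (fun z => f (zeroY₃ z)) (disk₃ lam r) := fun z hz =>
    AnalyticAt.fun_comp (hf _ (mapsTo_zeroY₃ hr hz)) (analyticAt_zeroY₃ z)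
  -- The part of f that vanishes at Y = 0 is removed first; the rest, f at Y = 0, is a function of
  -- (a, l).
  obtain ⟨u, hu, hueq, hu0⟩ := exists_cohomological hl hr k
    (R := fun z => (f z - f (zeroY₃ z)) / z.2.1)
    (fun z hz => ((hf z hz).sub (hf0a z hz)).div (by fun_prop) ((mem_disk₃.mp hz).2.1 ▸ hl))
    (Eventually.of_forall fun z hz => by
      have : zeroY₃ z = z := by
        ext
        · rfl
        · rfl
        · exact hz.symm
      simp [this])
  have hu_a : ∀ᶠ z in 𝓝ˢ (disk₃ lam r), z.1 = 0 → u z = 0 := by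
    filter_upwards [hueq, (tendsto_zeroY₃ hr).eventually hu0, hf0] with z h1 h2 h3 hz
    have hc : contr z = zeroY₃ z := by simp [contr, zeroY₃, hz, nu]
    have h4 : u (zeroY₃ z) = 0 := h2 rfl
    rw [hc, h4, h3 hz] at h1
    simpa using h1
  have hu_a' : ∀ᶠ z in 𝓝ˢ (disk₃ lam r), z.1 = 0 → u z = u (zeroY₃ z) := by
    filter_upwards [hu_a, (tendsto_zeroY₃ hr).eventually hu_a] with z h1 h2 hz
    rw [h1 hz, h2 hz]
  have hp : ((0 : ℂ), lam, (0 : ℂ)) ∈ disk₃ lam r := mem_disk₃.mpr ⟨rfl, rfl, by simpa using hr⟩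
  have hcan : AnalyticAt ℂ (fun p : ℂ × ℂ => f (p.1, p.2, 0)) (0, lam) :=
    AnalyticAt.fun_comp (g := f) (f := fun p : ℂ × ℂ => (p.1, p.2, (0 : ℂ))) (hf _ hp)
      (by fun_prop)
  -- In the resonant case the value at Y = 0 is kept as c. Otherwise l - l^(k+1) is nonzero for l
  -- near λ, and a term independent of Y, hence invariant under `contr`, absorbs that value.
  -- Resonance is decided at λ, so c is analytic across all nearby l.
  by_cases hres : lam ^ k = 1
  · refine ⟨u, fun p => f (p.1, p.2, 0), hu, hcan, fun h => absurd hres h, ?_, hu_a'⟩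
    filter_upwards [hueq, hne] with z h1 h2
    have h3 : f (zeroY₃ z) = f (z.1, z.2.1, 0) := rfl
    rw [← h3]
    field_simp at h1
    linear_combination h1
  · have hne2 : ∀ z ∈ disk₃ lam r, z.2.1 - z.2.1 ^ (k + 1) ≠ 0 := by
      intro z hz h0
      rw [(mem_disk₃.mp hz).2.1, pow_succ'] at h0
      exact hres (mul_left_cancel₀ hl (by linear_combination -h0))
    refine ⟨fun z => u z + f (zeroY₃ z) / (z.2.1 - z.2.1 ^ (k + 1)), 0, ?_, analyticAt_const,
      fun _ => rfl, ?_, ?_⟩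
    · intro z hz
      exact (hu z hz).add ((hf0a z hz).div (by fun_prop) (hne2 z hz))
    · have hne3 : ∀ᶠ z in 𝓝ˢ (disk₃ lam r), z.2.1 - z.2.1 ^ (k + 1) ≠ 0 := by
        rw [eventually_nhdsSet_iff_forall]
        intro z hz
        have : ContinuousAt (fun z : ℂ × ℂ × ℂ => z.2.1 - z.2.1 ^ (k + 1)) z := by fun_prop
        exact this.eventually_ne (hne2 z hz)
      filter_upwards [hueq, hne, hne3] with z h1 h2 h3
      have h4 : zeroY₃ (contr z) = zeroY₃ z := rfl
      have h5 : (contr z).2.1 = z.2.1 := rfl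
      have h6 : u z * z.2.1 - z.2.1 ^ (k + 1) * u (contr z) = f z - f (zeroY₃ z) := by
        field_simp at h1
        linear_combination h1
      simp only [h4, h5, Pi.zero_apply, sub_zero]
      have h7 : f (zeroY₃ z) / (z.2.1 - z.2.1 ^ (k + 1)) * (z.2.1 - z.2.1 ^ (k + 1)) =
        f (zeroY₃ z) := div_mul_cancel₀ _ h3
      linear_combination h6 + h7
    · filter_upwards [hu_a'] with z h1 hz
      have h4 : zeroY₃ (zeroY₃ z) = zeroY₃ z := rfl
      have h5 : (zeroY₃ z).2.1 = z.2.1 := rfl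
      simp only [h4, h5, h1 hz]

end NormalForm

end SemiParabolicHenon

/-! ### Normalization of the transverse dynamics, order by order. -/

namespace SemiParabolicHenon

/-- The properties of the Hénon family in the coordinates of `exists_straightening`. -/
structure StraightFamily (lam : ℂ) (r : ℝ) (F : ℂ × ℂ × ℂ × ℂ → ℂ × ℂ × ℂ × ℂ) : Prop where
  analytic : AnalyticOnNhd ℂ F (cyl lam 0 r)
  fst : ∀ᶠ z in 𝓝ˢ (cyl lam 0 r), (F z).1 = z.1 ∧ (F z).2.1 = z.2.1
  line : ∀ᶠ z in 𝓝ˢ (cyl lam 0 r), z.2.2.1 = 0 →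
    F z = (z.1, z.2.1, 0, nu z.2.1 z.1 * z.2.2.2)
  degenerate : ∀ᶠ z in 𝓝ˢ (cyl lam 0 r), z.1 = 0 →
    F z = (0, z.2.1, z.2.1 * z.2.2.1 + z.2.2.1 ^ 2, 0)
  multiplier : ∀ᶠ z in 𝓝ˢ (cyl lam 0 r), z.2.2.2 = 0 →
    HasDerivAt (fun ξ => (F (z.1, z.2.1, ξ, 0)).2.2.1) z.2.1 0

/-- A coordinate `X = ξ w` in which the family has the normal form up to order `j`. -/
structure PartialNormalForm (lam : ℂ) (r : ℝ) (F : ℂ × ℂ × ℂ × ℂ → ℂ × ℂ × ℂ × ℂ) (j : ℕ)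
    (X w : ℂ × ℂ × ℂ × ℂ → ℂ) (c : ℕ → ℂ × ℂ → ℂ) : Prop where
  analytic : AnalyticOnNhd ℂ X (cyl lam 0 r)
  analytic_unit : AnalyticOnNhd ℂ w (cyl lam 0 r)
  unit_ne : ∀ z ∈ cyl lam 0 r, w z ≠ 0
  eq_mul : ∀ᶠ z in 𝓝ˢ (cyl lam 0 r), X z = z.2.2.1 * w z
  indep : ∀ᶠ z in 𝓝ˢ (cyl lam 0 r), z.1 = 0 → X z = X (zeroY z)
  analytic_coeff : ∀ i, AnalyticAt ℂ (c i) (0, lam)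
  resonant : ∀ i, lam ^ (i - 1) ≠ 1 → c i = 0
  form : DivBy lam r j (fun z => X (F z) - z.2.1 * X z -
    ∑ i ∈ Finset.Ico 2 j, c i (z.1, z.2.1) * X z ^ i)

variable {lam : ℂ} {r : ℝ} {F : ℂ × ℂ × ℂ × ℂ → ℂ × ℂ × ℂ × ℂ}

lemma StraightFamily.apply (hF : StraightFamily lam r F) {z : ℂ × ℂ × ℂ × ℂ}
    (hz : z ∈ cyl lam 0 r) : F z = (0, lam, 0, 0) := by
  obtain ⟨h1, h2, h3, -⟩ := mem_cyl.mp hz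
  have := hF.degenerate.self_of_nhdsSet z hz h1
  rw [this, h2, h3]
  simp

lemma zero_mem_cyl (hr : 0 ≤ r) (lam x₀ : ℂ) :
    ((0 : ℂ), lam, x₀, (0 : ℂ)) ∈ cyl lam x₀ r :=
  mem_cyl.mpr ⟨rfl, rfl, rfl, by simpa using hr⟩

lemma StraightFamily.comp_analytic (hF : StraightFamily lam r F) (hr : 0 ≤ r)
    {X : ℂ × ℂ × ℂ × ℂ → ℂ} (hX : AnalyticOnNhd ℂ X (cyl lam 0 r)) :
    AnalyticOnNhd ℂ (fun z => X (F z)) (cyl lam 0 r) := fun z hz =>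
  AnalyticAt.fun_comp (hX _ (by rw [hF.apply hz]; exact zero_mem_cyl hr _ _)) (hF.analytic z hz)

lemma analyticOnNhd_dropX {u : ℂ × ℂ × ℂ → ℂ} (hu : AnalyticOnNhd ℂ u (disk₃ lam r)) (x₀ : ℂ) :
    AnalyticOnNhd ℂ (fun z => u (dropX z)) (cyl lam x₀ r) := fun z hz =>
  AnalyticAt.fun_comp (hu _ (mapsTo_dropX _ _ _ hz)) (analyticAt_dropX z)

lemma analyticOnNhd_contr_dropX (hl : lam ≠ 0) (hr : 0 ≤ r) {u : ℂ × ℂ × ℂ → ℂ}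
    (hu : AnalyticOnNhd ℂ u (disk₃ lam r)) :
    AnalyticOnNhd ℂ (fun z => u (contr (dropX z))) (cyl lam 0 r) := by
  intro z hz
  have h1 : AnalyticAt ℂ (fun z => contr (dropX z)) z :=
    AnalyticAt.fun_comp (analyticAt_contr ((mem_cyl.mp hz).2.1 ▸ hl)) (analyticAt_dropX z)
  refine AnalyticAt.fun_comp (g := u) (f := fun z => contr (dropX z)) (hu _ ?_) h1
  rw [contr_mem (mapsTo_dropX _ _ _ hz)]
  exact mem_disk₃.mpr ⟨rfl, rfl, by simpa using hr⟩

/-- The difference of `u` along the dynamics and along its linear model is divisible by `ξ`. -/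
lemma StraightFamily.divBy_sub (hF : StraightFamily lam r F) (hl : lam ≠ 0) (hr : 0 ≤ r)
    {u : ℂ × ℂ × ℂ → ℂ} (hu : AnalyticOnNhd ℂ u (disk₃ lam r)) :
    DivBy lam r 1 (fun z => u (dropX (F z)) - u (contr (dropX z))) := by
  refine DivBy.of_vanish ((hF.comp_analytic hr (analyticOnNhd_dropX hu 0)).sub
    (analyticOnNhd_contr_dropX hl hr hu)) ?_
  filter_upwards [hF.line] with z hz h0
  rw [hz h0]
  exact sub_self _

lemma analyticOnNhd_coeff {c : ℂ × ℂ → ℂ} (hc : AnalyticAt ℂ c (0, lam)) :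
    AnalyticOnNhd ℂ (fun z : ℂ × ℂ × ℂ × ℂ => c (z.1, z.2.1)) (cyl lam 0 r) := by
  intro z hz
  obtain ⟨h1, h2, -, -⟩ := mem_cyl.mp hz
  refine AnalyticAt.fun_comp (g := c) (f := fun z : ℂ × ℂ × ℂ × ℂ => (z.1, z.2.1)) ?_ (by fun_prop)
  rw [h1, h2]
  exact hc

/-- The first coordinate change, making the transverse multiplier constant. -/
lemma exists_partialNormalForm_two (hF : StraightFamily lam r F) (hl : lam ≠ 0) (hr : 0 ≤ r) :
    ∃ X w c, PartialNormalForm lam r F 2 X w c := by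
  have hF1 : DivBy lam r 1 (fun z => (F z).2.2.1) := by
    refine DivBy.of_vanish (fun z hz => ?_) ?_
    · have := hF.analytic z hz
      fun_prop
    · filter_upwards [hF.line] with z hz h0
      rw [hz h0]
  obtain ⟨e, he, heq⟩ := hF1
  simp only [pow_one] at heq
  have hea : ∀ᶠ z in 𝓝ˢ (cyl lam 0 r), z.1 = 0 → e z - (z.2.1 + z.2.2.1) = 0 := by
    refine eventually_eq_zero_of_ne (fun z hz => (he z hz).sub (by fun_prop)) ?_
    filter_upwards [heq, hF.degenerate] with z h1 h2 h0 hξ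
    rw [h2 h0] at h1
    simp only at h1
    have : z.2.2.1 * (e z - (z.2.1 + z.2.2.1)) = 0 := by linear_combination -h1
    exact (mul_eq_zero.mp this).resolve_left hξ
  -- the transverse multiplier along the strong stable manifold
  have hfan : AnalyticOnNhd ℂ (fun z => e (zeroX z)) (disk₃ lam r) := fun z hz =>
    AnalyticAt.fun_comp (he _ (mapsTo_zeroX _ _ hz)) (analyticAt_zeroX z)
  have hfa : ∀ᶠ z in 𝓝ˢ (disk₃ lam r), z.1 = 0 → e (zeroX z) = z.2.1 := by
    filter_upwards [(tendsto_zeroX lam r).eventually hea] with z hz h0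
    have := hz h0
    simp only [zeroX, add_zero] at this
    exact sub_eq_zero.mp this
  have hfK : ∀ z ∈ disk₃ lam r, e (zeroX z) = lam := fun z hz => by
    rw [hfa.self_of_nhdsSet z hz (mem_disk₃.mp hz).1, (mem_disk₃.mp hz).2.1]
  -- At the fixed point the transverse multiplier is the eigenvalue l, so the logarithm of
  -- multiplier / l vanishes at Y = 0, as the cohomological equation requires.
  have hf0 : ∀ᶠ z in 𝓝ˢ (disk₃ lam r), z.2.2 = 0 → e (zeroX z) = z.2.1 := by
    have h1 : ∀ᶠ z in 𝓝ˢ (cyl lam 0 r), ∀ᶠ w in 𝓝 z, (F w).2.2.1 = w.2.2.1 * e w :=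
      eventually_nhdsSet_iff_forall.mpr fun z hz =>
        (eventually_nhdsSet_iff_forall.mp heq z hz).eventually_nhds
    have h2 : ∀ᶠ z in 𝓝ˢ (cyl lam 0 r), AnalyticAt ℂ e z :=
      eventually_nhdsSet_iff_forall.mpr fun z hz => (he z hz).eventually_analyticAt
    filter_upwards [(tendsto_zeroX lam r).eventually h1, (tendsto_zeroX lam r).eventually h2,
      (tendsto_zeroX lam r).eventually hF.multiplier] with z h1 h2 h3 hz
    have hzX : zeroX z = (z.1, z.2.1, 0, 0) := by simp [zeroX, hz]
    rw [hzX] at h1 h2 h3 ⊢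
    have h3 := h3 rfl
    simp only at h3
    have hc : HasDerivAt (fun ξ : ℂ => (z.1, z.2.1, ξ, (0 : ℂ)))
        ((0 : ℂ), (0 : ℂ), (1 : ℂ), (0 : ℂ)) 0 :=
      (hasDerivAt_const _ _).prodMk ((hasDerivAt_const _ _).prodMk
        ((hasDerivAt_id _).prodMk (hasDerivAt_const _ _)))
    have h4 := HasFDerivAt.comp_hasDerivAt (f := fun ξ : ℂ => (z.1, z.2.1, ξ, (0 : ℂ))) (l := e)
      (0 : ℂ) h2.differentiableAt.hasFDerivAt hc
    have h5 := (hasDerivAt_id' (0 : ℂ)).fun_mul h4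
    have h6 : ∀ᶠ ξ in 𝓝 (0 : ℂ), (F (z.1, z.2.1, ξ, 0)).2.2.1 = ξ * e (z.1, z.2.1, ξ, 0) :=
      hc.continuousAt.eventually (p := fun w => (F w).2.2.1 = w.2.2.1 * e w) h1
    have h7 := h3.unique (h5.congr_of_eventuallyEq h6)
    simpa using h7.symm
  have hlog : AnalyticOnNhd ℂ (fun z : ℂ × ℂ × ℂ => Complex.log (e (zeroX z) / z.2.1))
      (disk₃ lam r) := by
    intro z hz
    have h1 : AnalyticAt ℂ (fun z : ℂ × ℂ × ℂ => e (zeroX z) / z.2.1) z :=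
      (hfan z hz).div (by fun_prop) ((mem_disk₃.mp hz).2.1 ▸ hl)
    refine h1.clog ?_
    rw [hfK z hz, (mem_disk₃.mp hz).2.1, div_self hl]
    exact Complex.one_mem_slitPlane
  have hne : ∀ᶠ z in 𝓝ˢ (disk₃ lam r), z.2.1 ≠ 0 := by
    rw [eventually_nhdsSet_iff_forall]
    intro z hz
    have : ContinuousAt (fun z : ℂ × ℂ × ℂ => z.2.1) z := by fun_prop
    exact this.eventually_ne ((mem_disk₃.mp hz).2.1 ▸ hl)
  have hfne : ∀ᶠ z in 𝓝ˢ (disk₃ lam r), e (zeroX z) ≠ 0 := by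
    rw [eventually_nhdsSet_iff_forall]
    intro z hz
    exact (hfan z hz).continuousAt.eventually_ne (by rw [hfK z hz]; exact hl)
  -- The multiplicative equation l v(Y) = e(0, Y) v(νY) becomes additive for u = log v, with k = 0;
  -- then X = ξ v has constant multiplier l.
  obtain ⟨u, hu, hueq, hu0⟩ := exists_cohomological hl hr 0 hlog (by
    filter_upwards [hf0, hne] with z h1 h2 h0
    rw [h1 h0, div_self h2, Complex.log_one])
  have hua : ∀ᶠ z in 𝓝ˢ (disk₃ lam r), z.1 = 0 → u z = 0 := by
    filter_upwards [hueq, (tendsto_zeroY₃ hr).eventually hu0, hfa, hne] with z h1 h2 h3 h4 h0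
    have hc : contr z = zeroY₃ z := by simp [contr, zeroY₃, h0, nu]
    rw [hc, h2 rfl, h3 h0, div_self h4, Complex.log_one] at h1
    simpa using h1
  -- the coordinate
  let v : ℂ × ℂ × ℂ → ℂ := fun z => Complex.exp (u z)
  have hv : AnalyticOnNhd ℂ v (disk₃ lam r) := fun z hz => (hu z hz).cexp
  have hveq : ∀ᶠ z in 𝓝ˢ (disk₃ lam r), z.2.1 * v z = e (zeroX z) * v (contr z) := by
    filter_upwards [hueq, hne, hfne] with z h1 h2 h3
    have h4 : u z = Complex.log (e (zeroX z) / z.2.1) + u (contr z) := by linear_combination h1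
    simp only [v]
    rw [h4, Complex.exp_add, Complex.exp_log (div_ne_zero h3 h2)]
    field_simp
  have hva := analyticOnNhd_dropX hv 0
  refine ⟨fun z => z.2.2.1 * v (dropX z), fun z => v (dropX z), fun _ => 0, ?_, hva,
    fun z _ => Complex.exp_ne_zero _, Eventually.of_forall fun z => rfl, ?_,
    fun _ => analyticAt_const, fun _ _ => rfl, ?_⟩
  · exact fun z hz => AnalyticAt.mul (by fun_prop) (hva z hz)
  · filter_upwards [(tendsto_dropX lam 0 r).eventually hua,
      ((tendsto_dropX lam 0 r).comp (tendsto_zeroY hr)).eventually hua] with z h1 h2 h0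
    have h3 : (zeroY z).2.2.1 = z.2.2.1 := rfl
    simp only [v, h1 h0, h3]
    rw [show u (dropX (zeroY z)) = 0 from h2 h0]
  · have hbr : DivBy lam r 1 (fun z => v (dropX (F z)) * e z - z.2.1 * v (dropX z)) := by
      refine DivBy.of_vanish (((hF.comp_analytic hr hva).mul he).sub
        (fun z hz => AnalyticAt.mul (by fun_prop) (hva z hz))) ?_
      filter_upwards [hF.line, (tendsto_dropX lam 0 r).eventually hveq] with z h1 h2 h0
      have h3 : zeroX (dropX z) = z := by
        ext
        · rfl
        · rfl
        · exact h0.symm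
        · rfl
      rw [h1 h0]
      rw [h3] at h2
      have h4 : (dropX z).2.1 = z.2.1 := rfl
      rw [h4] at h2
      rw [h2]
      simp only [contr, dropX]
      ring
    have hξ : DivBy lam r 1 (fun z => z.2.2.1) :=
      ⟨fun _ => 1, analyticOnNhd_const, Eventually.of_forall fun z => by simp⟩
    refine (hξ.mul hbr).congr ?_
    filter_upwards [heq] with z hz
    simp only [Finset.Ico_self, Finset.sum_empty, hz]
    ring

/-- Extending the normal form by one order. -/
lemma PartialNormalForm.succ (hF : StraightFamily lam r F) (hl : lam ≠ 0) (hr : 0 ≤ r) {j : ℕ}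
    (hj : 2 ≤ j) {X w : ℂ × ℂ × ℂ × ℂ → ℂ} {c : ℕ → ℂ × ℂ → ℂ}
    (h : PartialNormalForm lam r F j X w c) : ∃ X w c, PartialNormalForm lam r F (j + 1) X w c := by
  have hX1 : DivBy lam r 1 X :=
    ⟨w, h.analytic_unit, h.eq_mul.mono fun z hz => by rw [hz, pow_one]⟩
  obtain ⟨e0, he0, heq0⟩ := h.form
  have hwne : ∀ᶠ z in 𝓝ˢ (cyl lam 0 r), w z ≠ 0 :=
    eventually_nhdsSet_iff_forall.mpr fun z hz =>
      (h.analytic_unit z hz).continuousAt.eventually_ne (h.unit_ne z hz)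
  -- The error is divisible by ξ^j; dividing by the unit w^j rewrites it as a multiple of X^j.
  let e : ℂ × ℂ × ℂ × ℂ → ℂ := fun z => e0 z / w z ^ j
  have he : AnalyticOnNhd ℂ e (cyl lam 0 r) := fun z hz =>
    (he0 z hz).div ((h.analytic_unit z hz).pow j) (pow_ne_zero _ (h.unit_ne z hz))
  have heq : ∀ᶠ z in 𝓝ˢ (cyl lam 0 r), X (F z) - z.2.1 * X z -
      ∑ i ∈ Finset.Ico 2 j, c i (z.1, z.2.1) * X z ^ i = X z ^ j * e z := by
    filter_upwards [heq0, h.eq_mul, hwne] with z h1 h2 h3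
    rw [h1, h2]
    simp only [e]
    field_simp
    ring
  -- at `a = 0` nothing depends on `Y`
  have hea : ∀ᶠ z in 𝓝ˢ (cyl lam 0 r), z.1 = 0 → e z - e (zeroY z) = 0 := by
    refine eventually_eq_zero_of_ne (fun z hz => (he z hz).sub
      (AnalyticAt.fun_comp (he _ (mapsTo_zeroY hr hz)) (analyticAt_zeroY z))) ?_
    filter_upwards [heq, (tendsto_zeroY hr).eventually heq, h.indep, hF.degenerate,
      (tendsto_zeroY hr).eventually hF.degenerate, h.eq_mul, hwne] with z h1 h2 h3 h4 h5 h6 h7 h0 hξ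
    have hXne : X z ≠ 0 := by rw [h6]; exact mul_ne_zero hξ h7
    have hFF : F (zeroY z) = F z := by rw [h4 h0, h5 h0]; rfl
    have e1 : (zeroY z).1 = z.1 := rfl
    have e2 : (zeroY z).2.1 = z.2.1 := rfl
    rw [hFF, e1, e2, ← h3 h0, h1] at h2
    exact sub_eq_zero.mpr (mul_left_cancel₀ (pow_ne_zero j hXne) h2)
  have hfan : AnalyticOnNhd ℂ (fun z => e (zeroX z)) (disk₃ lam r) := fun z hz =>
    AnalyticAt.fun_comp (he _ (mapsTo_zeroX _ _ hz)) (analyticAt_zeroX z)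
  obtain ⟨k, rfl⟩ : ∃ k, j = k + 1 := ⟨j - 1, by omega⟩
  -- With X' = X + u X^(k+1), the coefficient of X^(k+1) on ξ = 0 changes from f to f + l^(k+1)
  -- u(νY) - l u(Y), and u is chosen so that this equals the resonant constant d. All other effects
  -- have order at least k + 2.
  obtain ⟨u, d, hu, hd, hdres, hueq, hua⟩ := exists_solution hl hr k hfan (by
    filter_upwards [(tendsto_zeroX lam r).eventually hea] with z hz h0
    exact sub_eq_zero.mp (hz h0))
  have hua4 := analyticOnNhd_dropX hu 0
  have hXF : DivBy lam r 2 (fun z => X (F z) - z.2.1 * X z) := by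
    have h1 : DivBy lam r 2 (fun z => X z ^ (k + 1) * e z) :=
      ((hX1.pow (k + 1)).mul (DivBy.of_analytic he)).mono hj
    have h2 : DivBy lam r 2 (fun z => ∑ i ∈ Finset.Ico 2 (k + 1), c i (z.1, z.2.1) * X z ^ i) := by
      refine DivBy.sum fun i hi => ?_
      exact ((DivBy.of_analytic (analyticOnNhd_coeff (h.analytic_coeff i))).mul
        (hX1.pow i)).mono (by have := (Finset.mem_Ico.mp hi).1; omega)
    refine (h1.add h2).congr ?_
    filter_upwards [heq] with z hz
    linear_combination hz
  have hlan : DivBy lam r 0 (fun z => z.2.1) :=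
    DivBy.of_analytic fun z _ => by fun_prop
  have hlX : DivBy lam r 1 (fun z => z.2.1 * X z) := (hlan.mul hX1).mono (by omega)
  have hXF1 : DivBy lam r 1 (fun z => X (F z)) :=
    ((hXF.mono (j := 1) (by omega)).add hlX).congr (Eventually.of_forall fun z => by ring)
  let X' : ℂ × ℂ × ℂ × ℂ → ℂ := fun z => X z + u (dropX z) * X z ^ (k + 1)
  let w' : ℂ × ℂ × ℂ × ℂ → ℂ := fun z => w z + u (dropX z) * (X z ^ k * w z)
  let c' : ℕ → ℂ × ℂ → ℂ := fun i => if i = k + 1 then d else c i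
  have hdiff : DivBy lam r (k + 1) (fun z => X' z - X z) := by
    refine ((DivBy.of_analytic hua4).mul (hX1.pow (k + 1))).mono (by omega) |>.congr
      (Eventually.of_forall fun z => ?_)
    simp only [X']; ring
  have hX'1 : DivBy lam r 1 X' :=
    ((hdiff.mono (j := 1) (by omega)).add hX1).congr (Eventually.of_forall fun z => by ring)
  have hK0 : ∀ z ∈ cyl lam 0 r, X z = 0 := fun z hz => by
    rw [h.eq_mul.self_of_nhdsSet z hz, (mem_cyl.mp hz).2.2.1, zero_mul]
  refine ⟨X', w', c', ?_, ?_, ?_, ?_, ?_, ?_, ?_, ?_⟩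
  · exact h.analytic.add (hua4.mul (h.analytic.pow (k + 1)))
  · exact h.analytic_unit.add (hua4.mul ((h.analytic.pow k).mul h.analytic_unit))
  · intro z hz
    have : k ≠ 0 := by omega
    simp only [w', hK0 z hz, zero_pow this, zero_mul, mul_zero, add_zero]
    exact h.unit_ne z hz
  · filter_upwards [h.eq_mul] with z hz
    simp only [X', w']
    linear_combination (1 + u (dropX z) * X z ^ k) * hz
  · filter_upwards [h.indep, (tendsto_dropX lam 0 r).eventually hua] with z h1 h2 h0
    simp only [X']
    rw [← h1 h0, h2 h0]
    rfl
  · intro i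
    simp only [c']
    split_ifs
    · exact hd
    · exact h.analytic_coeff i
  · intro i hi
    simp only [c']
    split_ifs with hik
    · refine hdres ?_
      rwa [hik, Nat.add_sub_cancel] at hi
    · exact h.resonant i hi
  · -- the terms of the new error
    have t1 : DivBy lam r (k + 1 + 1) (fun z => X z ^ (k + 1) * (e z - e (zeroX (dropX z)))) := by
      refine (hX1.pow (k + 1)).mul (DivBy.of_vanish ?_ (Eventually.of_forall fun z hz => ?_))
      · exact he.sub (analyticOnNhd_dropX hfan 0)
      · have h3 : zeroX (dropX z) = z := by
          ext
          · rfl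
          · rfl
          · exact hz.symm
          · rfl
        rw [h3, sub_self]
    have t2 : DivBy lam r (k + 1 + 1)
        (fun z => (u (dropX (F z)) - u (contr (dropX z))) * X (F z) ^ (k + 1)) :=
      ((hF.divBy_sub hl hr hu).mul (hXF1.pow (k + 1))).mono (by omega)
    have t3 : DivBy lam r (k + 1 + 1)
        (fun z => u (contr (dropX z)) * (X (F z) ^ (k + 1) - (z.2.1 * X z) ^ (k + 1))) :=
      ((DivBy.of_analytic (analyticOnNhd_contr_dropX hl hr hu)).mul
        (DivBy.pow_sub_pow hXF1 hlX hXF k)).mono (by omega)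
    have t4 : DivBy lam r (k + 1 + 1) (fun z => ∑ i ∈ Finset.Ico 2 (k + 1 + 1),
        c' i (z.1, z.2.1) * (X' z ^ i - X z ^ i)) := by
      refine DivBy.sum fun i hi => ?_
      have h2i := (Finset.mem_Ico.mp hi).1
      obtain ⟨n, rfl⟩ : ∃ n, i = n + 1 := ⟨i - 1, by omega⟩
      have hc' : AnalyticAt ℂ (c' (n + 1)) (0, lam) := by
        simp only [c']
        split_ifs
        · exact hd
        · exact h.analytic_coeff _
      exact ((DivBy.of_analytic (analyticOnNhd_coeff hc')).mul
        (DivBy.pow_sub_pow hX'1 hX1 hdiff n)).mono (by omega)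
    refine (((t1.add t2).add t3).sub t4).congr ?_
    filter_upwards [heq, (tendsto_dropX lam 0 r).eventually hueq] with z h1 h2
    have hsum : ∑ i ∈ Finset.Ico 2 (k + 1 + 1), c' i (z.1, z.2.1) * X z ^ i =
        ∑ i ∈ Finset.Ico 2 (k + 1), c i (z.1, z.2.1) * X z ^ i +
          d (z.1, z.2.1) * X z ^ (k + 1) := by
      rw [Finset.sum_Ico_succ_top hj]
      congr 1
      · refine Finset.sum_congr rfl fun i hi => ?_
        have := (Finset.mem_Ico.mp hi).2
        simp only [c', if_neg (show i ≠ k + 1 by omega)]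
      · simp only [c', if_true]
    have hsum2 : ∑ i ∈ Finset.Ico 2 (k + 1 + 1), c' i (z.1, z.2.1) * (X' z ^ i - X z ^ i) =
        ∑ i ∈ Finset.Ico 2 (k + 1 + 1), c' i (z.1, z.2.1) * X' z ^ i -
          ∑ i ∈ Finset.Ico 2 (k + 1 + 1), c' i (z.1, z.2.1) * X z ^ i := by
      rw [← Finset.sum_sub_distrib]
      exact Finset.sum_congr rfl fun i _ => by ring
    have h3 : (dropX z).2.1 = z.2.1 := rfl
    have h4 : (dropX z).1 = z.1 := rfl
    rw [h3, h4] at h2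
    rw [hsum2, hsum]
    simp only [X']
    rw [mul_pow]
    linear_combination h1 - X z ^ (k + 1) * h2

lemma exists_partialNormalForm (hF : StraightFamily lam r F) (hl : lam ≠ 0) (hr : 0 ≤ r) {j : ℕ}
    (hj : 2 ≤ j) : ∃ X w c, PartialNormalForm lam r F j X w c := by
  induction j, hj using Nat.le_induction with
  | base => exact exists_partialNormalForm_two hF hl hr
  | succ j hj ih =>
    obtain ⟨X, w, c, h⟩ := ih
    exact h.succ hF hl hr hj

end SemiParabolicHenon

/-! ### Every petal of the quadratic polynomial meets the orbit of the critical value. -/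

namespace SemiParabolicHenon

section Parabolic

/-- A primitive P of G'/G vanishing at the centre makes G e^(-P) constant, so r₀ e^(P/2) is the
square root with prescribed value at the centre. -/
lemma exists_sqrt_on_ball {G : ℂ → ℂ} {p r₀ : ℂ} {ρ : ℝ} (hρ : 0 < ρ)
    (hG : DifferentiableOn ℂ G (ball p ρ)) (hne : ∀ z ∈ ball p ρ, G z ≠ 0) (hr₀ : r₀ ^ 2 = G p) :
    ∃ S : ℂ → ℂ, DifferentiableOn ℂ S (ball p ρ) ∧ S p = r₀ ∧ ∀ z ∈ ball p ρ, S z ^ 2 = G z := by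
  have hG' : DifferentiableOn ℂ (fun z => deriv G z / G z) (ball p ρ) :=
    (hG.deriv isOpen_ball).div hG hne
  obtain ⟨P, hP0, hP⟩ := hG'.isExactOn_ball.with_val_at p 0
  have hd : ∀ z ∈ ball p ρ, HasDerivAt (fun z => G z * Complex.exp (-P z)) 0 z := by
    intro z hz
    have h1 := (hG.differentiableAt (isOpen_ball.mem_nhds hz)).hasDerivAt
    have h2 := h1.fun_mul (hP z hz).neg.cexp
    refine h2.congr_deriv ?_
    have := hne z hz
    simp only [Pi.neg_apply]
    field_simp
    ring
  have hconst : ∀ z ∈ ball p ρ, G z * Complex.exp (-P z) = G p := by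
    intro z hz
    have := isOpen_ball.is_const_of_deriv_eq_zero (convex_ball p ρ).isPreconnected
      (fun z hz => (hd z hz).differentiableAt.differentiableWithinAt)
      (fun z hz => (hd z hz).deriv) hz (mem_ball_self hρ)
    simpa [hP0] using this
  refine ⟨fun z => r₀ * Complex.exp (P z / 2), fun z hz => ?_, by simp [hP0], fun z hz => ?_⟩
  · exact (((hP z hz).div_const 2).cexp.const_mul r₀).differentiableAt.differentiableWithinAt
  · rw [mul_pow, ← Complex.exp_nat_mul, hr₀, ← hconst z hz, mul_assoc, ← Complex.exp_add]
    simp only [Nat.cast_ofNat]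
    rw [mul_div_cancel₀ _ (two_ne_zero), neg_add_cancel, Complex.exp_zero, mul_one]

/-- The quadratic polynomial with fixed point `0` of multiplier `lam`. -/
def quad (lam z : ℂ) : ℂ := lam * z + z ^ 2

lemma differentiable_quad_iterate (lam : ℂ) (n : ℕ) : Differentiable ℂ ((quad lam)^[n]) := by
  refine Differentiable.iterate ?_ n
  unfold quad
  fun_prop

lemma lt_norm_quad {lam : ℂ} (hl : ‖lam‖ = 1) {z : ℂ} (hz : 3 < ‖z‖) : ‖z‖ < ‖quad lam z‖ := by
  have h1 : quad lam z = z * (z + lam) := by unfold quad; ring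
  have h2 : ‖z‖ - ‖lam‖ ≤ ‖z + lam‖ := by
    have := norm_sub_norm_le z (-lam)
    simpa using this
  rw [h1, norm_mul]
  nlinarith

/-- Inverse branches of the iterates of a quadratic polynomial on a disk whose image does not meet
the orbit of the critical value. -/
lemma exists_inverse_branch {lam : ℂ} (hl : ‖lam‖ = 1) {G : ℂ → ℂ} {p : ℂ} {ρ : ℝ} (hρ : 0 < ρ)
    (hG : DifferentiableOn ℂ G (ball p ρ)) (hG3 : ∀ z ∈ ball p ρ, ‖G z‖ ≤ 3)
    (hcrit : ∀ z ∈ ball p ρ, ∀ i, G z ≠ (quad lam)^[i] (-lam ^ 2 / 4)) (n : ℕ) :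
    ∀ ζ : ℂ, (quad lam)^[n] ζ = G p → ∃ h : ℂ → ℂ, DifferentiableOn ℂ h (ball p ρ) ∧ h p = ζ ∧
      (∀ z ∈ ball p ρ, (quad lam)^[n] (h z) = G z) ∧ ∀ z ∈ ball p ρ, ‖h z‖ ≤ 3 := by
  induction n with
  | zero => exact fun ζ hζ => ⟨G, hG, hζ.symm, fun z _ => rfl, hG3⟩
  | succ n ih =>
    intro ζ hζ
    rw [Function.iterate_succ_apply] at hζ
    obtain ⟨h, hh, hp, heq, hb⟩ := ih _ hζ
    obtain ⟨S, hS, hSp, hSeq⟩ := exists_sqrt_on_ball (G := fun z => h z + lam ^ 2 / 4)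
      (r₀ := ζ + lam / 2) hρ (hh.add_const _) (fun z hz h0 => by
        refine hcrit z hz n ?_
        rw [← heq z hz]
        congr 1
        linear_combination h0) (by simp only [hp, quad]; ring)
    have hq : ∀ z ∈ ball p ρ, quad lam (S z - lam / 2) = h z := by
      intro z hz
      have := hSeq z hz
      unfold quad
      linear_combination this
    refine ⟨fun z => S z - lam / 2, hS.sub_const _, by simp [hSp], fun z hz => ?_, fun z hz => ?_⟩
    · rw [Function.iterate_succ_apply, hq z hz, heq z hz]
    -- Outside the disk of radius 3 the polynomial increases the modulus, so taking a preimage of a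
    -- point of this disk cannot leave it.
    · by_contra! hlt
      have h1 := lt_norm_quad hl hlt
      rw [hq z hz] at h1
      have h2 := hb z hz
      linarith

/-- X parametrizes an invariant region on which the q-th iterate is the almost-translation F.
Suppose X avoids the critical orbit. For p = F^n(w₀) all inverse branches along the orbit then exist
on a disk about p of radius at least 1 + 9n/10, giving h with h(p) = X(w₀) and |h| ≤ 3. Cauchy's
estimate yields h'(p) = O(1/n), whereas (F^n)'(w₀) = O(√n). As X'(w₀) = h'(p) (F^n)'(w₀) for every
n, it follows that X'(w₀) = 0, a contradiction. -/
lemma no_free_petal {lam : ℂ} (hl : ‖lam‖ = 1) {q : ℕ} {X F : ℂ → ℂ} {R : ℝ}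
    (hX : DifferentiableOn ℂ X {w | R < w.re}) (hX' : ∀ w, R < w.re → deriv X w ≠ 0)
    (hX3 : ∀ w, R < w.re → ‖X w‖ ≤ 3) (hF : DifferentiableOn ℂ F {w | R < w.re})
    (hF1 : ∀ w, R < w.re → ‖F w - w - 1‖ ≤ 1 / 10)
    (hconj : ∀ w, R < w.re → X (F w) = (quad lam)^[q] (X w)) :
    ∃ w, R < w.re ∧ ∃ i, X w = (quad lam)^[i] (-lam ^ 2 / 4) := by
  by_contra! hcrit
  have hopen : IsOpen {w : ℂ | R < w.re} := isOpen_lt continuous_const Complex.continuous_re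
  set w₀ : ℂ := ((R + 1 : ℝ) : ℂ) with hw₀
  have hre : ∀ w, R < w.re → w.re + 9 / 10 ≤ (F w).re := by
    intro w hw
    have h1 := (Complex.abs_re_le_norm _).trans (hF1 w hw)
    rw [abs_le] at h1
    simp only [Complex.sub_re, Complex.one_re] at h1
    linarith
  have hball : ∀ w : ℂ, ball w (w.re - R) ⊆ {w | R < w.re} := by
    intro w z hz
    rw [mem_ball, dist_eq_norm] at hz
    have h1 := (Complex.abs_re_le_norm (z - w)).trans_lt hz
    rw [abs_lt] at h1
    simp only [Complex.sub_re] at h1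
    simp only [mem_ofPred_eq]
    linarith
  -- Cauchy's estimate for F(w) - w - 1 on a disk of half the distance to the boundary of the half
  -- plane.
  have hFd : ∀ w, R < w.re → ‖deriv F w‖ ≤ 1 + (1 / 5) / (w.re - R) := by
    intro w hw
    have hpos : 0 < (w.re - R) / 2 := by linarith
    have hE : DifferentiableOn ℂ (fun z => F z - z - 1) {w | R < w.re} :=
      (hF.sub differentiableOn_id).sub_const 1
    have hcb : closedBall w ((w.re - R) / 2) ⊆ {w | R < w.re} :=
      (closedBall_subset_ball (by linarith)).trans (hball w)
    have h1 := Complex.norm_deriv_le_of_forall_mem_sphere_norm_le (f := fun z => F z - z - 1)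
      (C := 1 / 10) hpos
      ((hE.mono hcb).diffContOnCl_ball subset_rfl)
      (fun z hz => hF1 z (hcb (sphere_subset_closedBall hz)))
    have h2 : HasDerivAt (fun z => F z - z - 1) (deriv F w - 1) w :=
      (((hF.differentiableAt (hopen.mem_nhds hw)).hasDerivAt).sub (hasDerivAt_id w)).sub_const 1
    rw [h2.deriv] at h1
    have h3 : ‖deriv F w‖ ≤ ‖deriv F w - 1‖ + 1 := by
      have := norm_add_le (deriv F w - 1) 1
      simpa using this
    have h4 : (1 : ℝ) / 10 / ((w.re - R) / 2) = (1 / 5) / (w.re - R) := by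
      field_simp; norm_num
    linarith
  -- the orbit of `w₀` and the derivatives along it
  have horb : ∀ n : ℕ, R + 1 + 9 / 10 * n ≤ (F^[n] w₀).re ∧
      ∃ d : ℂ, HasDerivAt (F^[n]) d w₀ ∧ ‖d‖ ^ 2 ≤ n + 1 := by
    intro n
    induction n with
    | zero => exact ⟨by simp [w₀], 1, hasDerivAt_id w₀, by simp⟩
    | succ n ih =>
      obtain ⟨h1, d, hd, hdn⟩ := ih
      have hn : (0 : ℝ) ≤ n := n.cast_nonneg
      have hin : R < (F^[n] w₀).re := by linarith
      refine ⟨?_, deriv F (F^[n] w₀) * d, ?_, ?_⟩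
      · rw [Function.iterate_succ_apply']
        have := hre _ hin
        push_cast
        linarith
      · rw [Function.iterate_succ']
        exact (hF.differentiableAt (hopen.mem_nhds hin)).hasDerivAt.comp w₀ hd
      · have h2 := hFd _ hin
        -- The increment of ‖d‖² is at most 4/9 + 4/81 < 1, so the bound n + 1 propagates; any
        -- growth slower than linear in n for ‖d‖ would suffice.
        have h3 : (1 / 5 : ℝ) / ((F^[n] w₀).re - R) ≤ (2 / 9) / (n + 1) := by
          rw [div_le_div_iff₀ (by linarith) (by linarith)]
          linarith
        have h4 : ‖deriv F (F^[n] w₀)‖ ≤ 1 + (2 / 9) / (n + 1) := by linarith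
        rw [norm_mul, mul_pow]
        calc ‖deriv F (F^[n] w₀)‖ ^ 2 * ‖d‖ ^ 2 ≤ (1 + (2 / 9) / (n + 1 : ℝ)) ^ 2 * (n + 1) := by
              gcongr
          _ = n + 1 + 4 / 9 + (4 / 81) / (n + 1 : ℝ) := by
              field_simp; ring
          _ ≤ n + 1 + 4 / 9 + 4 / 81 := by
              have : (4 / 81) / (n + 1 : ℝ) ≤ 4 / 81 := div_le_self (by norm_num) (by linarith)
              linarith
          _ ≤ ((n + 1 : ℕ) : ℝ) + 1 := by push_cast; linarith
  have hiter : ∀ n : ℕ, ∀ w, (∀ k ≤ n, R < (F^[k] w).re) →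
      X (F^[n] w) = (quad lam)^[q * n] (X w) := by
    intro n
    induction n with
    | zero => intro w _; rfl
    | succ n ih =>
      intro w hw
      rw [Function.iterate_succ_apply', hconj _ (hw n (by omega)),
        ih w (fun k hk => hw k (by omega)), ← Function.iterate_add_apply,
        show q * (n + 1) = q + q * n by ring]
  have hw₀R : R < w₀.re := by simp [w₀]
  have hRn : ∀ n : ℕ, R < (F^[n] w₀).re := fun n => by
    have := (horb n).1
    have hn : (0 : ℝ) ≤ n := n.cast_nonneg
    linarith
  have hbound : ∀ n : ℕ, ‖deriv X w₀‖ ^ 2 * (n + 1) ≤ 45 := by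
    intro n
    obtain ⟨h1, d, hd, hdn⟩ := horb n
    have hn : (0 : ℝ) ≤ n := n.cast_nonneg
    set p := F^[n] w₀ with hp
    have hρ : 0 < p.re - R := by linarith
    have hpR : R < p.re := by linarith
    obtain ⟨h, hh, hhp, heq, hh3⟩ := exists_inverse_branch hl hρ (hX.mono (hball p))
      (fun z hz => hX3 z (hball p hz)) (fun z hz i => hcrit z (hball p hz) i) (q * n) (X w₀)
      (hiter n w₀ fun k _ => hRn k).symm
    have hhd : HasDerivAt h (deriv h p) p :=
      (hh.differentiableAt (isOpen_ball.mem_nhds (mem_ball_self hρ))).hasDerivAt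
    have hqd : HasDerivAt ((quad lam)^[q * n]) (deriv ((quad lam)^[q * n]) (X w₀)) (X w₀) :=
      (differentiable_quad_iterate lam _).differentiableAt.hasDerivAt
    set D := deriv ((quad lam)^[q * n]) (X w₀)
    have hXp : HasDerivAt X (deriv X p) p :=
      (hX.differentiableAt (hopen.mem_nhds hpR)).hasDerivAt
    have hXw : HasDerivAt X (deriv X w₀) w₀ :=
      (hX.differentiableAt (hopen.mem_nhds hw₀R)).hasDerivAt
    have e1 : deriv X p = D * deriv h p := by
      have h2 : HasDerivAt (fun z => (quad lam)^[q * n] (h z)) (D * deriv h p) p := by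
        rw [← hhp] at hqd
        exact hqd.comp p hhd
      refine hXp.unique (h2.congr_of_eventuallyEq ?_)
      filter_upwards [isOpen_ball.mem_nhds (mem_ball_self hρ)] with z hz using (heq z hz).symm
    have e2 : deriv X p * d = D * deriv X w₀ := by
      have h2 : HasDerivAt (fun w => (quad lam)^[q * n] (X w)) (D * deriv X w₀) w₀ :=
        hqd.comp w₀ hXw
      have h3 : HasDerivAt (fun w => X (F^[n] w)) (deriv X p * d) w₀ := hXp.comp w₀ hd
      refine h3.unique (h2.congr_of_eventuallyEq ?_)
      have hkc : ∀ k ≤ n, ∀ᶠ w in 𝓝 w₀, R < (F^[k] w).re := by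
        intro k _
        obtain ⟨-, d', hd', -⟩ := horb k
        have hc : ContinuousAt (fun w => (F^[k] w).re) w₀ :=
          Complex.continuous_re.continuousAt.comp hd'.continuousAt
        exact hc.eventually_const_lt (hRn k)
      have := (Finset.range (n + 1)).eventually_all.mpr
        (fun k hk => hkc k (by have := Finset.mem_range.mp hk; omega))
      filter_upwards [this] with w hw
      exact hiter n w fun k hk => hw k (Finset.mem_range.mpr (by omega))
    -- The chain rule gives X'(p) = D h'(p) and X'(p) d = D X'(w₀); since X'(p) ≠ 0, the factor D
    -- can be cancelled.
    have hD : D ≠ 0 := by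
      intro h0
      rw [h0, zero_mul] at e1
      exact hX' p hpR e1
    have e3 : deriv X w₀ = deriv h p * d := by
      rw [e1] at e2
      exact mul_left_cancel₀ hD (by linear_combination -e2)
    have h5 : ‖deriv h p‖ ≤ 3 / ((p.re - R) / 2) :=
      Complex.norm_deriv_le_of_forall_mem_sphere_norm_le (by linarith)
        ((hh.mono (closedBall_subset_ball (by linarith))).diffContOnCl_ball subset_rfl)
        (fun z hz => hh3 z (closedBall_subset_ball (by linarith) (sphere_subset_closedBall hz)))
    have h6 : ‖deriv h p‖ ≤ (20 / 3) / (n + 1) := by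
      refine h5.trans ?_
      rw [div_le_div_iff₀ (by linarith) (by linarith)]
      linarith
    rw [e3, norm_mul, mul_pow]
    calc ‖deriv h p‖ ^ 2 * ‖d‖ ^ 2 * (n + 1)
        ≤ ((20 / 3) / (n + 1 : ℝ)) ^ 2 * (n + 1) * (n + 1) := by gcongr
      _ = 400 / 9 := by field_simp; norm_num
      _ ≤ 45 := by norm_num
  have hpos : 0 < ‖deriv X w₀‖ ^ 2 := by
    have := norm_pos_iff.mpr (hX' w₀ hw₀R)
    positivity
  obtain ⟨n, hn⟩ := exists_nat_gt (45 / ‖deriv X w₀‖ ^ 2)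
  rw [div_lt_iff₀ hpos] at hn
  have := hbound n
  nlinarith

end Parabolic

end SemiParabolicHenon

/-! ### Attracting petals, and the bound on their number. -/

namespace SemiParabolicHenon

section Parabolic

/-- The right half planes form a neighbourhood basis at the attracting end of a petal. -/
def rightEnd : Filter ℂ := comap Complex.re atTop

lemma eventually_rightEnd {p : ℂ → Prop} :
    (∀ᶠ w in rightEnd, p w) ↔ ∃ R : ℝ, ∀ w : ℂ, R < w.re → p w := by
  have h := (atTop_basis_Ioi (α := ℝ)).comap Complex.re
  rw [rightEnd, h.eventually_iff]
  simp

lemma tendsto_norm_rightEnd : Tendsto (fun w : ℂ => ‖w‖) rightEnd atTop :=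
  tendsto_atTop_mono Complex.re_le_norm tendsto_comap

/-- The parametrization of a petal in the direction `β` by a right half plane. -/
noncomputable def petal (m : ℕ) (β w : ℂ) : ℂ := β * Complex.exp (-(Complex.log w / m))

lemma petal_pow {m : ℕ} (hm : m ≠ 0) (β : ℂ) {w : ℂ} (hw : w ≠ 0) :
    petal m β w ^ m = β ^ m / w := by
  have hm' : (m : ℂ) ≠ 0 := Nat.cast_ne_zero.mpr hm
  rw [petal, mul_pow, ← Complex.exp_nat_mul,
    show (m : ℂ) * -(Complex.log w / m) = -Complex.log w by field_simp, Complex.exp_neg,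
    Complex.exp_log hw, div_eq_mul_inv]

lemma hasDerivAt_petal (m : ℕ) (β : ℂ) {w : ℂ} (hw : 0 < w.re) :
    HasDerivAt (petal m β) (petal m β w * -(w⁻¹ / m)) w := by
  have h := ((((Complex.hasDerivAt_log (Or.inl hw)).div_const (m : ℂ)).neg.cexp).const_mul β)
  refine h.congr_deriv ?_
  simp only [petal, Pi.neg_apply]
  ring

lemma tendsto_petal {m : ℕ} (hm : m ≠ 0) (β : ℂ) : Tendsto (petal m β) rightEnd (𝓝 0) := by
  have h1 : Tendsto (fun w : ℂ => ‖β ^ m‖ / ‖w‖) rightEnd (𝓝 0) :=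
    tendsto_const_nhds.div_atTop tendsto_norm_rightEnd
  rw [Metric.tendsto_nhds]
  intro ε hε
  filter_upwards [h1.eventually_lt_const (pow_pos hε m),
    tendsto_norm_rightEnd.eventually_gt_atTop 0] with w hw hw0
  rw [dist_zero_right]
  refine lt_of_pow_lt_pow_left₀ m hε.le ?_
  rwa [← norm_pow, petal_pow hm β (norm_pos_iff.mp hw0), norm_div]

lemma abs_arg_lt {w : ℂ} (hw : 0 < w.re) : |(Complex.log w).im| < Real.pi / 2 := by
  rw [Complex.log_im]
  exact Complex.abs_arg_lt_pi_div_two_iff.mpr (Or.inl hw)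

/-- In the coordinate z = β w^(-1/m) the map becomes F(w) = w (1 + s)^(-m) with s = z^m h(z). The
choice of β makes w s → -1/m, so F(w) = w + 1 + o(1) as the real part of w tends to infinity. -/
lemma exists_petal {g h : ℂ → ℂ} {m : ℕ} (hm : m ≠ 0) (hh : AnalyticAt ℂ h 0) (hc : h 0 ≠ 0)
    (hg : ∀ᶠ z in 𝓝 0, g z = z + z ^ (m + 1) * h z) {β : ℂ} (hβ : β ^ m = -1 / (m * h 0)) :
    ∃ R : ℝ, 0 < R ∧ ∃ F : ℂ → ℂ, DifferentiableOn ℂ F {w | R < w.re} ∧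
      (∀ w, R < w.re → ‖F w - w - 1‖ ≤ 1 / 10) ∧
      (∀ w, R < w.re → petal m β (F w) = g (petal m β w)) ∧
      ∀ w, R < w.re → ‖petal m β w‖ ≤ 3 := by
  have hm' : (m : ℂ) ≠ 0 := Nat.cast_ne_zero.mpr hm
  set c := h 0 with hcdef
  set X := petal m β with hX
  set s : ℂ → ℂ := fun w => X w ^ m * h (X w) with hs
  set F : ℂ → ℂ := fun w => w * Complex.exp (-(m * Complex.log (1 + s w))) with hF
  have hX0 : Tendsto X rightEnd (𝓝 0) := tendsto_petal hm β
  have hs0 : Tendsto s rightEnd (𝓝 0) := by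
    have := (hX0.pow m).mul (hh.continuousAt.tendsto.comp hX0)
    simpa [hm] using this
  have hre0 : ∀ᶠ w : ℂ in rightEnd, 0 < w.re := tendsto_comap.eventually_gt_atTop 0
  have hws : ∀ᶠ w in rightEnd, w * s w = -(h (X w) / (m * c)) := by
    filter_upwards [hre0] with w hw
    have hw0 : w ≠ 0 := fun h => by simp [h] at hw
    simp only [s]
    rw [petal_pow hm β hw0, hβ]
    field_simp
  have hwst : Tendsto (fun w => w * s w) rightEnd (𝓝 (-(1 / m))) := by
    have h1 : Tendsto (fun w => -(h (X w) / (m * c))) rightEnd (𝓝 (-(c / (m * c)))) :=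
      ((hh.continuousAt.tendsto.comp hX0).div_const _).neg
    rw [show c / (m * c) = 1 / (m : ℂ) by field_simp] at h1
    exact h1.congr' (hws.mono fun w hw => hw.symm)
  have hψ : HasDerivAt (fun s : ℂ => Complex.exp (-(m * Complex.log (1 + s)))) (-m) 0 := by
    have h1 : HasDerivAt (fun s : ℂ => 1 + s) 1 0 := (hasDerivAt_id 0).const_add 1
    have h2 := ((h1.clog (by simp)).const_mul (m : ℂ)).neg.cexp
    refine h2.congr_deriv ?_
    simp
  -- D is the divided difference of (1 + s)^(-m) at s = 0, so F(w) - w - 1 = D(s) w s - 1, which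
  -- tends to (-m)(-1/m) - 1 = 0.
  obtain ⟨D, hD⟩ : ∃ D : ℂ → ℂ, D = dslope (fun s : ℂ => Complex.exp (-(m * Complex.log (1 + s)))) 0 :=
    ⟨_, rfl⟩
  have hDc : Tendsto (fun w => D (s w)) rightEnd (𝓝 (-m)) := by
    have h1 : ContinuousAt D 0 := by rw [hD]; exact continuousAt_dslope_same.mpr hψ.differentiableAt
    have h2 : D 0 = -m := by rw [hD, dslope_same, hψ.deriv]
    rw [← h2]
    exact h1.tendsto.comp hs0
  have hFD : ∀ w, F w - w - 1 = D (s w) * (w * s w) - 1 := by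
    intro w
    have h1 := sub_smul_dslope (fun s : ℂ => Complex.exp (-(m * Complex.log (1 + s)))) 0 (s w)
    rw [← hD] at h1
    simp only [sub_zero, smul_eq_mul, add_zero, Complex.log_one, mul_zero, neg_zero,
      Complex.exp_zero] at h1
    simp only [hF]
    linear_combination -w * h1
  have hFt : Tendsto (fun w => F w - w - 1) rightEnd (𝓝 0) := by
    have h1 := (hDc.mul hwst).sub_const 1
    rw [show -(m : ℂ) * -(1 / m) - 1 = 0 by field_simp; ring] at h1
    exact h1.congr fun w => (hFD w).symm
  have hlog : Tendsto (fun w => (m : ℂ) * Complex.log (1 + s w)) rightEnd (𝓝 0) := by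
    have h1 : ContinuousAt (fun s : ℂ => (m : ℂ) * Complex.log (1 + s)) 0 := by
      refine ContinuousAt.mul continuousAt_const (ContinuousAt.clog (by fun_prop) (by simp))
    have h2 : Tendsto (fun s : ℂ => (m : ℂ) * Complex.log (1 + s)) (𝓝 0) (𝓝 0) := by
      simpa using h1.tendsto
    exact h2.comp hs0
  have hnice : ∀ᶠ z in 𝓝 (0 : ℂ), AnalyticAt ℂ h z ∧ g z = z + z ^ (m + 1) * h z :=
    hh.eventually_analyticAt.and hg
  have hslit : ∀ᶠ z in 𝓝 (0 : ℂ), 1 + z ∈ Complex.slitPlane := by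
    have : ContinuousAt (fun z : ℂ => 1 + z) 0 := by fun_prop
    exact this.eventually_mem (Complex.isOpen_slitPlane.mem_nhds (by simp))
  obtain ⟨R, hR⟩ := eventually_rightEnd.mp (hre0.and ((hX0.eventually hnice).and
    ((hs0.eventually hslit).and ((hFt.norm.eventually_lt_const
      (show ‖(0 : ℂ)‖ < 1 / 10 by norm_num)).and ((hlog.norm.eventually_lt_const
      (show ‖(0 : ℂ)‖ < 1 by norm_num)).and (hX0.norm.eventually_lt_const
      (show ‖(0 : ℂ)‖ < 3 by norm_num)))))))
  refine ⟨max R 1, by positivity, F, ?_, ?_, ?_, ?_⟩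
  · intro w hw
    obtain ⟨h1, h2, h3, -⟩ := hR w ((le_max_left _ _).trans_lt hw)
    refine DifferentiableAt.differentiableWithinAt ?_
    have hXd : DifferentiableAt ℂ X w := (hasDerivAt_petal m β h1).differentiableAt
    have hsd : DifferentiableAt ℂ s w :=
      (hXd.pow m).mul (h2.1.differentiableAt.comp w hXd)
    exact differentiableAt_id.mul (((hsd.const_add 1).clog h3).const_mul _).neg.cexp
  · intro w hw
    exact (hR w ((le_max_left _ _).trans_lt hw)).2.2.2.1.le
  · intro w hw
    obtain ⟨h1, h2, h3, h4, h5, h6⟩ := hR w ((le_max_left _ _).trans_lt hw)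
    have hw0 : w ≠ 0 := fun h => by simp [h] at h1
    set τ := Complex.log (1 + s w) with hτ
    have e1 : F w = Complex.exp (Complex.log w - m * τ) := by
      rw [sub_eq_add_neg, Complex.exp_add, Complex.exp_log hw0]
    have h7 := abs_lt.mp (abs_arg_lt h1)
    have h8 := abs_lt.mp ((Complex.abs_im_le_norm _).trans_lt h5)
    have hpi := Real.pi_gt_three
    -- No branch jump occurs: |arg w| < π/2 and the correction has modulus below 1, so the imaginary
    -- part stays within (-π, π).
    have e2 : Complex.log (F w) = Complex.log w - m * τ := by
      rw [e1, Complex.log_exp]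
      · rw [Complex.sub_im]; linarith [h7.1, h8.2]
      · rw [Complex.sub_im]; linarith [h7.2, h8.1]
    have e3 : X (F w) = X w * Complex.exp τ := by
      simp only [X, petal]
      rw [e2, mul_assoc, ← Complex.exp_add]
      congr 2
      field_simp
      ring
    rw [e3, h2.2, hτ, Complex.exp_log (Complex.slitPlane_ne_zero h3)]
    simp only [s]
    ring
  · intro w hw
    exact (hR w ((le_max_left _ _).trans_lt hw)).2.2.2.2.2.le

lemma tendsto_iterate_rightEnd {F : ℂ → ℂ} {R : ℝ}
    (hF : ∀ w, R < w.re → ‖F w - w - 1‖ ≤ 1 / 10) {w : ℂ} (hw : R < w.re) :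
    (∀ n : ℕ, R < (F^[n] w).re) ∧ Tendsto (fun n => F^[n] w) atTop rightEnd := by
  have h : ∀ n : ℕ, w.re + 9 / 10 * n ≤ (F^[n] w).re := by
    intro n
    induction n with
    | zero => simp
    | succ n ih =>
      have hn : (0 : ℝ) ≤ n := n.cast_nonneg
      rw [Function.iterate_succ_apply']
      have h1 := (Complex.abs_re_le_norm _).trans (hF (F^[n] w) (by linarith))
      rw [abs_le] at h1
      simp only [Complex.sub_re, Complex.one_re] at h1
      push_cast
      linarith
  refine ⟨fun n => ?_, tendsto_comap_iff.mpr ?_⟩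
  · have := h n
    have hn : (0 : ℝ) ≤ n := n.cast_nonneg
    linarith
  · refine tendsto_atTop_mono h ?_
    exact tendsto_atTop_add_const_left _ _
      (tendsto_natCast_atTop_atTop.const_mul_atTop (by norm_num))

lemma quad_zero (lam : ℂ) : quad lam 0 = 0 := by simp [quad]

lemma hasDerivAt_quad_iterate (lam : ℂ) (n : ℕ) : HasDerivAt ((quad lam)^[n]) (lam ^ n) 0 := by
  have h : HasDerivAt (quad lam) lam 0 := by
    have h1 : HasDerivAt (quad lam) (lam * 1 + 2 * 0 ^ (2 - 1) * 1) 0 :=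
      ((hasDerivAt_id' (0 : ℂ)).const_mul lam).add ((hasDerivAt_id' (0 : ℂ)).pow 2)
    simpa using h1
  exact h.iterate _ (quad_zero lam) n

/-- Two petals that meet the same orbit have directions that are related by a power of the
multiplier. -/
lemma petal_direction {lam : ℂ} {q m : ℕ} (hm : m ≠ 0) (hlam : lam ^ m = 1)
    {β β' : ℂ} (hβ : β ≠ 0) (hββ : β ^ m = β' ^ m) {R R' : ℝ} (hR : 0 < R) (hR' : 0 < R')
    {F F' : ℂ → ℂ}
    (hF : ∀ w, R < w.re → ‖F w - w - 1‖ ≤ 1 / 10) (hF' : ∀ w, R' < w.re → ‖F' w - w - 1‖ ≤ 1 / 10)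
    (hX : ∀ w, R < w.re → petal m β (F w) = (quad lam)^[q] (petal m β w))
    (hX' : ∀ w, R' < w.re → petal m β' (F' w) = (quad lam)^[q] (petal m β' w))
    {w w' : ℂ} (hw : R < w.re) (hw' : R' < w'.re) {D : ℕ}
    (h : petal m β' w' = (quad lam)^[D] (petal m β w)) : β' = lam ^ D * β := by
  have hm' : (m : ℂ) ≠ 0 := Nat.cast_ne_zero.mpr hm
  have hlam0 : lam ≠ 0 := by rintro rfl; simp [hm] at hlam
  obtain ⟨hn, ht⟩ := tendsto_iterate_rightEnd hF hw
  obtain ⟨hn', ht'⟩ := tendsto_iterate_rightEnd hF' hw'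
  have horb : ∀ n, petal m β' (F'^[n] w') = (quad lam)^[D] (petal m β (F^[n] w)) := by
    intro n
    induction n with
    | zero => exact h
    | succ n ih =>
      rw [Function.iterate_succ_apply', Function.iterate_succ_apply', hX' _ (hn' n), hX _ (hn n),
        ih, ← Function.iterate_add_apply, ← Function.iterate_add_apply, add_comm]
  set x := fun n => petal m β (F^[n] w) with hx
  have hx0 : Tendsto x atTop (𝓝 0) := (tendsto_petal hm β).comp ht
  have hxne : ∀ n, x n ≠ 0 := fun n => mul_ne_zero hβ (Complex.exp_ne_zero _)
  have hratio : Tendsto (fun n => petal m β' (F'^[n] w') / x n) atTop (𝓝 (lam ^ D)) := by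
    have h1 := (hasDerivAt_iff_tendsto_slope.mp (hasDerivAt_quad_iterate lam D)).comp
      (tendsto_nhdsWithin_iff.mpr ⟨hx0, Eventually.of_forall hxne⟩)
    refine h1.congr fun n => ?_
    simp only [Function.comp_apply, slope, vsub_eq_sub, sub_zero, smul_eq_mul,
      Function.iterate_fixed (quad_zero lam)]
    rw [horb n, div_eq_inv_mul]
  set κ := fun n => Complex.log (F^[n] w) - Complex.log (F'^[n] w') with hκ
  set ζ := β' / (lam ^ D * β) with hζ
  have hζm : ζ ^ m = 1 := by
    rw [hζ, div_pow, mul_pow, ← hββ, ← pow_mul, mul_comm D m, pow_mul, hlam, one_pow, one_mul,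
      div_self (pow_ne_zero m hβ)]
  -- The ratio of the two orbits is also β'/β times exp(κ/m), whence ζ exp(κ/m) → 1 with ζ^m = 1.
  -- The m-th power gives exp κ → 1. Both arguments lie in (-π/2, π/2), so κ itself tends to 0, and
  -- ζ = 1 follows.
  have hlim : Tendsto (fun n => ζ * Complex.exp (κ n / m)) atTop (𝓝 1) := by
    have h1 := hratio.div_const (lam ^ D)
    rw [div_self (pow_ne_zero D hlam0)] at h1
    refine h1.congr fun n => ?_
    simp only [x, petal, ζ, κ]
    rw [sub_div, sub_eq_neg_add, Complex.exp_add, Complex.exp_neg (Complex.log (F^[n] w) / m)]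
    field_simp
  have hexp : Tendsto (fun n => Complex.exp (κ n)) atTop (𝓝 1) := by
    have h1 := hlim.pow m
    rw [one_pow] at h1
    refine h1.congr fun n => ?_
    rw [mul_pow, hζm, one_mul, ← Complex.exp_nat_mul]
    congr 1
    field_simp
  have hκ0 : Tendsto κ atTop (𝓝 0) := by
    have h1 := hexp.clog (by simp)
    rw [Complex.log_one] at h1
    refine h1.congr fun n => ?_
    have h2 := abs_lt.mp (abs_arg_lt (hR.trans (hn n)))
    have h3 := abs_lt.mp (abs_arg_lt (hR'.trans (hn' n)))
    refine Complex.log_exp ?_ ?_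
    · simp only [κ, Complex.sub_im]; linarith [h2.1, h3.2]
    · simp only [κ, Complex.sub_im]; linarith [h2.2, h3.1]
  have hlim' : Tendsto (fun n => ζ * Complex.exp (κ n / m)) atTop (𝓝 ζ) := by
    have h1 : Tendsto (fun n => Complex.exp (κ n / m)) atTop (𝓝 (Complex.exp (0 / m))) :=
      (Complex.continuous_exp.tendsto _).comp (hκ0.div_const _)
    have := h1.const_mul ζ
    simpa using this
  have h1 := tendsto_nhds_unique hlim' hlim
  rwa [hζ, div_eq_one_iff_eq (mul_ne_zero (pow_ne_zero D hlam0) hβ)] at h1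

/-- The orbit of 4 strictly increases in modulus. Thus no iterate is the identity and a leading term
of the deviation exists. -/
lemma quad_iterate_ne {lam : ℂ} (hl : ‖lam‖ = 1) {q : ℕ} (hq : 0 < q) :
    (quad lam)^[q] 4 ≠ 4 := by
  have h : ∀ n : ℕ, 3 < ‖(quad lam)^[n] 4‖ ∧ (0 < n → 4 < ‖(quad lam)^[n] 4‖) := by
    intro n
    induction n with
    | zero => simp; norm_num
    | succ n ih =>
      rw [Function.iterate_succ_apply']
      have h1 := lt_norm_quad hl ih.1
      refine ⟨ih.1.trans h1, fun _ => ?_⟩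
      rcases Nat.eq_zero_or_pos n with rfl | hn
      · simpa using h1
      · exact (ih.2 hn).trans h1
  intro h0
  have := (h q).2 hq
  rw [h0] at this
  norm_num at this

/-- The leading term of the deviation of `g` from the identity, for `g` the `q`-th iterate. -/
lemma exists_leading_term {lam : ℂ} (hl : ‖lam‖ = 1) {q : ℕ} (hq : 0 < q) :
    ∃ (n : ℕ) (h : ℂ → ℂ), AnalyticAt ℂ h 0 ∧ h 0 ≠ 0 ∧
      ∀ᶠ z in 𝓝 0, (quad lam)^[q] z = z + z ^ n * h z := by
  have hd : Differentiable ℂ (fun z => (quad lam)^[q] z - z) :=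
    (differentiable_quad_iterate lam q).sub differentiable_id
  have hne : ¬ ∀ᶠ z in 𝓝 (0 : ℂ), (quad lam)^[q] z - z = 0 := by
    intro h0
    have h1 : AnalyticOnNhd ℂ (fun z => (quad lam)^[q] z - z) univ :=
      fun z _ => hd.analyticAt z
    have h2 := h1.eqOn_zero_of_preconnected_of_eventuallyEq_zero isPreconnected_univ (mem_univ 0) h0
    exact quad_iterate_ne hl hq (sub_eq_zero.mp (h2 (mem_univ 4)))
  obtain ⟨n, h, ha, h0, he⟩ := (hd.analyticAt 0).exists_eventuallyEq_pow_smul_nonzero_iff.mpr hne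
  refine ⟨n, h, ha, h0, he.mono fun z hz => ?_⟩
  rw [sub_zero, smul_eq_mul] at hz
  linear_combination hz

/-- The iterate commutes with the polynomial; comparing the coefficients of z^n in this identity
gives λ h(0) = λ^n h(0). -/
lemma leading_exponent {lam : ℂ} {q n : ℕ} (hn : 1 ≤ n) {h : ℂ → ℂ} (hh : AnalyticAt ℂ h 0)
    (h0 : h 0 ≠ 0) (hg : ∀ᶠ z in 𝓝 0, (quad lam)^[q] z = z + z ^ n * h z) : lam = lam ^ n := by
  have hq : Tendsto (quad lam) (𝓝 0) (𝓝 0) := by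
    have := (differentiable_quad_iterate lam 1).continuous.tendsto 0
    simpa [quad_zero] using this
  have hn' : n ≠ 0 := by omega
  have key : ∀ᶠ z in 𝓝[≠] (0 : ℂ),
      lam * h z + 2 * z * h z + z ^ n * h z ^ 2 = (lam + z) ^ n * h (quad lam z) := by
    filter_upwards [hg.filter_mono nhdsWithin_le_nhds,
      (hq.eventually hg).filter_mono nhdsWithin_le_nhds, self_mem_nhdsWithin] with z h1 h2 hz
    have h3 : (quad lam)^[q] (quad lam z) = quad lam ((quad lam)^[q] z) := by
      rw [← Function.iterate_succ_apply, Function.iterate_succ_apply']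
    rw [h2, h1] at h3
    have h4 : quad lam z ^ n = z ^ n * (lam + z) ^ n := by
      rw [← mul_pow]; congr 1; unfold quad; ring
    rw [h4] at h3
    refine mul_left_cancel₀ (pow_ne_zero n hz) ?_
    unfold quad at h3 ⊢
    linear_combination -h3
  have hc := hh.continuousAt.tendsto
  have hz : Tendsto (fun z : ℂ => z) (𝓝 0) (𝓝 0) := tendsto_id
  have hl : Tendsto (fun z => lam * h z + 2 * z * h z + z ^ n * h z ^ 2) (𝓝[≠] 0)
      (𝓝 (lam * h 0)) := by
    have := ((hc.const_mul lam).add ((hz.const_mul 2).mul hc)).add ((hz.pow n).mul (hc.pow 2))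
    simp only [mul_zero, zero_mul, add_zero, zero_pow hn'] at this
    exact this.mono_left nhdsWithin_le_nhds
  have hr : Tendsto (fun z => (lam + z) ^ n * h (quad lam z)) (𝓝[≠] 0) (𝓝 (lam ^ n * h 0)) := by
    have := ((hz.const_add lam).pow n).mul (hc.comp hq)
    rw [add_zero] at this
    exact this.mono_left nhdsWithin_le_nhds
  exact mul_right_cancel₀ h0 (tendsto_nhds_unique hl (hr.congr' (key.mono fun z hz => hz.symm)))

lemma le_of_isBigO_pow_mul {n k : ℕ} {h : ℂ → ℂ} (hh : ContinuousAt h 0) (h0 : h 0 ≠ 0)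
    (hO : (fun z => z ^ n * h z) =O[𝓝 0] fun z => z ^ k) : k ≤ n := by
  by_contra! hlt
  have h1 : (fun z : ℂ => z ^ n) =O[𝓝 0] fun z => z ^ k := by
    have h2 : (fun z => (h z)⁻¹) =O[𝓝 0] fun _ => (1 : ℂ) :=
      (hh.inv₀ h0).tendsto.isBigO_one ℂ
    refine (hO.mul h2).congr' ?_ (by simp)
    filter_upwards [hh.eventually_ne h0] with z hz
    field_simp
  have h2 : (fun z : ℂ => z ^ k) =o[𝓝 0] fun z => z ^ n := Asymptotics.isLittleO_pow_pow hlt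
  have h3 := h1.trans_isLittleO h2
  have h4 : ∃ᶠ z in 𝓝 (0 : ℂ), z ^ n ≠ 0 := by
    have : ∀ᶠ z in 𝓝[≠] (0 : ℂ), z ^ n ≠ 0 :=
      eventually_nhdsWithin_of_forall fun z hz => pow_ne_zero n hz
    exact this.frequently.filter_mono nhdsWithin_le_nhds
  exact Asymptotics.isLittleO_irrefl h4 h3

/-- The quadratic polynomial whose fixed point `0` has as multiplier a primitive `q`-th root of
unity has only one cycle of petals there. -/
theorem not_isBigO_quad_iterate {lam : ℂ} {q : ℕ} (hq : 0 < q) (hlam : IsPrimitiveRoot lam q) :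
    ¬ (fun z => (quad lam)^[q] z - z) =O[𝓝 0] fun z => z ^ (q + 2) := by
  intro hO
  have hl : ‖lam‖ = 1 := hlam.norm'_eq_one hq.ne'
  obtain ⟨n, h, hh, h0, hg⟩ := exists_leading_term hl hq
  have hqn : q + 2 ≤ n := by
    refine le_of_isBigO_pow_mul hh.continuousAt h0 (hO.congr' ?_ EventuallyEq.rfl)
    filter_upwards [hg] with z hz
    rw [hz]; ring
  obtain ⟨m, rfl⟩ : ∃ m, n = m + 1 := ⟨n - 1, by omega⟩
  have hm : m ≠ 0 := by omega
  have hlam0 : lam ≠ 0 := norm_pos_iff.mp (by rw [hl]; norm_num)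
  have hlm : lam ^ m = 1 := by
    have := leading_exponent (by omega) hh h0 hg
    rw [pow_succ] at this
    exact (mul_right_cancel₀ hlam0 (by rw [one_mul]; exact this)).symm
  have hm' : (m : ℂ) ≠ 0 := Nat.cast_ne_zero.mpr hm
  have hne : -1 / (m * h 0) ≠ 0 := div_ne_zero (by norm_num) (mul_ne_zero hm' h0)
  obtain ⟨β, hβ⟩ := IsAlgClosed.exists_pow_nat_eq (-1 / (m * h 0)) (Nat.pos_of_ne_zero hm)
  have hβ0 : β ≠ 0 := by
    rintro rfl
    rw [zero_pow hm] at hβ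
    exact hne hβ.symm
  -- The petals in the directions β and ωβ both meet the critical orbit, so ω or its inverse is a
  -- power of λ and ω^q = 1. As ω has order m ≥ q + 1, this is impossible.
  set ω := Complex.exp (2 * Real.pi * Complex.I / m) with hω
  have hωp : IsPrimitiveRoot ω m := Complex.isPrimitiveRoot_exp m hm
  have hω0 : ω ≠ 0 := Complex.exp_ne_zero _
  have hβ' : (ω * β) ^ m = -1 / (m * h 0) := by rw [mul_pow, hωp.pow_eq_one, one_mul, hβ]
  have free : ∀ γ : ℂ, γ ≠ 0 → γ ^ m = -1 / (m * h 0) → ∃ (R : ℝ) (F : ℂ → ℂ) (w : ℂ) (i : ℕ),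
      0 < R ∧ (∀ w, R < w.re → ‖F w - w - 1‖ ≤ 1 / 10) ∧
      (∀ w, R < w.re → petal m γ (F w) = (quad lam)^[q] (petal m γ w)) ∧
      R < w.re ∧ petal m γ w = (quad lam)^[i] (-lam ^ 2 / 4) := by
    intro γ hγ0 hγ
    obtain ⟨R, hR, F, hF, hF1, hconj, hX3⟩ := exists_petal hm hh h0 hg hγ
    obtain ⟨w, hw, i, hi⟩ := no_free_petal hl (X := petal m γ)
      (fun w hw => (hasDerivAt_petal m γ (hR.trans hw)).differentiableAt.differentiableWithinAt)
      (fun w hw => by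
        rw [(hasDerivAt_petal m γ (hR.trans hw)).deriv]
        have hw0 : w ≠ 0 := fun h => by
          rw [h, Complex.zero_re] at hw
          exact lt_asymm hR hw
        exact mul_ne_zero (mul_ne_zero hγ0 (Complex.exp_ne_zero _))
          (neg_ne_zero.mpr (div_ne_zero (inv_ne_zero hw0) hm'))) hX3 hF hF1 hconj
    exact ⟨R, F, w, i, hR, hF1, hconj, hw, hi⟩
  obtain ⟨R, F, w, i, hR, hF, hX, hw, hi⟩ := free β hβ0 hβ
  obtain ⟨R', F', w', j, hR', hF', hX', hw', hj⟩ := free (ω * β) (mul_ne_zero hω0 hβ0) hβ'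
  have hωq : ω ^ q = 1 := by
    rcases le_total i j with hij | hij
    · have h1 := petal_direction hm hlm hβ0 (hβ.trans hβ'.symm) hR hR' hF hF' hX hX' hw hw'
        (D := j - i) (by rw [hi, hj, ← Function.iterate_add_apply, Nat.sub_add_cancel hij])
      rw [mul_right_cancel₀ hβ0 h1, ← pow_mul, mul_comm, pow_mul, hlam.pow_eq_one, one_pow]
    · have h1 := petal_direction hm hlm (mul_ne_zero hω0 hβ0) (hβ'.trans hβ.symm) hR' hR hF' hF
        hX' hX hw' hw
        (D := i - j) (by rw [hi, hj, ← Function.iterate_add_apply, Nat.sub_add_cancel hij])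
      have h2 : lam ^ (i - j) * ω = 1 := mul_right_cancel₀ hβ0 (by linear_combination -h1)
      have h3 : (lam ^ (i - j) * ω) ^ q = 1 := by rw [h2, one_pow]
      rwa [mul_pow, ← pow_mul, mul_comm (i - j), pow_mul, hlam.pow_eq_one, one_pow, one_mul] at h3
  have h1 := Nat.le_of_dvd hq (hωp.dvd_of_pow_eq_one q hωq)
  omega

end Parabolic

end SemiParabolicHenon

/-! ### Nonvanishing of the resonant coefficient and the full normal form. -/

namespace SemiParabolicHenon

/-- A coordinate `X = ξ w` in which the first component of the family has the normal form. -/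
structure NormalForm (q : ℕ) (lam : ℂ) (r : ℝ) (F : ℂ × ℂ × ℂ × ℂ → ℂ × ℂ × ℂ × ℂ)
    (X w : ℂ × ℂ × ℂ × ℂ → ℂ) (C : ℂ × ℂ → ℂ) (E : ℂ × ℂ × ℂ × ℂ → ℂ) : Prop where
  analytic : AnalyticOnNhd ℂ X (cyl lam 0 r)
  analytic_unit : AnalyticOnNhd ℂ w (cyl lam 0 r)
  unit_ne : ∀ z ∈ cyl lam 0 r, w z ≠ 0
  eq_mul : ∀ᶠ z in 𝓝ˢ (cyl lam 0 r), X z = z.2.2.1 * w z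
  indep : ∀ᶠ z in 𝓝ˢ (cyl lam 0 r), z.1 = 0 → X z = X (zeroY z)
  analytic_coeff : AnalyticAt ℂ C (0, lam)
  analytic_error : AnalyticOnNhd ℂ E (cyl lam 0 r)
  form : ∀ᶠ z in 𝓝ˢ (cyl lam 0 r), X (F z) =
    z.2.1 * (X z + X z ^ (q + 1) + C (z.1, z.2.1) * X z ^ (2 * q + 1)) + X z ^ (2 * q + 2) * E z

variable {lam : ℂ} {r : ℝ} {F : ℂ × ℂ × ℂ × ℂ → ℂ × ℂ × ℂ × ℂ}

/-- Resonance λ^(i-1) = 1 means q ∣ i - 1, and in the given range only i - 1 = q and i - 1 = 2q are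
possible. -/
lemma sum_resonant {q : ℕ} (hq : 0 < q) (hlam : IsPrimitiveRoot lam q) {b : ℕ → ℂ}
    (hb : ∀ i, lam ^ (i - 1) ≠ 1 → b i = 0) :
    ∑ i ∈ Finset.Ico 2 (2 * q + 2), b i = b (q + 1) + b (2 * q + 1) := by
  rw [← Finset.sum_pair (show q + 1 ≠ 2 * q + 1 by omega)]
  symm
  refine Finset.sum_subset (fun i hi => ?_) fun i hi hi' => hb i fun h1 => hi' ?_
  · simp only [Finset.mem_insert, Finset.mem_singleton] at hi
    rw [Finset.mem_Ico]
    omega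
  · obtain ⟨k, hk⟩ := hlam.dvd_of_pow_eq_one _ h1
    rw [Finset.mem_Ico] at hi
    simp only [Finset.mem_insert, Finset.mem_singleton]
    have hk0 : k ≠ 0 := by rintro rfl; omega
    have hk2 : k ≤ 2 := by
      by_contra! h3
      have : q * 3 ≤ q * k := Nat.mul_le_mul_left q h3
      omega
    interval_cases k <;> omega

/-- A local coordinate does not shrink distances by more than a constant factor; this transfers an
estimate for x(g(z)) - x(z) to g(z) - z. -/
lemma isBigO_sub_of_hasStrictDerivAt {x : ℂ → ℂ} {x' : ℂ} (hx : HasStrictDerivAt x x' 0)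
    (hx' : x' ≠ 0) : (fun p : ℂ × ℂ => p.1 - p.2) =O[𝓝 (0, 0)] fun p => x p.1 - x p.2 := by
  have h1 := hx.isLittleO
  have h2 : (fun p : ℂ × ℂ => p.1 - p.2) =O[𝓝 (0, 0)] fun p => (p.1 - p.2) * x' := by
    refine Asymptotics.IsBigO.of_bound ‖x'‖⁻¹ (Eventually.of_forall fun p => ?_)
    rw [norm_mul, mul_comm ‖p.1 - p.2‖, ← mul_assoc, inv_mul_cancel₀ (norm_ne_zero_iff.mpr hx'),
      one_mul]
  have h3 := (h1.trans_isBigO h2).right_isBigO_add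
  refine h2.trans (h3.congr_right fun p => ?_)
  simp

lemma quad_iterate_isBigO (lam : ℂ) (n : ℕ) : (quad lam)^[n] =O[𝓝 0] fun z => z := by
  have := (hasDerivAt_quad_iterate lam n).differentiableAt.isBigO_sub
  simpa [Function.iterate_fixed (quad_zero lam)] using this

lemma tendsto_quad_iterate (lam : ℂ) (n : ℕ) : Tendsto ((quad lam)^[n]) (𝓝 0) (𝓝 0) := by
  have := (differentiable_quad_iterate lam n).continuous.tendsto 0
  rwa [Function.iterate_fixed (quad_zero lam)] at this

/-- A coordinate conjugating the quadratic polynomial to its linear part up to order `q + 2`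
contradicts the count of its petals. -/
lemma not_isBigO_linearization {q : ℕ} (hq : 0 < q) (hlam : IsPrimitiveRoot lam q) {x : ℂ → ℂ}
    {x' : ℂ} (hx : HasStrictDerivAt x x' 0) (hx' : x' ≠ 0) :
    ¬ (fun z => x (quad lam z) - lam * x z) =O[𝓝 0] fun z => z ^ (q + 2) := by
  intro hO
  have hn : ∀ n : ℕ, (fun z => x ((quad lam)^[n] z) - lam ^ n * x z) =O[𝓝 0]
      fun z => z ^ (q + 2) := by
    intro n
    induction n with
    | zero => simp [Asymptotics.isBigO_zero]
    | succ n ih =>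
      have h1 := (hO.comp_tendsto (tendsto_quad_iterate lam n)).trans
        ((quad_iterate_isBigO lam n).pow (q + 2))
      refine (h1.add (ih.const_mul_left lam)).congr_left fun z => ?_
      simp only [Function.comp_apply, Function.iterate_succ_apply', pow_succ]
      ring
  refine not_isBigO_quad_iterate hq hlam ?_
  have h1 := hn q
  simp only [hlam.pow_eq_one, one_mul] at h1
  have h2 : Tendsto (fun z => ((quad lam)^[q] z, z)) (𝓝 0) (𝓝 (0, 0)) :=
    (tendsto_quad_iterate lam q).prodMk_nhds tendsto_id
  exact ((isBigO_sub_of_hasStrictDerivAt hx hx').comp_tendsto h2).trans h1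

/-- On the slice a = 0, l = λ, Y = 0 the family is ξ ↦ λξ + ξ². If the coefficient vanished, X would
linearize this polynomial up to terms of order 2q + 1 ≥ q + 2, against the petal count. -/
lemma PartialNormalForm.coeff_ne (hF : StraightFamily lam r F) (hr : 0 ≤ r) {q : ℕ} (hq : 0 < q)
    (hlam : IsPrimitiveRoot lam q) {X w : ℂ × ℂ × ℂ × ℂ → ℂ} {c : ℕ → ℂ × ℂ → ℂ}
    (h : PartialNormalForm lam r F (2 * q + 2) X w c) : c (q + 1) (0, lam) ≠ 0 := by
  intro h0
  have hmem := zero_mem_cyl hr lam 0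
  set ι : ℂ → ℂ × ℂ × ℂ × ℂ := fun ξ => (0, lam, ξ, 0) with hι
  have hιc : Tendsto ι (𝓝 0) (𝓝ˢ (cyl lam 0 r)) := by
    have : ContinuousAt ι 0 := by fun_prop
    exact this.tendsto.mono_right (nhds_le_nhdsSet hmem)
  have hιa : AnalyticAt ℂ ι 0 := by fun_prop
  have hXa : AnalyticAt ℂ (fun ξ => X (ι ξ)) 0 :=
    AnalyticAt.fun_comp (g := X) (f := ι) (h.analytic _ hmem) hιa
  have hwa : AnalyticAt ℂ (fun ξ => w (ι ξ)) 0 :=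
    AnalyticAt.fun_comp (g := w) (f := ι) (h.analytic_unit _ hmem) hιa
  obtain ⟨e, he, heq⟩ := h.form
  have hea : AnalyticAt ℂ (fun ξ => e (ι ξ)) 0 :=
    AnalyticAt.fun_comp (g := e) (f := ι) (he _ hmem) hιa
  have hX : HasStrictDerivAt (fun ξ => X (ι ξ)) (w (ι 0)) 0 := by
    have h1 := hXa.hasStrictDerivAt
    have h2 : HasDerivAt (fun ξ => ξ * w (ι ξ)) (1 * w (ι 0) + 0 * _) 0 :=
      (hasDerivAt_id' (0 : ℂ)).fun_mul hwa.differentiableAt.hasDerivAt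
    have h3 : HasDerivAt (fun ξ => X (ι ξ)) (1 * w (ι 0) + 0 * _) 0 :=
      h2.congr_of_eventuallyEq (hιc.eventually h.eq_mul)
    rw [h3.deriv] at h1
    simpa using h1
  have hX1 : (fun ξ => X (ι ξ)) =O[𝓝 0] fun ξ => ξ := by
    have := hX.hasDerivAt.differentiableAt.isBigO_sub
    have h2 : X (ι 0) = 0 := by
      rw [h.eq_mul.self_of_nhdsSet _ hmem]; simp
    simpa [h2] using this
  refine not_isBigO_linearization hq hlam hX (h.unit_ne _ hmem) ?_
  have e1 : ∀ᶠ ξ in 𝓝 (0 : ℂ), c (2 * q + 1) (0, lam) * X (ι ξ) ^ (2 * q + 1) +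
      ξ ^ (2 * q + 2) * e (ι ξ) = X (ι (quad lam ξ)) - lam * X (ι ξ) := by
    filter_upwards [hιc.eventually heq, hιc.eventually hF.degenerate] with ξ h1 h2
    rw [h2 rfl, sum_resonant hq hlam (b := fun i => c i (0, lam) * X (ι ξ) ^ i)
      (fun i hi => by simp [h.resonant i hi]), h0] at h1
    simp only [ι, quad] at h1 ⊢
    linear_combination -h1
  have small : ∀ k, q + 2 ≤ k → (fun z : ℂ => z ^ k) =O[𝓝 0] fun z => z ^ (q + 2) := by
    intro k hk
    rcases hk.eq_or_lt with rfl | hk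
    · exact Asymptotics.isBigO_refl _ _
    · exact (Asymptotics.isLittleO_pow_pow hk).isBigO
  refine Asymptotics.IsBigO.congr' ?_ e1 EventuallyEq.rfl
  refine Asymptotics.IsBigO.add ?_ ?_
  · exact ((hX1.pow (2 * q + 1)).const_mul_left _).trans (small _ (by omega))
  · have h3 := (Asymptotics.isBigO_refl (fun ξ : ℂ => ξ ^ (2 * q + 2)) (𝓝 0)).mul
      (hea.continuousAt.tendsto.isBigO_one ℂ)
    simp only [mul_one] at h3
    exact h3.trans (small _ (by omega))

lemma exists_analytic_root {E : Type*} [NormedAddCommGroup E] [NormedSpace ℂ E] {g : E → ℂ} {p : E}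
    (hg : AnalyticAt ℂ g p) (h0 : g p ≠ 0) {q : ℕ} (hq : 0 < q) :
    ∃ s : E → ℂ, AnalyticAt ℂ s p ∧ s p ≠ 0 ∧ ∀ᶠ z in 𝓝 p, s z ^ q = g z := by
  obtain ⟨σ, hσ⟩ := IsAlgClosed.exists_pow_nat_eq (g p) hq
  have hq' : (q : ℂ) ≠ 0 := Nat.cast_ne_zero.mpr hq.ne'
  have hσ0 : σ ≠ 0 := by rintro rfl; rw [zero_pow hq.ne'] at hσ; exact h0 hσ.symm
  refine ⟨fun z => σ * Complex.exp (Complex.log (g z / g p) / q), ?_,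
    mul_ne_zero hσ0 (Complex.exp_ne_zero _), ?_⟩
  · have h1 : AnalyticAt ℂ (fun z => Complex.log (g z / g p)) p :=
      (hg.div analyticAt_const h0).clog (by simp [div_self h0])
    exact analyticAt_const.mul (h1.div analyticAt_const hq').cexp
  · filter_upwards [hg.continuousAt.eventually_ne h0] with z hz
    rw [mul_pow, ← Complex.exp_nat_mul, mul_div_cancel₀ _ hq', Complex.exp_log (div_ne_zero hz h0),
      hσ]
    field_simp

lemma eventually_coeff {p : ℂ × ℂ → Prop} (hp : ∀ᶠ s in 𝓝 ((0 : ℂ), lam), p s) :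
    ∀ᶠ z in 𝓝ˢ (cyl lam 0 r), p (z.1, z.2.1) := by
  rw [eventually_nhdsSet_iff_forall]
  intro z hz
  obtain ⟨h1, h2, -, -⟩ := mem_cyl.mp hz
  have hc : ContinuousAt (fun z : ℂ × ℂ × ℂ × ℂ => (z.1, z.2.1)) z := by fun_prop
  refine hc.eventually ?_
  rwa [show (fun z : ℂ × ℂ × ℂ × ℂ => (z.1, z.2.1)) z = (0, lam) from Prod.ext h1 h2]

/-- Replacing X by sX divides the coefficient of order q + 1 by s^q, so s is a q-th root of
c_{q+1}/l, analytic near (0, λ) because c_{q+1} does not vanish there. The last coefficient becomes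
c_{2q+1}/(l s^(2q)) after the factor l is taken out. -/
theorem exists_normalForm (hF : StraightFamily lam r F) (hr : 0 ≤ r) {q : ℕ} (hq : 0 < q)
    (hlam : IsPrimitiveRoot lam q) : ∃ X w C E, NormalForm q lam r F X w C E := by
  have hl : lam ≠ 0 := hlam.ne_zero hq.ne'
  obtain ⟨X, w, c, h⟩ := exists_partialNormalForm hF hl hr (j := 2 * q + 2) (by omega)
  have hc0 := h.coeff_ne hF hr hq hlam
  have hsnd : AnalyticAt ℂ (fun p : ℂ × ℂ => p.2) (0, lam) := by fun_prop
  obtain ⟨s, hs, hs0, hsq⟩ := exists_analytic_root (g := fun p : ℂ × ℂ => c (q + 1) p / p.2)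
    ((h.analytic_coeff (q + 1)).div hsnd hl) (div_ne_zero hc0 hl) hq
  obtain ⟨e, he, heq⟩ := h.form
  have hsK : ∀ z ∈ cyl lam 0 r, s (z.1, z.2.1) ≠ 0 := fun z hz => by
    rw [(mem_cyl.mp hz).1, (mem_cyl.mp hz).2.1]; exact hs0
  have hsa : AnalyticOnNhd ℂ (fun z : ℂ × ℂ × ℂ × ℂ => s (z.1, z.2.1)) (cyl lam 0 r) :=
    analyticOnNhd_coeff hs
  refine ⟨fun z => s (z.1, z.2.1) * X z, fun z => s (z.1, z.2.1) * w z,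
    fun p => c (2 * q + 1) p / (p.2 * s p ^ (2 * q)),
    fun z => s (z.1, z.2.1) * e z / (s (z.1, z.2.1) * w z) ^ (2 * q + 2),
    hsa.mul h.analytic, hsa.mul h.analytic_unit,
    fun z hz => mul_ne_zero (hsK z hz) (h.unit_ne z hz), ?_, ?_, ?_, ?_, ?_⟩
  · filter_upwards [h.eq_mul] with z hz
    rw [hz]; ring
  · filter_upwards [h.indep] with z hz h0
    rw [hz h0]; rfl
  · exact (h.analytic_coeff _).div (hsnd.mul (hs.pow _)) (mul_ne_zero hl (pow_ne_zero _ hs0))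
  · exact (hsa.mul he).div ((hsa.mul h.analytic_unit).pow _)
      fun z hz => pow_ne_zero _ (mul_ne_zero (hsK z hz) (h.unit_ne z hz))
  · have hne : ∀ᶠ z in 𝓝ˢ (cyl lam 0 r), w z ≠ 0 := eventually_nhdsSet_iff_forall.mpr
      fun z hz => (h.analytic_unit z hz).continuousAt.eventually_ne (h.unit_ne z hz)
    filter_upwards [heq, hF.fst, h.eq_mul, hne, eventually_ne_zero_cyl hl 0 r,
      eventually_coeff hsq, eventually_coeff (hs.continuousAt.eventually_ne hs0)]
      with z h1 h2 h3 h4 h5 h6 h7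
    rw [h2.1, h2.2]
    rw [sum_resonant hq hlam (b := fun i => c i (z.1, z.2.1) * X z ^ i)
      (fun i hi => by simp [h.resonant i hi])] at h1
    set S := s (z.1, z.2.1)
    have hcq : c (q + 1) (z.1, z.2.1) = z.2.1 * S ^ q := by rw [h6]; field_simp
    have e1 : (S * X z) ^ (2 * q + 2) * (S * e z / (S * w z) ^ (2 * q + 2)) =
        S * (z.2.2.1 ^ (2 * q + 2) * e z) := by
      rw [h3]
      have : (S * w z) ^ (2 * q + 2) ≠ 0 := pow_ne_zero _ (mul_ne_zero h7 h4)
      rw [show S * (z.2.2.1 * w z) = z.2.2.1 * (S * w z) by ring, mul_pow]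
      field_simp
    have e2 : z.2.1 * (c (2 * q + 1) (z.1, z.2.1) / (z.2.1 * S ^ (2 * q)) *
        (S * X z) ^ (2 * q + 1)) = S * (c (2 * q + 1) (z.1, z.2.1) * X z ^ (2 * q + 1)) := by
      rw [mul_pow, pow_succ S]
      field_simp
    rw [e1, mul_add, mul_add, e2, ← h1, hcq, mul_pow]
    ring

end SemiParabolicHenon

/-! ### Sierpiński's theorem and paths in the strong stable manifold. -/

namespace SemiParabolicHenon

/-- A line cannot be split into countably many disjoint closed sets (Sierpiński). -/
lemma eq_univ_of_iUnion_isClosed {A : ℕ → Set ℝ} (hA : ∀ n, IsClosed (A n))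
    (hd : Pairwise (Function.onFun Disjoint A)) (hU : ⋃ n, A n = univ) {n : ℕ}
    (hn : (A n).Nonempty) : A n = univ := by
  have hcov : ∀ x, ∃ k, x ∈ A k := fun x => mem_iUnion.mp (hU ▸ mem_univ x)
  have huniq : ∀ {x j k}, x ∈ A j → x ∈ A k → j = k := fun {x j k} hj hk => by
    by_contra hjk
    exact disjoint_left.mp (hd hjk) hj hk
  -- P consists of the points interior to no piece. By Baire, if P is nonempty, some piece A k
  -- contains P within an interval about a point of P. Any other piece is relatively clopen in that
  -- interval, hence would fill it; so A k fills it, and the chosen point is interior after all.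
  set P : Set ℝ := (⋃ k, interior (A k))ᶜ with hP
  have hPc : IsClosed P := (isOpen_iUnion fun k => isOpen_interior).isClosed_compl
  have hint : ∀ {x k}, x ∉ P → x ∈ A k → x ∈ interior (A k) := by
    intro x k hx hk
    obtain ⟨j, hj⟩ := mem_iUnion.mp (not_not.mp hx)
    rwa [huniq hk (interior_subset hj)]
  have hPe : P = ∅ := by
    by_contra hne
    obtain ⟨x₀, hx₀⟩ := nonempty_iff_ne_empty.mpr hne
    have : Nonempty P := ⟨⟨x₀, hx₀⟩⟩
    have : CompleteSpace P := hPc.completeSpace_coe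
    obtain ⟨k, y, hy⟩ := nonempty_interior_of_iUnion_of_closed
      (f := fun k => ((↑) : P → ℝ) ⁻¹' A k) (fun k => (hA k).preimage continuous_subtype_val)
      (by rw [← preimage_iUnion, hU, preimage_univ])
    rw [mem_interior_iff_mem_nhds, nhds_subtype_eq_comap] at hy
    obtain ⟨V, hV, hVA⟩ := mem_comap.mp hy
    obtain ⟨ε, hε, hball⟩ := Metric.mem_nhds_iff.mp hV
    have hyk : ∀ x ∈ ball (y : ℝ) ε, x ∈ P → x ∈ A k := fun x hx hxP =>
      @hVA ⟨x, hxP⟩ (hball hx)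
    have hsub : ball (y : ℝ) ε ⊆ A k := by
      intro x hx
      obtain ⟨m, hm⟩ := hcov x
      by_cases hmk : m = k
      · rwa [← hmk]
      exfalso
      have hcl : ∀ z ∈ ball (y : ℝ) ε, z ∈ A m → z ∈ interior (A m) := fun z hz hzm =>
        hint (fun hzP => hmk (huniq hzm (hyk z hz hzP))) hzm
      have h1 : ball (y : ℝ) ε ⊆ interior (A m) := by
        refine (convex_ball (y : ℝ) ε).isPreconnected.subset_left_of_subset_union isOpen_interior
          (hA m).isOpen_compl (disjoint_left.mpr fun z hz hz' => hz' (interior_subset hz)) ?_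
          ⟨x, hx, hcl x hx hm⟩
        intro z hz
        by_cases hzm : z ∈ A m
        · exact Or.inl (hcl z hz hzm)
        · exact Or.inr hzm
      exact hmk (huniq (interior_subset (h1 (mem_ball_self hε)))
        (hyk y (mem_ball_self hε) y.2))
    exact y.2 (mem_iUnion.mpr ⟨k, mem_interior.mpr
      ⟨_, hsub, isOpen_ball, mem_ball_self hε⟩⟩)
  have hop : IsOpen (A n) := by
    rw [← subset_interior_iff_isOpen]
    exact fun x hx => hint (by simp [hPe]) hx
  exact IsClopen.eq_univ ⟨hA n, hop⟩ hn

/-- A path in a set whose points are eventually mapped to an invariant disk stays in this disk. -/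
lemma pathComponentIn_subset_disk {α : Type*} [TopologicalSpace α] [T2Space α] {H : α → α}
    (hH : Continuous H) (hinj : Function.Injective H) {ψ : ℂ → α} {ν : ℂ} {R R' : ℝ}
    (hR' : 0 ≤ R') (hRR : R' < R) (hν0 : ν ≠ 0) (hν : ‖ν‖ ≤ 1) {B W : Set α} (hB : IsClosed B)
    (hψ : ContinuousOn ψ (closedBall 0 R)) (hψi : InjOn ψ (closedBall 0 R))
    (hconj : ∀ Y ∈ closedBall (0 : ℂ) R, H (ψ Y) = ψ (ν * Y))
    (hψB : ∀ Y ∈ closedBall (0 : ℂ) R, ψ Y ∈ B → Y ∈ closedBall (0 : ℂ) R')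
    (hνB : ∀ Y ∈ closedBall (0 : ℂ) R, ψ (ν * Y) ∈ B)
    (hW : ∀ z ∈ W, ∀ n : ℕ, H^[n] z ∈ B)
    (hWS : ∀ z ∈ W, ∃ n : ℕ, H^[n] z ∈ ψ '' closedBall 0 R) :
    pathComponentIn W (ψ 0) ⊆ ψ '' closedBall 0 R := by
  have hνpos : 0 < ‖ν‖ := norm_pos_iff.mpr hν0
  have hRpos : 0 < R := hR'.trans_lt hRR
  have hνm : ∀ Y ∈ closedBall (0 : ℂ) R, ν * Y ∈ closedBall (0 : ℂ) R := by
    intro Y hY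
    rw [mem_closedBall_zero_iff] at hY ⊢
    rw [norm_mul]
    exact (mul_le_of_le_one_left (norm_nonneg _) hν).trans hY
  set S : Set α := ψ '' closedBall 0 R ∩ B with hS
  have hcpt : IsCompact (ψ '' closedBall 0 R) := (isCompact_closedBall 0 R).image_of_continuousOn hψ
  have hSc : IsClosed S := hcpt.isClosed.inter hB
  have hSinv : ∀ z ∈ S, H z ∈ S := by
    rintro _ ⟨⟨Y, hY, rfl⟩, -⟩
    rw [hconj Y hY]
    exact ⟨mem_image_of_mem _ (hνm Y hY), hνB Y hY⟩
  have hSinv' : ∀ n : ℕ, ∀ z ∈ S, H^[n] z ∈ S := by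
    intro n
    induction n with
    | zero => exact fun z hz => hz
    | succ n ih => exact fun z hz => ih _ (hSinv z hz)
  -- T collects the points outside S that enter S at the next step. Such a point must land in the
  -- annulus |Y| ≥ |ν|R, for otherwise Y/ν lies in the disk and injectivity puts the point in S.
  -- Points of S have |Y| ≤ R' < R and land strictly inside the annulus. Describing T through the
  -- closed annulus makes it closed, although "not in S" is an open condition.
  set A : Set ℂ := closedBall 0 R ∩ {Y | ‖ν‖ * R ≤ ‖Y‖} with hA
  set T : Set α := B ∩ H ⁻¹' (ψ '' A ∩ B) with hT
  have hAc : IsCompact A :=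
    (isCompact_closedBall 0 R).inter_right (isClosed_le continuous_const continuous_norm)
  have hTc : IsClosed T := hB.inter
    (((hAc.image_of_continuousOn (hψ.mono inter_subset_left)).isClosed.inter hB).preimage hH)
  have hTS : ∀ z ∈ T, z ∉ S := by
    rintro z ⟨hzB, ⟨Y', ⟨hY', hY'2⟩, hzY⟩, -⟩ ⟨⟨Y, hY, rfl⟩, -⟩
    rw [hconj Y hY] at hzY
    have h1 := hψi hY' (hνm Y hY) hzY
    have h2 := hψB Y hY hzB
    rw [mem_closedBall_zero_iff] at h2
    rw [mem_ofPred_eq, h1, norm_mul] at hY'2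
    have := mul_lt_mul_of_pos_left hRR hνpos
    nlinarith
  have hTof : ∀ z ∈ B, H z ∈ S → z ∉ S → z ∈ T := by
    rintro z hz ⟨⟨Y', hY', hzY⟩, hHz⟩ hzS
    refine ⟨hz, ⟨⟨Y', ⟨hY', ?_⟩, hzY⟩, hHz⟩⟩
    rw [mem_ofPred_eq]
    by_contra! hlt
    have hm : Y' / ν ∈ closedBall (0 : ℂ) R := by
      rw [mem_closedBall_zero_iff, norm_div, div_le_iff₀ hνpos]
      linarith
    refine hzS ⟨⟨Y' / ν, hm, hinj ?_⟩, hz⟩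
    rw [hconj _ hm, mul_div_cancel₀ _ hν0, hzY]
  have hTH : ∀ z ∈ T, H z ∈ S := fun z hz =>
    ⟨image_mono inter_subset_left hz.2.1, hz.2.2⟩
  -- V 0 is S and V (k + 1) is the set of points entering S exactly at time k + 1. These closed sets
  -- are disjoint and cover W.
  set V : ℕ → Set α := fun n => Nat.casesOn n S fun k => H^[k] ⁻¹' T with hV
  have hVc : ∀ n, IsClosed (V n) := by
    rintro (_ | k)
    · exact hSc
    · exact hTc.preimage (hH.iterate k)
  have hlater : ∀ j k, j < k → ∀ z, z ∈ V j → z ∉ V k := by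
    intro j k hjk z hj hk
    obtain ⟨k, rfl⟩ : ∃ k', k = k' + 1 := ⟨k - 1, by omega⟩
    refine hTS _ hk ?_
    rcases j with _ | j
    · exact hSinv' k z hj
    · have h1 := hSinv' (k - (j + 1)) _ (hTH _ hj)
      rwa [← Function.iterate_succ_apply' H, ← Function.iterate_add_apply,
        show k - (j + 1) + j.succ = k by omega] at h1
  have hcover : ∀ z ∈ W, ∃ n, z ∈ V n := by
    intro z hz
    have hex : ∃ n : ℕ, H^[n] z ∈ S := by
      obtain ⟨n, hn⟩ := hWS z hz
      exact ⟨n, hn, hW z hz n⟩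
    classical
    set n := Nat.find hex with hn
    have h1 : H^[n] z ∈ S := Nat.find_spec hex
    rcases hn0 : n with _ | k
    · rw [hn0] at h1
      exact ⟨0, h1⟩
    · refine ⟨k + 1, hTof _ (hW z hz k) ?_ (Nat.find_min hex (by omega))⟩
      rwa [hn0, Function.iterate_succ_apply'] at h1
  rintro z ⟨γ, hγ⟩
  have hγc : Continuous γ.extend := γ.continuous_extend
  have hγW : ∀ t, γ.extend t ∈ W := by
    intro t
    exact hγ _
  have h0 : ψ 0 ∈ S := by
    have h0 : (0 : ℂ) ∈ closedBall (0 : ℂ) R := mem_closedBall_self hRpos.le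
    refine ⟨mem_image_of_mem _ h0, ?_⟩
    have := hνB 0 h0
    rwa [mul_zero] at this
  have huniv := eq_univ_of_iUnion_isClosed (A := fun n => γ.extend ⁻¹' V n)
    (fun n => (hVc n).preimage hγc)
    (fun j k hjk => disjoint_left.mpr fun t hj hk => by
      rcases lt_or_gt_of_ne hjk with h | h
      · exact hlater j k h _ hj hk
      · exact hlater k j h _ hk hj)
    (eq_univ_of_forall fun t => mem_iUnion.mpr (hcover _ (hγW t)))
    (n := 0) ⟨0, by simpa [hV] using h0⟩
  have h1 : (1 : ℝ) ∈ γ.extend ⁻¹' V 0 := huniv ▸ mem_univ _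
  rw [mem_preimage, Path.extend_one] at h1
  exact h1.1

end SemiParabolicHenon

/-! ### Uniform polydisks, escape to infinity, and decay rates. -/

namespace SemiParabolicHenon

/-- Compactness turns a germ statement into one with a uniform ε, including a margin beyond |y| = r.
-/
lemma exists_polydisk {lam x₀ : ℂ} {r : ℝ} (hr : 0 ≤ r) {p : ℂ × ℂ × ℂ × ℂ → Prop}
    (hp : ∀ᶠ z in 𝓝ˢ (cyl lam x₀ r), p z) :
    ∃ ε > 0, ∀ a l x y : ℂ, ‖a‖ < ε → ‖l - lam‖ < ε → ‖x - x₀‖ < ε → ‖y‖ < r + ε →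
      p (a, l, x, y) := by
  obtain ⟨U, hUo, hKU, hU⟩ := mem_nhdsSet_iff_exists.mp hp
  obtain ⟨ε, hε, hεU⟩ := (isCompact_cyl lam x₀ r).exists_thickening_subset_open hUo hKU
  refine ⟨ε, hε, fun a l x y ha hl hx hy => hU (hεU ?_)⟩
  have h1 : y ∈ thickening ε (closedBall (0 : ℂ) r) := by
    rw [thickening_closedBall hε hr, mem_ball_zero_iff]
    linarith
  obtain ⟨y', hy', hyy⟩ := mem_thickening_iff.mp h1
  refine mem_thickening_iff.mpr ⟨(0, lam, x₀, y'),
    mem_cyl.mpr ⟨rfl, rfl, rfl, mem_closedBall_zero_iff.mp hy'⟩, ?_⟩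
  simp only [Prod.dist_eq, max_lt_iff]
  refine ⟨by simpa using ha, ?_, ?_, hyy⟩
  · rwa [dist_eq_norm]
  · rwa [dist_eq_norm]

lemma eventually_eventually_nhdsSet {α : Type*} [TopologicalSpace α] {K : Set α} {p : α → Prop}
    (hp : ∀ᶠ z in 𝓝ˢ K, p z) : ∀ᶠ z in 𝓝ˢ K, ∀ᶠ w in 𝓝 z, p w :=
  eventually_nhdsSet_iff_forall.mpr fun z hz =>
    (eventually_nhdsSet_iff_forall.mp hp z hz).eventually_nhds

lemma norm_henon_fst {c a : ℂ} (hc : ‖c‖ ≤ 1) (ha : ‖a‖ ≤ 1 / 2) {z : ℂ × ℂ} (h1 : 3 ≤ ‖z.1‖)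
    (h2 : ‖z.2‖ ≤ ‖z.1‖) : ‖z.1‖ + 1 ≤ ‖(henon c a z).1‖ ∧
      ‖(henon c a z).2‖ ≤ ‖(henon c a z).1‖ := by
  have h3 : ‖z.1‖ ^ 2 - ‖c‖ - ‖a‖ * ‖z.2‖ ≤ ‖(henon c a z).1‖ := by
    have e : z.1 ^ 2 = (henon c a z).1 - c - a * z.2 := by simp only [henon]; ring
    rw [← norm_pow, e, ← norm_mul]
    have := norm_sub_le ((henon c a z).1 - c) (a * z.2)
    have := norm_sub_le (henon c a z).1 c
    linarith
  have h4 : ‖a‖ * ‖z.2‖ ≤ 1 / 2 * ‖z.1‖ := by gcongr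
  have h5 : ‖z.1‖ + 1 ≤ ‖(henon c a z).1‖ := by nlinarith
  refine ⟨h5, ?_⟩
  have : ‖(henon c a z).2‖ = ‖a‖ * ‖z.1‖ := by simp [henon]
  rw [this]
  nlinarith [norm_nonneg z.1]

/-- The second coordinate cannot leave the disk first, because |a| ≤ 1/2. Once |x| > r > 3 with |y|
≤ |x|, the modulus of x grows by at least 1 in every step, contradicting boundedness. -/
lemma henon_iterate_mem {c a : ℂ} (hc : ‖c‖ ≤ 1) (ha : ‖a‖ ≤ 1 / 2) {r M : ℝ} (hr : 3 < r)
    {z : ℂ × ℂ} (hz : z ∈ closedBall (0 : ℂ) r ×ˢ closedBall (0 : ℂ) r)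
    (hM : ∀ n : ℕ, ‖((henon c a)^[n] z).1‖ ≤ M) (n : ℕ) :
    (henon c a)^[n] z ∈ closedBall (0 : ℂ) r ×ˢ closedBall (0 : ℂ) r := by
  induction n with
  | zero => exact hz
  | succ n ih =>
    rw [Function.iterate_succ_apply']
    set w := (henon c a)^[n] z with hw
    obtain ⟨h1, h2⟩ := ih
    rw [mem_closedBall_zero_iff] at h1 h2
    have hy : ‖(henon c a w).2‖ ≤ r := by
      have : ‖(henon c a w).2‖ = ‖a‖ * ‖w.1‖ := by simp [henon]
      rw [this]
      nlinarith [norm_nonneg w.1]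
    refine ⟨mem_closedBall_zero_iff.mpr ?_, mem_closedBall_zero_iff.mpr hy⟩
    by_contra! hlt
    have hesc : ∀ k : ℕ, r + k ≤ ‖((henon c a)^[k] (henon c a w)).1‖ ∧
        ‖((henon c a)^[k] (henon c a w)).2‖ ≤ ‖((henon c a)^[k] (henon c a w)).1‖ := by
      intro k
      induction k with
      | zero => exact ⟨by simpa using hlt.le, hy.trans hlt.le⟩
      | succ k ih =>
        rw [Function.iterate_succ_apply']
        have hk : (0 : ℝ) ≤ k := k.cast_nonneg
        obtain ⟨h3, h4⟩ := norm_henon_fst hc ha (by linarith [ih.1]) ih.2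
        refine ⟨?_, h4⟩
        push_cast
        linarith [ih.1]
    obtain ⟨k, hk⟩ := exists_nat_gt (M - r)
    have h3 := hM (k + 1 + n)
    rw [Function.iterate_add_apply, Function.iterate_succ_apply] at h3
    linarith [(hesc k).1]

/-- A sequence losing at most a factor 2 per step cannot be O(4^(-n)) unless it starts at 0. -/
lemma eq_zero_of_half_le {g : ℕ → ℝ} {C ν : ℝ} (hν0 : 0 ≤ ν) (hν : ν ≤ 1 / 4) (hg0 : 0 ≤ g 0)
    (hg : ∀ n, g n / 2 ≤ g (n + 1)) (hC : ∀ n, g n ≤ C * ν ^ n) : g 0 = 0 := by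
  have h1 : ∀ n : ℕ, g 0 ≤ 2 ^ n * g n := by
    intro n
    induction n with
    | zero => simp
    | succ n ih =>
      have := hg n
      have h2 : (0 : ℝ) < 2 ^ n := by positivity
      rw [pow_succ]
      nlinarith
  have h2 : ∀ n : ℕ, g 0 ≤ |C| * (1 / 2) ^ n := by
    intro n
    refine (h1 n).trans ?_
    calc 2 ^ n * g n ≤ 2 ^ n * (|C| * (1 / 4) ^ n) := by
          refine mul_le_mul_of_nonneg_left ((hC n).trans ?_) (by positivity)
          exact mul_le_mul (le_abs_self C) (pow_le_pow_left₀ hν0 hν n) (by positivity)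
            (abs_nonneg C)
      _ = |C| * (1 / 2) ^ n := by
          rw [mul_left_comm, ← mul_pow]; norm_num
  have h3 : Tendsto (fun n : ℕ => |C| * (1 / 2 : ℝ) ^ n) atTop (𝓝 (|C| * 0)) :=
    (tendsto_pow_atTop_nhds_zero_of_lt_one (by norm_num) (by norm_num)).const_mul _
  rw [mul_zero] at h3
  exact le_antisymm (ge_of_tendsto' h3 h2) hg0

lemma injective_henon {c a : ℂ} (ha : a ≠ 0) : Function.Injective (henon c a) := by
  rintro ⟨x, y⟩ ⟨x', y'⟩ h
  simp only [henon, Prod.mk.injEq] at h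
  obtain ⟨h1, h2⟩ := h
  have hx := mul_left_cancel₀ ha h2
  subst hx
  have hy : a * y = a * y' := by linear_combination h1
  rw [mul_left_cancel₀ ha hy]

lemma continuous_henon (c a : ℂ) : Continuous (henon c a) := by
  unfold henon; fun_prop

/-- The points of the strong stable manifold approach the fixed point exponentially. -/
lemma exists_dist_le {l a : ℂ} (ha : a ≠ 0) (hl : l ≠ 0) {z : ℂ × ℂ} (hz : z ∈ strongStable l a) :
    ∃ M : ℝ, ∀ n : ℕ, dist ((henonOn l a)^[n] z) (fixedPt l a) ≤ M * ‖nu l a‖ ^ n := by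
  rw [strongStable, if_neg ha] at hz
  obtain ⟨L, hL⟩ := hz
  obtain ⟨M, hM⟩ := hL.bddAbove_range
  have hν : 0 < ‖nu l a‖ := norm_pos_iff.mpr (div_ne_zero (neg_ne_zero.mpr (pow_ne_zero 2 ha)) hl)
  refine ⟨M, fun n => ?_⟩
  have h1 := hM (mem_range_self n)
  simp only [inv_pow] at h1
  rwa [inv_mul_le_iff₀ (by positivity), mul_comm] at h1

end SemiParabolicHenon

/-! ### The local strong stable manifold lies in the tube. -/

namespace SemiParabolicHenon

/-- The coordinates of `exists_straightening`. -/
structure Straightening (lam : ℂ) (r : ℝ) (Ψ Φ F : ℂ × ℂ × ℂ × ℂ → ℂ × ℂ × ℂ × ℂ) : Prop where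
  analytic_param : AnalyticOnNhd ℂ Ψ (cyl lam 0 r)
  analytic_chart : AnalyticOnNhd ℂ Φ (cyl lam (lam / 2) r)
  family : StraightFamily lam r F
  fst : ∀ z, (Ψ z).1 = z.1 ∧ (Ψ z).2.1 = z.2.1
  chart_param : ∀ᶠ z in 𝓝ˢ (cyl lam 0 r), Φ (Ψ z) = z
  param_chart : ∀ᶠ z in 𝓝ˢ (cyl lam (lam / 2) r), Ψ (Φ z) = z
  semiconj_chart : ∀ᶠ z in 𝓝ˢ (cyl lam (lam / 2) r), F (Φ z) = Φ (henonFam z)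
  semiconj_param : ∀ᶠ z in 𝓝ˢ (cyl lam 0 r), Ψ (F z) = henonFam (Ψ z)
  degenerate : ∀ᶠ z in 𝓝ˢ (cyl lam 0 r), z.1 = 0 →
    Ψ z = (0, z.2.1, z.2.1 / 2 + z.2.2.1, z.2.2.2)
  fixedPt : ∀ a l, Ψ (a, l, 0, 0) = (a, l, fixedPt l a)

lemma exists_straightening_family {lam : ℂ} (hlam : ‖lam‖ = 1) {r : ℝ} (hr : 0 ≤ r) :
    ∃ Ψ Φ F, Straightening lam r Ψ Φ F := by
  obtain ⟨Ψ, Φ, F, h1, h2, h3, h4, h5, h6, h7, h8, h9, h10, h11, h12, h13⟩ :=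
    exists_straightening hlam hr
  refine ⟨Ψ, Φ, F, h1, h2, ⟨h3, ?_, h11, h12, h13⟩, h4, h5, h6, h7, h8, h9, h10⟩
  filter_upwards [h8] with z hz
  have := h4 (F z)
  rw [hz] at this
  exact ⟨this.1.symm.trans (h4 z).1, this.2.symm.trans (h4 z).2⟩

variable {lam : ℂ} {r : ℝ} {Ψ Φ F : ℂ × ℂ × ℂ × ℂ → ℂ × ℂ × ℂ × ℂ}

namespace Straightening

lemma param_apply (h : Straightening lam r Ψ Φ F) {z : ℂ × ℂ × ℂ × ℂ} (hz : z ∈ cyl lam 0 r) :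
    Ψ z = (0, lam, lam / 2, z.2.2.2) := by
  obtain ⟨h1, h2, h3, -⟩ := mem_cyl.mp hz
  rw [h.degenerate.self_of_nhdsSet z hz h1, h2, h3, add_zero]

lemma chart_apply (h : Straightening lam r Ψ Φ F) {z : ℂ × ℂ × ℂ × ℂ}
    (hz : z ∈ cyl lam (lam / 2) r) : Φ z = (0, lam, 0, z.2.2.2) := by
  obtain ⟨h1, h2, h3, h4⟩ := mem_cyl.mp hz
  have hm : (0, lam, 0, z.2.2.2) ∈ cyl lam 0 r := mem_cyl.mpr ⟨rfl, rfl, rfl, h4⟩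
  have e : z = Ψ (0, lam, 0, z.2.2.2) := by
    rw [h.param_apply hm]
    exact Prod.ext h1 (Prod.ext h2 (Prod.ext h3 rfl))
  conv_lhs => rw [e]
  exact h.chart_param.self_of_nhdsSet _ hm

lemma mapsTo_chart (h : Straightening lam r Ψ Φ F) :
    MapsTo Φ (cyl lam (lam / 2) r) (cyl lam 0 r) := by
  intro z hz
  rw [h.chart_apply hz]
  exact mem_cyl.mpr ⟨rfl, rfl, rfl, (mem_cyl.mp hz).2.2.2⟩

lemma tendsto_chart (h : Straightening lam r Ψ Φ F) :
    Tendsto Φ (𝓝ˢ (cyl lam (lam / 2) r)) (𝓝ˢ (cyl lam 0 r)) :=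
  tendsto_nhdsSet_of_mapsTo (fun z hz => (h.analytic_chart z hz).continuousAt) h.mapsTo_chart

end Straightening

lemma tendsto_fixedPt (hl : lam ≠ 0) (hr : 0 ≤ r) :
    Tendsto (fun p : ℂ × ℂ => (p.1, p.2, fixedPt p.2 p.1)) (𝓝 (0, lam))
      (𝓝ˢ (cyl lam (lam / 2) r)) := by
  have h : ContinuousAt (fun p : ℂ × ℂ => (p.1, p.2, fixedPt p.2 p.1)) (0, lam) := by
    have h2 : ContinuousAt (fun p : ℂ × ℂ => p.1 ^ 2 / (2 * p.2)) (0, lam) :=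
      ContinuousAt.div (by fun_prop) (by fun_prop) (by simpa using hl)
    unfold fixedPt
    fun_prop
  refine h.tendsto.mono_right (nhds_le_nhdsSet (mem_cyl.mpr ?_))
  simp [fixedPt, hr]

/-- The orbits in the strong stable manifold end up in the local strong stable disk. -/
lemma eventually_chart_eq_zero (hs : Straightening lam r Ψ Φ F) (hr : 0 ≤ r) {q : ℕ} (hq : 0 < q)
    (hlam : ‖lam‖ = 1) {X w C E} (hX : NormalForm q lam r F X w C E) :
    ∀ᶠ p in 𝓝 ((0 : ℂ), lam), p.1 ≠ 0 → ∀ z ∈ strongStable p.2 p.1,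
      ∃ (n : ℕ) (Y : ℂ), ‖Y‖ < 1 ∧
        Ψ (p.1, p.2, 0, Y) = (p.1, p.2, (henonOn p.2 p.1)^[n] z) := by
  have hl0 : lam ≠ 0 := norm_pos_iff.mp (by rw [hlam]; norm_num)
  -- in the coordinates the transverse coordinate does not decrease by more than one half
  have hgrow : ∀ᶠ z in 𝓝ˢ (cyl lam 0 r), ‖X z‖ / 2 ≤ ‖X (F z)‖ := by
    have hX0 : ∀ z ∈ cyl lam 0 r, X z = 0 := fun z hz => by
      rw [hX.eq_mul.self_of_nhdsSet z hz, (mem_cyl.mp hz).2.2.1, zero_mul]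
    have hb : ∀ᶠ z in 𝓝ˢ (cyl lam 0 r), 1 / 2 < ‖z.2.1 * (1 + X z ^ q +
        C (z.1, z.2.1) * X z ^ (2 * q)) + X z ^ (2 * q + 1) * E z‖ := by
      rw [eventually_nhdsSet_iff_forall]
      intro z hz
      have hc : ContinuousAt (fun z : ℂ × ℂ × ℂ × ℂ => ‖z.2.1 * (1 + X z ^ q +
          C (z.1, z.2.1) * X z ^ (2 * q)) + X z ^ (2 * q + 1) * E z‖) z := by
        have h1 := (hX.analytic z hz).continuousAt
        have h2 := (analyticOnNhd_coeff (r := r) hX.analytic_coeff z hz).continuousAt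
        have h3 := (hX.analytic_error z hz).continuousAt
        have h4 : ContinuousAt (fun z : ℂ × ℂ × ℂ × ℂ => z.2.1) z := by fun_prop
        exact ((h4.mul ((continuousAt_const.add (h1.pow q)).add (h2.mul (h1.pow (2 * q))))).add
          ((h1.pow (2 * q + 1)).mul h3)).norm
      refine hc.eventually_const_lt ?_
      simp only [hX0 z hz, (mem_cyl.mp hz).2.1, zero_pow hq.ne', zero_pow (by omega : 2 * q ≠ 0),
        zero_pow (by omega : 2 * q + 1 ≠ 0),
        add_zero, mul_zero, zero_mul, mul_one, hlam]
      norm_num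
    filter_upwards [hX.form, hb] with z h1 h2
    have e : X (F z) = X z * (z.2.1 * (1 + X z ^ q + C (z.1, z.2.1) * X z ^ (2 * q)) +
        X z ^ (2 * q + 1) * E z) := by
      rw [h1]; ring
    rw [e, norm_mul]
    nlinarith [norm_nonneg (X z)]
  have hw : ∀ᶠ z in 𝓝ˢ (cyl lam 0 r), w z ≠ 0 := eventually_nhdsSet_iff_forall.mpr
    fun z hz => (hX.analytic_unit z hz).continuousAt.eventually_ne (hX.unit_ne z hz)
  have hXΦ : AnalyticOnNhd ℂ (fun z => X (Φ z)) (cyl lam (lam / 2) r) := fun z hz =>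
    AnalyticAt.fun_comp (hX.analytic _ (hs.mapsTo_chart hz)) (hs.analytic_chart z hz)
  have han : ∀ᶠ z in 𝓝ˢ (cyl lam (lam / 2) r), AnalyticAt ℂ (fun z => X (Φ z)) z ∧
      AnalyticAt ℂ Φ z := eventually_nhdsSet_iff_forall.mpr fun z hz =>
    (hXΦ z hz).eventually_analyticAt.and (hs.analytic_chart z hz).eventually_analyticAt
  have hν : ∀ᶠ p in 𝓝 ((0 : ℂ), lam), ‖nu p.2 p.1‖ < 1 / 4 := by
    have h1 : ContinuousAt (fun p : ℂ × ℂ => ‖nu p.2 p.1‖) (0, lam) :=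
      (analyticAt_nu (by fun_prop) (by fun_prop) hl0).continuousAt.norm
    exact h1.eventually_lt_const (by simp [nu_zero])
  have h0c : Tendsto (fun p : ℂ × ℂ => (p.1, p.2, (0 : ℂ), (0 : ℂ))) (𝓝 (0, lam))
      (𝓝ˢ (cyl lam 0 r)) := by
    have : ContinuousAt (fun p : ℂ × ℂ => (p.1, p.2, (0 : ℂ), (0 : ℂ))) (0, lam) := by fun_prop
    exact this.tendsto.mono_right (nhds_le_nhdsSet (zero_mem_cyl hr lam 0))
  have hl : ∀ᶠ p in 𝓝 ((0 : ℂ), lam), p.2 ≠ 0 :=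
    continuousAt_snd.eventually_ne hl0
  filter_upwards [(tendsto_fixedPt hl0 hr).eventually (eventually_eventually_nhdsSet
    (hs.param_chart.and (hs.semiconj_chart.and ((hs.tendsto_chart.eventually hgrow).and
    ((hs.tendsto_chart.eventually hX.eq_mul).and (hs.tendsto_chart.eventually hw)))))),
    (tendsto_fixedPt hl0 hr).eventually han, hν, h0c.eventually hs.chart_param, hl,
    h0c.eventually hX.eq_mul]
    with p hQ hp hνp hΦ0 hlp hX0 ha z hz
  rw [hs.fixedPt] at hΦ0
  set P := (p.1, p.2, fixedPt p.2 p.1) with hP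
  set o := fun n : ℕ => (p.1, p.2, (henonOn p.2 p.1)^[n] z) with ho
  have hoS : ∀ n, henonFam (o n) = o (n + 1) := fun n => by
    simp only [henonFam, o, Function.iterate_succ_apply']
  obtain ⟨M, hM⟩ := exists_dist_le ha hlp hz
  have hod : ∀ n, dist (o n) P = dist ((henonOn p.2 p.1)^[n] z) (fixedPt p.2 p.1) := fun n => by
    simp [o, P, Prod.dist_eq]
  have hoP : Tendsto o atTop (𝓝 P) := by
    rw [tendsto_iff_dist_tendsto_zero]
    have h1 : Tendsto (fun n => M * ‖nu p.2 p.1‖ ^ n) atTop (𝓝 (M * 0)) :=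
      (tendsto_pow_atTop_nhds_zero_of_lt_one (norm_nonneg _) (by linarith)).const_mul M
    rw [mul_zero] at h1
    exact squeeze_zero (fun n => dist_nonneg) (fun n => (hod n).trans_le (hM n)) h1
  obtain ⟨c, hc⟩ := hp.1.differentiableAt.isBigO_sub.bound
  have hXP : X (Φ P) = 0 := by rw [hΦ0, hX0, zero_mul]
  have hY : ∀ᶠ w in 𝓝 P, ‖(Φ w).2.2.2‖ < 1 := by
    have h1 : ContinuousAt (fun w => ‖(Φ w).2.2.2‖) P := by
      have := hp.2.continuousAt
      fun_prop
    refine h1.eventually_lt_const ?_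
    simp [hΦ0]
  obtain ⟨n₀, hn₀⟩ := eventually_atTop.mp (hoP.eventually ((hQ.and hc).and hY))
  -- From time n₀ on, the orbit is in the chart. There |X| is at least halved in size from one step
  -- to the next in the lower bound, yet it is O(|ν|^n) because X vanishes at the fixed point; hence
  -- X, and with it ξ, is 0.
  have hzero := eq_zero_of_half_le (g := fun k => ‖X (Φ (o (n₀ + k)))‖)
    (C := |c| * M * ‖nu p.2 p.1‖ ^ n₀) (norm_nonneg _) hνp.le (norm_nonneg _)
    (fun k => by
      obtain ⟨⟨⟨-, h2, h3, -⟩, -⟩, -⟩ := hn₀ (n₀ + k) (by omega)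
      rwa [h2, hoS] at h3)
    (fun k => by
      obtain ⟨⟨-, h1⟩, -⟩ := hn₀ (n₀ + k) (by omega)
      rw [hXP, sub_zero, ← dist_eq_norm, hod] at h1
      refine h1.trans ((mul_le_mul (le_abs_self c) (hM _) dist_nonneg (abs_nonneg c)).trans_eq ?_)
      rw [pow_add]; ring)
  obtain ⟨⟨⟨h1, -, -, h4, h5⟩, -⟩, h6⟩ := hn₀ n₀ le_rfl
  rw [add_zero, norm_eq_zero, h4] at hzero
  have hξ := (mul_eq_zero.mp hzero).resolve_right h5
  refine ⟨n₀, (Φ (o n₀)).2.2.2, h6, ?_⟩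
  have h7 := hs.fst (Φ (o n₀))
  rw [h1] at h7
  have e : Φ (o n₀) = (p.1, p.2, 0, (Φ (o n₀)).2.2.2) :=
    Prod.ext h7.1.symm (Prod.ext h7.2.symm (Prod.ext hξ rfl))
  rw [← e, h1]

/-- The local strong stable manifold is contained in every tube. -/
theorem eventually_localStrongStable_subset {s : ℝ} (hs : Straightening lam s Ψ Φ F) {q : ℕ}
    (hq : 0 < q) (hlam : ‖lam‖ = 1) {X w C E} (hX : NormalForm q lam s F X w C E) (hr : 3 < r)
    (hrs : r < s) {ρ : ℝ} (hρ : 0 < ρ) :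
    ∀ᶠ p in 𝓝 ((0 : ℂ), lam),
      localStrongStable p.2 p.1 r ⊆ ball (p.2 / 2) ρ ×ˢ closedBall (0 : ℂ) r := by
  have hl0 : lam ≠ 0 := norm_pos_iff.mp (by rw [hlam]; norm_num)
  have hs0 : 0 ≤ s := by linarith
  have hclose : ∀ᶠ z in 𝓝ˢ (cyl lam 0 s), ‖(Ψ z).2.2.1 - z.2.1 / 2‖ < min ρ 1 ∧
      ‖(Ψ z).2.2.2 - z.2.2.2‖ < min ((s - r) / 2) 1 := by
    rw [eventually_nhdsSet_iff_forall]
    intro z hz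
    have hc := (hs.analytic_param z hz).continuousAt
    have h1 : ContinuousAt (fun z => ‖(Ψ z).2.2.1 - z.2.1 / 2‖) z := by fun_prop
    have h2 : ContinuousAt (fun z => ‖(Ψ z).2.2.2 - z.2.2.2‖) z := by fun_prop
    refine (h1.eventually_lt_const ?_).and (h2.eventually_lt_const ?_)
    · simp [hs.param_apply hz, (mem_cyl.mp hz).2.1, hρ]
    · simp [hs.param_apply hz, hrs]
  have han : ∀ᶠ z in 𝓝ˢ (cyl lam 0 s), ContinuousAt Ψ z := eventually_nhdsSet_iff_forall.mpr
    fun z hz => (hs.analytic_param z hz).eventually_analyticAt.mono fun w hw => hw.continuousAt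
  obtain ⟨ε, hε, hpoly⟩ := exists_polydisk hs0 (hs.chart_param.and (hs.semiconj_param.and
    (hs.family.line.and (hclose.and han))))
  have hball : ∀ᶠ p in 𝓝 ((0 : ℂ), lam), ‖p.1‖ < ε ∧ ‖p.2 - lam‖ < ε := by
    have h1 : ContinuousAt (fun p : ℂ × ℂ => ‖p.1‖) (0, lam) := by fun_prop
    have h2 : ContinuousAt (fun p : ℂ × ℂ => ‖p.2 - lam‖) (0, lam) := by fun_prop
    exact (h1.eventually_lt_const (by simpa using hε)).and
      (h2.eventually_lt_const (by simpa using hε))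
  have hpar : ∀ᶠ p in 𝓝 ((0 : ℂ), lam), ‖p.1‖ < 1 / 2 ∧ ‖cParam p.2 p.1‖ < 1 ∧
      ‖nu p.2 p.1‖ * s < 1 ∧ ‖nu p.2 p.1‖ < 1 ∧ ‖p.2‖ < 2 ∧ p.2 ≠ 0 := by
    have h1 : ContinuousAt (fun p : ℂ × ℂ => ‖p.1‖) (0, lam) := by fun_prop
    have h2 : ContinuousAt (fun p : ℂ × ℂ => ‖cParam p.2 p.1‖) (0, lam) := by
      have h2 : ContinuousAt (fun p : ℂ × ℂ => p.1 ^ 2 / (2 * p.2)) (0, lam) :=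
        ContinuousAt.div (by fun_prop) (by fun_prop) (by simpa using hl0)
      unfold cParam
      fun_prop
    have h3 : ContinuousAt (fun p : ℂ × ℂ => ‖nu p.2 p.1‖) (0, lam) :=
      (analyticAt_nu (by fun_prop) (by fun_prop) hl0).continuousAt.norm
    have h4 : ContinuousAt (fun p : ℂ × ℂ => ‖p.2‖) (0, lam) := by fun_prop
    refine (h1.eventually_lt_const (by simp)).and ((h2.eventually_lt_const ?_).and
      (((h3.mul_const s).eventually_lt_const (by simp [nu_zero])).and
      ((h3.eventually_lt_const (by simp [nu_zero])).and
      ((h4.eventually_lt_const (by simp [hlam])).and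
      (continuousAt_snd.eventually_ne hl0)))))
    have : ‖lam / 2 - (lam / 2) ^ 2‖ ≤ ‖lam / 2‖ + ‖(lam / 2) ^ 2‖ := norm_sub_le _ _
    have h5 : ‖lam / 2‖ = 1 / 2 := by rw [norm_div, hlam]; norm_num
    rw [norm_pow, h5] at this
    simp only [cParam]
    refine lt_of_eq_of_lt ?_ (this.trans_lt (by norm_num))
    congr 1
    ring
  filter_upwards [hball, hpar, eventually_chart_eq_zero hs hs0 hq hlam hX] with p hp hpar hexit
  obtain ⟨ha2, hc1, hνs, hν1, hl2, hl⟩ := hpar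
  set B := closedBall (0 : ℂ) r ×ˢ closedBall (0 : ℂ) r with hB
  by_cases ha : p.1 = 0
  · intro z hz
    have h1 := pathComponentIn_subset hz
    rw [strongStable, if_pos ha] at h1
    refine ⟨?_, h1.2.2⟩
    have h2 : z.1 = p.2 / 2 := by rw [show z.1 = _ from h1.1]; simp [fixedPt, ha]
    rw [h2]
    exact mem_ball_self hρ
  have hY : ∀ Y ∈ closedBall (0 : ℂ) s, Φ (Ψ (p.1, p.2, 0, Y)) = (p.1, p.2, 0, Y) ∧
      Ψ (F (p.1, p.2, 0, Y)) = henonFam (Ψ (p.1, p.2, 0, Y)) ∧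
      F (p.1, p.2, 0, Y) = (p.1, p.2, 0, nu p.2 p.1 * Y) ∧
      (‖(Ψ (p.1, p.2, 0, Y)).2.2.1 - p.2 / 2‖ < min ρ 1 ∧
      ‖(Ψ (p.1, p.2, 0, Y)).2.2.2 - Y‖ < min ((s - r) / 2) 1) ∧
      ContinuousAt Ψ (p.1, p.2, 0, Y) := by
    intro Y hY
    rw [mem_closedBall_zero_iff] at hY
    obtain ⟨h1, h2, h3, h4, h5⟩ := hpoly p.1 p.2 0 Y hp.1 hp.2 (by simpa using hε) (by linarith)
    exact ⟨h1, h2, h3 rfl, h4, h5⟩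
  set ψ : ℂ → ℂ × ℂ := fun Y => (Ψ (p.1, p.2, 0, Y)).2.2 with hψ
  have hΨψ : ∀ Y, Ψ (p.1, p.2, 0, Y) = (p.1, p.2, ψ Y) := fun Y =>
    Prod.ext (hs.fst _).1 (Prod.ext (hs.fst _).2 rfl)
  have hψ0 : ψ 0 = fixedPt p.2 p.1 := by simp only [ψ]; rw [hs.fixedPt]
  have hνm : ∀ Y ∈ closedBall (0 : ℂ) s, ‖nu p.2 p.1 * Y‖ ≤ 1 := by
    intro Y hY
    rw [mem_closedBall_zero_iff] at hY
    rw [norm_mul]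
    exact (mul_le_mul_of_nonneg_left hY (norm_nonneg _)).trans hνs.le
  have hν0 : nu p.2 p.1 ≠ 0 := div_ne_zero (neg_ne_zero.mpr (pow_ne_zero 2 ha)) hl
  -- The disk has radius s > r. A point of it with |y| ≤ r has |Y| ≤ r + (s - r)/2 = (r + s)/2,
  -- which leaves the collar R' < R that the argument needs.
  have key := pathComponentIn_subset_disk (H := henonOn p.2 p.1) (ψ := ψ) (ν := nu p.2 p.1)
    (R := s) (R' := (r + s) / 2) (B := B) (W := strongStable p.2 p.1 ∩ B)
    (continuous_henon _ _) (injective_henon ha) (by linarith) (by linarith) hν0 hν1.le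
    (isClosed_closedBall.prod isClosed_closedBall) ?_ ?_ ?_ ?_ ?_ ?_ ?_
  · rw [hψ0] at key
    intro z hz
    have hzB := (pathComponentIn_subset hz).2
    obtain ⟨Y, hYs, rfl⟩ := key hz
    refine ⟨?_, hzB.2⟩
    rw [mem_ball, dist_eq_norm]
    exact (hY Y hYs).2.2.2.1.1.trans_le (min_le_left _ _)
  · intro Y hYs
    have h1 := (hY Y hYs).2.2.2.2
    have h2 : ContinuousAt (fun Y : ℂ => (p.1, p.2, (0 : ℂ), Y)) Y := by fun_prop
    have h3 : ContinuousAt (fun Y : ℂ => Ψ (p.1, p.2, 0, Y)) Y :=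
      h1.comp (f := fun Y : ℂ => (p.1, p.2, (0 : ℂ), Y)) h2
    exact (ContinuousAt.snd (ContinuousAt.snd h3)).continuousWithinAt
  · intro Y hYs Y' hYs' he
    have h1 : Ψ (p.1, p.2, 0, Y) = Ψ (p.1, p.2, 0, Y') := by rw [hΨψ, hΨψ, he]
    have h2 := congrArg Φ h1
    rw [(hY Y hYs).1, (hY Y' hYs').1] at h2
    exact congrArg (fun z : ℂ × ℂ × ℂ × ℂ => z.2.2.2) h2
  · intro Y hYs
    obtain ⟨-, h2, h3, -⟩ := hY Y hYs
    rw [h3, hΨψ, hΨψ] at h2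
    exact (congrArg (fun z : ℂ × ℂ × ℂ × ℂ => z.2.2) h2).symm
  · intro Y hYs hYB
    have h1 := (hY Y hYs).2.2.2.1.2.trans_le (min_le_left _ _)
    have h2 := mem_closedBall_zero_iff.mp hYB.2
    rw [mem_closedBall_zero_iff]
    have h3 := norm_sub_le (ψ Y).2 ((ψ Y).2 - Y)
    rw [sub_sub_cancel] at h3
    simp only [ψ] at h2 h3
    linarith
  -- Here |νY| ≤ 1, and the closeness bound 1 puts ψ(νY) in the bidisk of radius 2 < r.
  · intro Y hYs
    have hm : nu p.2 p.1 * Y ∈ closedBall (0 : ℂ) s :=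
      mem_closedBall_zero_iff.mpr ((hνm Y hYs).trans (by linarith))
    obtain ⟨-, -, -, ⟨h1, h2⟩, -⟩ := hY _ hm
    have h1 := h1.trans_le (min_le_right _ _)
    have h2 := h2.trans_le (min_le_right _ _)
    have h3 := norm_add_le ((Ψ (p.1, p.2, 0, nu p.2 p.1 * Y)).2.2.1 - p.2 / 2) (p.2 / 2)
    have h4 := norm_add_le ((Ψ (p.1, p.2, 0, nu p.2 p.1 * Y)).2.2.2 - nu p.2 p.1 * Y)
      (nu p.2 p.1 * Y)
    rw [sub_add_cancel] at h3 h4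
    have h5 : ‖p.2 / 2‖ ≤ 1 := by rw [norm_div]; norm_num; linarith
    have h6 := hνm Y hYs
    exact ⟨mem_closedBall_zero_iff.mpr (by simp only [ψ]; linarith),
      mem_closedBall_zero_iff.mpr (by simp only [ψ]; linarith)⟩
  -- Orbits in the strong stable manifold are bounded, so the escape estimate keeps them in the
  -- bidisk.
  · rintro z ⟨hzW, hzB⟩ n
    obtain ⟨M, hM⟩ := exists_dist_le ha hl hzW
    refine henon_iterate_mem hc1.le ha2.le hr hzB (M := |M| + ‖(fixedPt p.2 p.1).1‖) (fun n => ?_) n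
    have h1 : ‖((henonOn p.2 p.1)^[n] z).1 - (fixedPt p.2 p.1).1‖ ≤ |M| := by
      have h2 : ‖((henonOn p.2 p.1)^[n] z).1 - (fixedPt p.2 p.1).1‖ ≤
          dist ((henonOn p.2 p.1)^[n] z) (fixedPt p.2 p.1) := by
        rw [Prod.dist_eq, ← dist_eq_norm]; exact le_max_left _ _
      refine h2.trans ((hM n).trans ?_)
      calc M * ‖nu p.2 p.1‖ ^ n ≤ |M| * 1 :=
            mul_le_mul (le_abs_self M) (pow_le_one₀ (norm_nonneg _) hν1.le) (by positivity)
              (abs_nonneg M)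
        _ = |M| := mul_one _
    have h3 := norm_add_le (((henonOn p.2 p.1)^[n] z).1 - (fixedPt p.2 p.1).1) (fixedPt p.2 p.1).1
    rw [sub_add_cancel] at h3
    exact h3.trans (by linarith)
  · rintro z ⟨hzW, -⟩
    obtain ⟨n, Y, hY1, hYe⟩ := hexit ha z hzW
    refine ⟨n, Y, mem_closedBall_zero_iff.mpr (by linarith), ?_⟩
    simp only [ψ, hYe]

end SemiParabolicHenon

/-! ### The composite charts and the conjugated family. -/

namespace SemiParabolicHenon

/-- Functions vanishing for `a = 0` are `O(a)`, uniformly. -/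
lemma exists_norm_le_mul {lam x₀ : ℂ} {r : ℝ} {f : ℂ × ℂ × ℂ × ℂ → ℂ}
    (hf : AnalyticOnNhd ℂ f (cyl lam x₀ r))
    (h0 : ∀ᶠ z in 𝓝ˢ (cyl lam x₀ r), z.1 = 0 → f z = 0) :
    ∃ M : ℝ, 0 ≤ M ∧ ∀ᶠ z in 𝓝ˢ (cyl lam x₀ r), ‖f z‖ ≤ M * ‖z.1‖ := by
  obtain ⟨g, hg, hfg⟩ := exists_eq_mul lineAnalytic_four
    (L := ContinuousLinearMap.fst ℂ ℂ (ℂ × ℂ × ℂ)) (e := (1, 0, 0, 0)) (by simp) hf h0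
  obtain ⟨M, hM⟩ := (isBigO_one_of_analyticOnNhd (isCompact_cyl lam x₀ r) hg).bound
  refine ⟨max M 0, le_max_right _ _, ?_⟩
  filter_upwards [hfg, hM] with z h1 h2
  rw [h1, norm_mul, mul_comm]
  rw [norm_one, mul_one] at h2
  exact mul_le_mul_of_nonneg_right (h2.trans (le_max_left _ _)) (norm_nonneg _)

/-- A family of coordinate changes `Λ` defined for all parameters near `(0, lam)`, with inverse
`Λ'`, in which the Hénon family becomes `G` and has the normal form. -/
structure AdaptedChart (q : ℕ) (lam : ℂ) (r : ℝ) (Λ Λ' G : ℂ × ℂ × ℂ × ℂ → ℂ × ℂ × ℂ × ℂ)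
    (C : ℂ × ℂ → ℂ) (E h : ℂ × ℂ × ℂ × ℂ → ℂ) : Prop where
  analytic_chart : AnalyticOnNhd ℂ Λ (cyl lam (lam / 2) r)
  analytic_inverse : AnalyticOnNhd ℂ Λ' (cyl lam 0 r)
  analytic_map : AnalyticOnNhd ℂ G (cyl lam 0 r)
  analytic_error : AnalyticOnNhd ℂ E (cyl lam 0 r)
  analytic_second : AnalyticOnNhd ℂ h (cyl lam 0 r)
  apply : ∀ z ∈ cyl lam (lam / 2) r, Λ z = (0, lam, 0, z.2.2.2)
  fst : ∀ᶠ z in 𝓝ˢ (cyl lam (lam / 2) r), (Λ z).1 = z.1 ∧ (Λ z).2.1 = z.2.1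
  left_inv : ∀ᶠ z in 𝓝ˢ (cyl lam (lam / 2) r), Λ' (Λ z) = z
  semiconj : ∀ᶠ z in 𝓝ˢ (cyl lam (lam / 2) r), Λ (henonFam z) = G (Λ z)
  fixedPt : ∀ᶠ p in 𝓝 ((0 : ℂ), lam), Λ (p.1, p.2, fixedPt p.2 p.1) = (p.1, p.2, 0, 0)
  first : ∀ᶠ z in 𝓝ˢ (cyl lam 0 r), (G z).2.2.1 = z.2.1 * (z.2.2.1 + z.2.2.1 ^ (q + 1) +
    C (z.1, z.2.1) * z.2.2.1 ^ (2 * q + 1)) + z.2.2.1 ^ (2 * q + 2) * E z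
  second : ∀ᶠ z in 𝓝ˢ (cyl lam 0 r), (G z).2.2.2 = nu z.2.1 z.1 * z.2.2.2 + z.2.2.1 * h z
  second_degenerate : ∀ᶠ z in 𝓝ˢ (cyl lam 0 r), z.1 = 0 → z.2.2.1 * h z = 0
  degenerate : ∀ᶠ z in 𝓝ˢ (cyl lam (lam / 2) r), z.1 = 0 →
    Λ z = (0, z.2.1, (Λ (0, z.2.1, z.2.2.1, 0)).2.2.1, z.2.2.2)

variable {lam : ℂ} {r : ℝ} {Ψ Φ F : ℂ × ℂ × ℂ × ℂ → ℂ × ℂ × ℂ × ℂ}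

/-- Replacing the coordinate `ξ` by `X`. -/
def replaceX (X : ℂ × ℂ × ℂ × ℂ → ℂ) (z : ℂ × ℂ × ℂ × ℂ) : ℂ × ℂ × ℂ × ℂ :=
  (z.1, z.2.1, X z, z.2.2.2)

/-- On ξ = 0 the map `replaceX X` is the identity, and its ξ-derivative there is the unit w; so the
inverse theorem along the compact set applies. -/
lemma NormalForm.exists_inverse {q : ℕ} {X w C E} (hX : NormalForm q lam r F X w C E) :
    (∀ z ∈ cyl lam 0 r, replaceX X z = z) ∧ AnalyticOnNhd ℂ (replaceX X) (cyl lam 0 r) ∧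
    ∃ Θ, AnalyticOnNhd ℂ Θ (cyl lam 0 r) ∧ (∀ᶠ z in 𝓝ˢ (cyl lam 0 r), Θ (replaceX X z) = z) ∧
      ∀ᶠ z in 𝓝ˢ (cyl lam 0 r), replaceX X (Θ z) = z := by
  have hid : ∀ z ∈ cyl lam 0 r, replaceX X z = z := by
    intro z hz
    refine Prod.ext rfl (Prod.ext rfl (Prod.ext ?_ rfl))
    simp only [replaceX]
    rw [hX.eq_mul.self_of_nhdsSet z hz, (mem_cyl.mp hz).2.2.1, zero_mul]
  have han : AnalyticOnNhd ℂ (replaceX X) (cyl lam 0 r) := by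
    intro z hz
    have := hX.analytic z hz
    unfold replaceX
    fun_prop
  have himg : replaceX X '' cyl lam 0 r = cyl lam 0 r := by
    rw [image_congr hid, image_id']
  refine ⟨hid, han, ?_⟩
  rw [← himg]
  refine (exists_analytic_inverse (isCompact_cyl lam 0 r) han
    (fun z hz z' hz' h => by rwa [hid z hz, hid z' hz'] at h) ?_).imp fun Θ h => by
      simpa only [himg] using h
  intro z hz
  refine injective_fderiv_of_fibered (han z hz) (Eventually.of_forall fun w => ⟨rfl, rfl⟩) ?_
  rintro ⟨v₁, v₂⟩ hv
  have hline : HasDerivAt (fun s : ℂ => z + s • ((0 : ℂ), (0 : ℂ), v₁, v₂)) (0, 0, v₁, v₂) 0 := by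
    simpa using ((hasDerivAt_id (0 : ℂ)).smul_const ((0 : ℂ), (0 : ℂ), v₁, v₂)).const_add z
  have hv2 : v₂ = 0 := by
    have h1 : HasDerivAt (fun s : ℂ => (z + s • ((0 : ℂ), (0 : ℂ), v₁, v₂)).2.2.2) 0 0 :=
      hv.snd.snd.snd
    have h2 : HasDerivAt (fun s : ℂ => (z + s • ((0 : ℂ), (0 : ℂ), v₁, v₂)).2.2.2) v₂ 0 :=
      hline.snd.snd.snd
    exact h2.unique h1
  have hv1 : v₁ = 0 := by
    have h1 : HasDerivAt (fun s : ℂ => X (z + s • ((0 : ℂ), (0 : ℂ), v₁, v₂))) 0 0 :=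
      hv.snd.snd.fst
    have hw : HasDerivAt (fun s : ℂ => w (z + s • ((0 : ℂ), (0 : ℂ), v₁, v₂))) _ 0 :=
      HasFDerivAt.comp_hasDerivAt (f := fun s : ℂ => z + s • ((0 : ℂ), (0 : ℂ), v₁, v₂)) (l := w)
        (0 : ℂ) (by simpa using (hX.analytic_unit z hz).differentiableAt.hasFDerivAt) hline
    have h2 : HasDerivAt (fun s : ℂ => (z + s • ((0 : ℂ), (0 : ℂ), v₁, v₂)).2.2.1) v₁ 0 :=
      hline.snd.snd.fst
    have h2 := h2.fun_mul hw
    have hc : Tendsto (fun s : ℂ => z + s • ((0 : ℂ), (0 : ℂ), v₁, v₂)) (𝓝 0)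
        (𝓝ˢ (cyl lam 0 r)) := by
      have h3 := hline.continuousAt.tendsto
      simp only [zero_smul, add_zero] at h3
      exact h3.mono_right (nhds_le_nhdsSet hz)
    have h3 := h1.unique (h2.congr_of_eventuallyEq (hc.eventually hX.eq_mul))
    simp only [zero_smul, add_zero, (mem_cyl.mp hz).2.2.1, zero_mul] at h3
    exact (mul_eq_zero.mp h3.symm).resolve_right (hX.unit_ne z hz)
  rw [hv1, hv2]
  rfl

lemma Straightening.chart_fst (hs : Straightening lam r Ψ Φ F) :
    ∀ᶠ z in 𝓝ˢ (cyl lam (lam / 2) r), (Φ z).1 = z.1 ∧ (Φ z).2.1 = z.2.1 := by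
  filter_upwards [hs.param_chart] with z hz
  have := hs.fst (Φ z)
  rw [hz] at this
  exact ⟨this.1.symm, this.2.symm⟩

lemma Straightening.chart_degenerate (hs : Straightening lam r Ψ Φ F) :
    ∀ᶠ z in 𝓝ˢ (cyl lam (lam / 2) r), z.1 = 0 →
      Φ z = (0, z.2.1, z.2.2.1 - z.2.1 / 2, z.2.2.2) := by
  have hc : Tendsto (fun z : ℂ × ℂ × ℂ × ℂ => (z.1, z.2.1, z.2.2.1 - z.2.1 / 2, z.2.2.2))
      (𝓝ˢ (cyl lam (lam / 2) r)) (𝓝ˢ (cyl lam 0 r)) := by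
    refine tendsto_nhdsSet_of_mapsTo (fun z _ => by fun_prop) fun z hz => ?_
    obtain ⟨h1, h2, h3, h4⟩ := mem_cyl.mp hz
    exact mem_cyl.mpr ⟨h1, h2, by simp [h2, h3], h4⟩
  filter_upwards [hc.eventually hs.degenerate, hc.eventually hs.chart_param] with z h1 h2 h0
  rw [h1 h0] at h2
  simp only [add_sub_cancel, h0] at h2
  rw [← h2]
  congr 1
  exact Prod.ext h0 rfl

/-- The chart is `replaceX X ∘ Φ`, with inverse Ψ∘Θ. Since X vanishes exactly with ξ, the second
component of the conjugated map minus νY vanishes on the zero line and is the transverse coordinate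
times h. At a = 0 the second component is zero, which later gives the O(a) bound. -/
theorem exists_adaptedChart (hs : Straightening lam r Ψ Φ F) (hr : 0 ≤ r) (hl : lam ≠ 0) {q : ℕ}
    {X w C E} (hX : NormalForm q lam r F X w C E) :
    ∃ Λ Λ' G E' h, AdaptedChart q lam r Λ Λ' G C E' h := by
  obtain ⟨hid, han, Θ, hΘ, hΘl, hΘr⟩ := hX.exists_inverse
  have hF := hs.family
  have hΘid : ∀ z ∈ cyl lam 0 r, Θ z = z := fun z hz => by
    have := hΘl.self_of_nhdsSet z hz
    rwa [hid z hz] at this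
  have hΘt : Tendsto Θ (𝓝ˢ (cyl lam 0 r)) (𝓝ˢ (cyl lam 0 r)) :=
    tendsto_nhdsSet_of_mapsTo (fun z hz => (hΘ z hz).continuousAt)
      fun z hz => by rwa [hΘid z hz]
  have hFmem : ∀ z ∈ cyl lam 0 r, F z ∈ cyl lam 0 r := fun z hz => by
    rw [hF.apply hz]; exact zero_mem_cyl hr _ _
  have hΘfst : ∀ᶠ z in 𝓝ˢ (cyl lam 0 r), (Θ z).1 = z.1 ∧ (Θ z).2.1 = z.2.1 ∧
      X (Θ z) = z.2.2.1 ∧ (Θ z).2.2.2 = z.2.2.2 := by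
    filter_upwards [hΘr] with z hz
    exact ⟨congrArg (fun z => z.1) hz, congrArg (fun z => z.2.1) hz,
      congrArg (fun z => z.2.2.1) hz, congrArg (fun z => z.2.2.2) hz⟩
  set G : ℂ × ℂ × ℂ × ℂ → ℂ × ℂ × ℂ × ℂ := fun z => replaceX X (F (Θ z)) with hG
  have hFΘ : AnalyticOnNhd ℂ (fun z => F (Θ z)) (cyl lam 0 r) := fun z hz =>
    AnalyticAt.fun_comp (hF.analytic _ (by rwa [hΘid z hz])) (hΘ z hz)
  have hGa : AnalyticOnNhd ℂ G (cyl lam 0 r) := fun z hz =>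
    AnalyticAt.fun_comp (han _ (hFmem _ (by rwa [hΘid z hz]))) (hFΘ z hz)
  -- the second component on the strong stable line
  have hGline : ∀ᶠ z in 𝓝ˢ (cyl lam 0 r), z.2.2.1 = 0 →
      (G z).2.2.2 - nu z.2.1 z.1 * z.2.2.2 = 0 := by
    have hw : ∀ᶠ z in 𝓝ˢ (cyl lam 0 r), w z ≠ 0 := eventually_nhdsSet_iff_forall.mpr
      fun z hz => (hX.analytic_unit z hz).continuousAt.eventually_ne (hX.unit_ne z hz)
    filter_upwards [hΘfst, hΘt.eventually hF.line, hΘt.eventually hX.eq_mul, hΘt.eventually hw]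
      with z h1 h2 h3 h4 h0
    rw [h1.2.2.1, h0] at h3
    have h5 := h2 ((mul_eq_zero.mp h3.symm).resolve_right h4)
    simp only [G, replaceX]
    rw [h5, h1.1, h1.2.1, h1.2.2.2, sub_self]
  have hGdeg : ∀ᶠ z in 𝓝ˢ (cyl lam 0 r), z.1 = 0 →
      (G z).2.2.2 - nu z.2.1 z.1 * z.2.2.2 = 0 := by
    filter_upwards [hΘfst, hΘt.eventually hF.degenerate] with z h1 h2 h0
    have h5 := h2 (h1.1.trans h0)
    simp only [G, replaceX]
    rw [h5, h0, nu_zero]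
    simp
  have hsec : AnalyticOnNhd ℂ (fun z => (G z).2.2.2 - nu z.2.1 z.1 * z.2.2.2) (cyl lam 0 r) := by
    intro z hz
    have h1 := hGa z hz
    have h2 : AnalyticAt ℂ (fun z : ℂ × ℂ × ℂ × ℂ => nu z.2.1 z.1) z :=
      analyticAt_nu (by fun_prop) (by fun_prop) ((mem_cyl.mp hz).2.1 ▸ hl)
    fun_prop
  obtain ⟨h, hh, hheq⟩ := DivBy.of_vanish hsec hGline
  simp only [pow_one] at hheq
  refine ⟨fun z => replaceX X (Φ z), fun z => Ψ (Θ z), G, fun z => E (Θ z), h, ?_, ?_, hGa, ?_, hh,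
    ?_, ?_, ?_, ?_, ?_, ?_, ?_, ?_, ?_⟩
  · exact fun z hz => AnalyticAt.fun_comp (han _ (hs.mapsTo_chart hz)) (hs.analytic_chart z hz)
  · exact fun z hz => AnalyticAt.fun_comp (hs.analytic_param _ (by rwa [hΘid z hz])) (hΘ z hz)
  · exact fun z hz => AnalyticAt.fun_comp (hX.analytic_error _ (by rwa [hΘid z hz])) (hΘ z hz)
  · intro z hz
    rw [hid _ (hs.mapsTo_chart hz), hs.chart_apply hz]
  · exact hs.chart_fst
  · filter_upwards [hs.tendsto_chart.eventually hΘl, hs.param_chart] with z h1 h2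
    rw [h1, h2]
  · filter_upwards [hs.tendsto_chart.eventually hΘl, hs.semiconj_chart] with z h1 h2
    simp only [G]
    rw [h1, h2]
  · have h0c : Tendsto (fun p : ℂ × ℂ => (p.1, p.2, (0 : ℂ), (0 : ℂ))) (𝓝 (0, lam))
        (𝓝ˢ (cyl lam 0 r)) := by
      have : ContinuousAt (fun p : ℂ × ℂ => (p.1, p.2, (0 : ℂ), (0 : ℂ))) (0, lam) := by fun_prop
      exact this.tendsto.mono_right (nhds_le_nhdsSet (zero_mem_cyl hr lam 0))
    filter_upwards [h0c.eventually hs.chart_param, h0c.eventually hX.eq_mul] with p h1 h2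
    rw [hs.fixedPt] at h1
    rw [h1]
    refine Prod.ext rfl (Prod.ext rfl (Prod.ext ?_ rfl))
    simp only [replaceX]
    rw [h2, zero_mul]
  · filter_upwards [hΘfst, hΘt.eventually hX.form] with z h1 h2
    simp only [G]
    rw [h1.1, h1.2.1, h1.2.2.1] at h2
    exact h2
  · filter_upwards [hheq] with z hz
    linear_combination hz
  · filter_upwards [hheq, hGdeg] with z h1 h2 h0
    rw [← h1, h2 h0]
  · have hzY : Tendsto zeroY (𝓝ˢ (cyl lam (lam / 2) r)) (𝓝ˢ (cyl lam (lam / 2) r)) :=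
      tendsto_nhdsSet_of_mapsTo (fun z _ => (analyticAt_zeroY z).continuousAt) fun z hz => by
        obtain ⟨h1, h2, h3, -⟩ := mem_cyl.mp hz
        exact mem_cyl.mpr ⟨h1, h2, h3, by simpa [zeroY] using hr⟩
    filter_upwards [hs.chart_degenerate, hzY.eventually hs.chart_degenerate,
      hs.tendsto_chart.eventually hX.indep] with z h1 h2 h3 h0
    have h1 := h1 h0
    have h2 := h2 (show (zeroY z).1 = 0 from h0)
    simp only [zeroY, h0] at h2
    rw [h1] at h3 ⊢
    have h3 := h3 rfl
    rw [h2]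
    simp only [replaceX, zeroY] at h3 ⊢
    rw [h3]

end SemiParabolicHenon

/-! ### Uniform bounds on polydisks and the power series of the remainder. -/

namespace SemiParabolicHenon

lemma IsNormalForm.mono {q : ℕ} {lam μ C : ℂ} {ρ s s' : ℝ} (hs : s' ≤ s) {h : ℂ × ℂ → ℂ}
    {F : ℂ × ℂ → ℂ × ℂ} (hF : IsNormalForm q lam μ C ρ s h F) :
    IsNormalForm q lam μ C ρ s' h F := by
  obtain ⟨h1, h2, A, h3, h4⟩ := hF
  have hb : closedBall (0 : ℂ) s' ⊆ closedBall 0 s := closedBall_subset_closedBall hs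
  exact ⟨h1.mono (prod_mono_right hb), h2.mono (prod_mono_right hb), A,
    fun k => (h3 k).mono hb, fun x hx y hy => h4 x hx y (hb hy)⟩

/-- The Taylor expansion in the first variable of an analytic function of two variables. -/
lemma exists_hasSum_fst {f : ℂ × ℂ → ℂ} {ε s : ℝ}
    (hf : AnalyticOnNhd ℂ f (ball 0 ε ×ˢ ball 0 s)) (hε : 0 < ε) :
    ∃ e : ℕ → ℂ → ℂ, (∀ k, AnalyticOnNhd ℂ (e k) (ball 0 s)) ∧
      ∀ x ∈ ball (0 : ℂ) ε, ∀ y ∈ ball (0 : ℂ) s, HasSum (fun k => e k y * x ^ k) (f (x, y)) := by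
  -- Taylor coefficients in x are iterated directional derivatives of f at (0, y), so their
  -- analyticity in y is immediate.
  set D : (ℂ × ℂ → ℂ) → ℂ × ℂ → ℂ := fun g z => fderiv ℂ g z (1, 0) with hD
  have hDa : ∀ k, AnalyticOnNhd ℂ (D^[k] f) (ball 0 ε ×ˢ ball 0 s) := by
    intro k
    induction k with
    | zero => exact hf
    | succ k ih =>
      rw [Function.iterate_succ_apply']
      intro z hz
      exact ((ContinuousLinearMap.apply ℂ ℂ ((1 : ℂ), (0 : ℂ))).analyticAt _).comp (ih z hz).fderiv
  have hiter : ∀ k, ∀ y ∈ ball (0 : ℂ) s, ∀ x ∈ ball (0 : ℂ) ε,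
      iteratedDeriv k (fun x => f (x, y)) x = (D^[k] f) (x, y) := by
    intro k y hy
    induction k with
    | zero => intro x _; simp
    | succ k ih =>
      intro x hx
      rw [iteratedDeriv_succ, Function.iterate_succ_apply']
      have h1 : iteratedDeriv k (fun x => f (x, y)) =ᶠ[𝓝 x] fun x => (D^[k] f) (x, y) := by
        filter_upwards [isOpen_ball.mem_nhds hx] with u hu using ih u hu
      have h2 : HasDerivAt (fun x : ℂ => (x, y)) ((1 : ℂ), (0 : ℂ)) x :=
        (hasDerivAt_id x).prodMk (hasDerivAt_const x y)
      have h3 := HasFDerivAt.comp_hasDerivAt (f := fun x : ℂ => (x, y)) (l := D^[k] f) x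
        ((hDa k (x, y) ⟨hx, hy⟩).differentiableAt.hasFDerivAt) h2
      rw [h1.deriv_eq]
      exact h3.deriv
  refine ⟨fun k y => (k.factorial : ℂ)⁻¹ * (D^[k] f) (0, y), fun k y hy => ?_, fun x hx y hy => ?_⟩
  · have h1 : AnalyticAt ℂ (fun y => (D^[k] f) (0, y)) y :=
      AnalyticAt.fun_comp (g := D^[k] f) (f := fun y => ((0 : ℂ), y))
        (hDa k _ ⟨mem_ball_self hε, hy⟩) (by fun_prop)
    exact analyticAt_const.mul h1
  · have h1 : DifferentiableOn ℂ (fun x => f (x, y)) (ball 0 ε) := fun u hu =>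
      (AnalyticAt.fun_comp (g := f) (f := fun x => (x, y)) (hf (u, y) ⟨hu, hy⟩)
        (by fun_prop)).differentiableAt.differentiableWithinAt
    have h2 := Complex.hasSum_taylorSeries_on_ball h1 hx
    refine h2.congr_fun fun k => ?_
    rw [hiter k y hy 0 (mem_ball_self hε)]
    simp only [sub_zero, smul_eq_mul]
    ring

variable {q : ℕ} {lam : ℂ} {s : ℝ} {Λ Λ' G : ℂ × ℂ × ℂ × ℂ → ℂ × ℂ × ℂ × ℂ} {C : ℂ × ℂ → ℂ}
  {E h : ℂ × ℂ × ℂ × ℂ → ℂ}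

namespace AdaptedChart

/-- All germ statements hold on one polydisk of size ε; halving it leaves room for the Taylor series
of the remainder E/l to converge on the closed disks. -/
lemma exists_isNormalForm (H : AdaptedChart q lam s Λ Λ' G C E h) (hl : lam ≠ 0) (hs : 0 ≤ s) :
    ∃ ρ > 0, ∃ M ≥ 0, ∃ N ≥ 0, ∀ a l : ℂ, ‖a‖ < ρ → ‖l - lam‖ < ρ →
      IsNormalForm q l (nu l a) (C (a, l)) ρ s (fun w => h (a, l, w)) (fun w => (G (a, l, w)).2.2) ∧
      ∀ x ∈ closedBall (0 : ℂ) ρ, ∀ y ∈ closedBall (0 : ℂ) s, AnalyticAt ℂ Λ' (a, l, x, y) ∧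
        ‖x * h (a, l, x, y)‖ ≤ M * ‖a‖ ∧
        ‖(G (a, l, x, y)).2.2.1 - l * (x + x ^ (q + 1) + C (a, l) * x ^ (2 * q + 1))‖ ≤
          N * ‖x‖ ^ (2 * q + 2) := by
  have han : ∀ᶠ z in 𝓝ˢ (cyl lam 0 s), AnalyticAt ℂ Λ' z ∧ AnalyticAt ℂ G z ∧ AnalyticAt ℂ E z ∧
      AnalyticAt ℂ h z := eventually_nhdsSet_iff_forall.mpr fun z hz =>
    (H.analytic_inverse z hz).eventually_analyticAt.and
      ((H.analytic_map z hz).eventually_analyticAt.and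
      ((H.analytic_error z hz).eventually_analyticAt.and
      (H.analytic_second z hz).eventually_analyticAt))
  obtain ⟨M, hM0, hM⟩ := exists_norm_le_mul (f := fun z => z.2.2.1 * h z) (x₀ := 0) (lam := lam)
    (r := s) (fun z hz => by have := H.analytic_second z hz; fun_prop) H.second_degenerate
  obtain ⟨N, hN⟩ := (isBigO_one_of_analyticOnNhd (isCompact_cyl lam 0 s) H.analytic_error).bound
  obtain ⟨ε, hε, hp⟩ := exists_polydisk hs (han.and (H.first.and (H.second.and (hM.and (hN.and
    (eventually_ne_zero_cyl hl 0 s))))))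
  simp only [sub_zero] at hp
  refine ⟨ε / 2, by positivity, M, hM0, max N 0, le_max_right _ _, fun a l ha hl' => ?_⟩
  have hp' : ∀ x ∈ ball (0 : ℂ) ε, ∀ y ∈ ball (0 : ℂ) (s + ε), _ := fun x hx y hy =>
    hp a l x y (ha.trans (half_lt_self hε)) (hl'.trans (half_lt_self hε))
      (mem_ball_zero_iff.mp hx) (mem_ball_zero_iff.mp hy)
  have hxm : closedBall (0 : ℂ) (ε / 2) ⊆ ball 0 ε := closedBall_subset_ball (half_lt_self hε)
  have hym : closedBall (0 : ℂ) s ⊆ ball 0 (s + ε) := closedBall_subset_ball (by linarith)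
  have hl0 : l ≠ 0 := (hp' 0 (mem_ball_self hε) 0 (mem_ball_self (by linarith))).2.2.2.2.2
  have hι : ∀ w : ℂ × ℂ, AnalyticAt ℂ (fun w : ℂ × ℂ => (a, l, w)) w := fun w => by fun_prop
  constructor
  · refine ⟨fun w hw => ?_, fun w hw => ?_, ?_⟩
    · have h1 : AnalyticAt ℂ (fun w => G (a, l, w)) w :=
        AnalyticAt.fun_comp (g := G) (f := fun w : ℂ × ℂ => (a, l, w))
          (hp' _ (hxm hw.1) _ (hym hw.2)).1.2.1 (hι w)
      exact analyticAt_snd_comp (analyticAt_snd_comp h1)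
    · exact AnalyticAt.fun_comp (g := h) (f := fun w : ℂ × ℂ => (a, l, w))
        (hp' _ (hxm hw.1) _ (hym hw.2)).1.2.2.2 (hι w)
    · have hE : AnalyticOnNhd ℂ (fun w => E (a, l, w) / l) (ball 0 ε ×ˢ ball 0 (s + ε)) :=
        fun w hw => (AnalyticAt.fun_comp (g := E) (f := fun w : ℂ × ℂ => (a, l, w))
          (hp' _ hw.1 _ hw.2).1.2.2.1 (hι w)).div analyticAt_const hl0
      obtain ⟨e, he, hsum⟩ := exists_hasSum_fst hE hε
      -- The series of E/l is shifted by 2q + 2. The truncated subtraction is harmless, as only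
      -- indices at least 2q + 2 occur in the sum.
      refine ⟨fun k => e (k - (2 * q + 2)), fun k => (he _).mono hym, fun x hx y hy =>
        ⟨x ^ (2 * q + 2) * (E (a, l, x, y) / l), ?_, ?_⟩⟩
      · refine ((hsum x (hxm hx) y (hym hy)).mul_left (x ^ (2 * q + 2))).congr_fun fun k => ?_
        simp only [Nat.add_sub_cancel_left, pow_add x (2 * q + 2)]
        ring
      · obtain ⟨-, h1, h2, -⟩ := hp' x (hxm hx) y (hym hy)
        refine Prod.ext ?_ h2
        refine h1.trans ?_
        field_simp
  · intro x hx y hy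
    obtain ⟨h0, h1, -, h3, h4, -⟩ := hp' x (hxm hx) y (hym hy)
    refine ⟨h0.1, h3, ?_⟩
    rw [norm_one, mul_one] at h4
    rw [h1, add_sub_cancel_left, norm_mul, norm_pow, mul_comm]
    exact mul_le_mul_of_nonneg_right (h4.trans (le_max_left _ _)) (by positivity)

/-- At a = 0 the chart has the form (x, y) ↦ (function of x, y). The deviation from this product is
divisible by a, which supplies both the constant K of the enlarged disk and the uniform limit a → 0.
-/
lemma exists_chart_bounds (H : AdaptedChart q lam s Λ Λ' G C E h) (hs : 0 ≤ s) {ρ : ℝ}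
    (hρ : 0 < ρ) :
    ∃ ε > 0, ∃ K ≥ 0, ∀ a l x y : ℂ, ‖a‖ < ε → ‖l - lam‖ < ε → ‖x - lam / 2‖ < ε → ‖y‖ ≤ s →
      AnalyticAt ℂ Λ (a, l, x, y) ∧ Λ' (Λ (a, l, x, y)) = (a, l, x, y) ∧
      Λ (a, l, x, y) = (a, l, (Λ (a, l, x, y)).2.2) ∧
      Λ (henonFam (a, l, x, y)) = G (Λ (a, l, x, y)) ∧
      ‖(Λ (a, l, x, y)).2.2.1‖ < ρ ∧
      ‖(Λ (a, l, x, y)).2.2.1 - (Λ (0, l, x, 0)).2.2.1‖ ≤ K * ‖a‖ ∧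
      ‖(Λ (a, l, x, y)).2.2.2 - y‖ ≤ K * ‖a‖ := by
  have han : ∀ᶠ z in 𝓝ˢ (cyl lam (lam / 2) s), AnalyticAt ℂ Λ z :=
    eventually_nhdsSet_iff_forall.mpr fun z hz => (H.analytic_chart z hz).eventually_analyticAt
  have hsmall : ∀ᶠ z in 𝓝ˢ (cyl lam (lam / 2) s), ‖(Λ z).2.2.1‖ < ρ := by
    rw [eventually_nhdsSet_iff_forall]
    intro z hz
    have hc := (H.analytic_chart z hz).continuousAt
    have h1 : ContinuousAt (fun z => ‖(Λ z).2.2.1‖) z := by fun_prop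
    refine h1.eventually_lt_const ?_
    simp [H.apply z hz, hρ]
  have h0an : ∀ z ∈ cyl lam (lam / 2) s,
      AnalyticAt ℂ (fun z : ℂ × ℂ × ℂ × ℂ => Λ (0, z.2.1, z.2.2.1, 0)) z := by
    intro z hz
    obtain ⟨-, h2, h3, -⟩ := mem_cyl.mp hz
    refine AnalyticAt.fun_comp (g := Λ)
      (f := fun z : ℂ × ℂ × ℂ × ℂ => ((0 : ℂ), z.2.1, z.2.2.1, (0 : ℂ)))
      (H.analytic_chart _ (mem_cyl.mpr ⟨rfl, h2, h3, by simpa using hs⟩)) (by fun_prop)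
  obtain ⟨K₁, hK₁, hb₁⟩ := exists_norm_le_mul
    (f := fun z => (Λ z).2.2.1 - (Λ (0, z.2.1, z.2.2.1, 0)).2.2.1) (lam := lam) (x₀ := lam / 2)
    (r := s) (fun z hz => by
      have h1 := H.analytic_chart z hz
      have h2 := h0an z hz
      exact AnalyticAt.sub (by fun_prop)
        (analyticAt_fst_comp (analyticAt_snd_comp (analyticAt_snd_comp h2))))
    (by
      filter_upwards [H.degenerate] with z hz h0
      rw [congrArg (fun z : ℂ × ℂ × ℂ × ℂ => z.2.2.1) (hz h0), sub_self])
  obtain ⟨K₂, hK₂, hb₂⟩ := exists_norm_le_mul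
    (f := fun z => (Λ z).2.2.2 - z.2.2.2) (lam := lam) (x₀ := lam / 2)
    (r := s) (fun z hz => by
      have h1 := H.analytic_chart z hz
      fun_prop)
    (by
      filter_upwards [H.degenerate] with z hz h0
      rw [congrArg (fun z : ℂ × ℂ × ℂ × ℂ => z.2.2.2) (hz h0), sub_self])
  obtain ⟨ε, hε, hp⟩ := exists_polydisk hs (han.and (H.left_inv.and (H.fst.and (H.semiconj.and
    (hsmall.and (hb₁.and hb₂))))))
  refine ⟨ε, hε, max K₁ K₂, hK₁.trans (le_max_left _ _), fun a l x y ha hl hx hy => ?_⟩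
  obtain ⟨h1, h2, h3, h4, h5, h6, h7⟩ := hp a l x y ha hl hx (by linarith)
  exact ⟨h1, h2, Prod.ext h3.1 (Prod.ext h3.2 rfl), h4, h5,
    h6.trans (mul_le_mul_of_nonneg_right (le_max_left _ _) (norm_nonneg _)),
    h7.trans (mul_le_mul_of_nonneg_right (le_max_right _ _) (norm_nonneg _))⟩

end AdaptedChart

end SemiParabolicHenon

/-! ### Choice of constants and assembly. -/

theorem mainTheorem10 (q : ℕ) (hq : 0 < q) (lam : ℂ) (hlam : IsPrimitiveRoot lam q)
    (r : ℝ) (hr : 3 < r) :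
    ∃ δ > (0 : ℝ), ∃ δ' > (0 : ℝ), ∃ ρ > (0 : ℝ), ∃ ρ' > (0 : ℝ),
    ∃ K ≥ (0 : ℝ), ∃ M ≥ (0 : ℝ), ∃ N ≥ (0 : ℝ),
    ∃ (φ : ℂ → ℝ → ℂ × ℂ → ℂ × ℂ) (F : ℂ → ℝ → ℂ × ℂ → ℂ × ℂ) (h : ℂ → ℝ → ℂ × ℂ → ℂ)
      (C : ℂ → ℝ → ℂ) (φ₁ : ℝ → ℂ → ℂ) (C₁ : ℝ → ℂ),
      -- the coordinates and the normal form, for every pair of parameters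
      (∀ (a : ℂ) (t : ℝ), ‖a‖ < δ → |t| < δ' →
        SemiParabolicHenon.localStrongStable (SemiParabolicHenon.lamT lam t) a r ⊆
          Metric.ball (SemiParabolicHenon.lamT lam t / 2) ρ' ×ˢ Metric.closedBall (0 : ℂ) r ∧
        SemiParabolicHenon.IsCoordinateChange (φ a t)
          (SemiParabolicHenon.tube (SemiParabolicHenon.lamT lam t) ρ' r) ∧
        Set.MapsTo (φ a t) (SemiParabolicHenon.tube (SemiParabolicHenon.lamT lam t) ρ' r)
          (Metric.closedBall (0 : ℂ) ρ ×ˢ Metric.closedBall (0 : ℂ) (r + K * ‖a‖)) ∧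
        φ a t (SemiParabolicHenon.fixedPt (SemiParabolicHenon.lamT lam t) a) = 0 ∧
        SemiParabolicHenon.IsNormalForm q (SemiParabolicHenon.lamT lam t)
          (SemiParabolicHenon.nu (SemiParabolicHenon.lamT lam t) a) (C a t) ρ (r + K * ‖a‖)
          (h a t) (F a t) ∧
        (∀ z ∈ SemiParabolicHenon.tube (SemiParabolicHenon.lamT lam t) ρ' r,
          SemiParabolicHenon.henonOn (SemiParabolicHenon.lamT lam t) a z ∈
              SemiParabolicHenon.tube (SemiParabolicHenon.lamT lam t) ρ' r →
          φ a t (SemiParabolicHenon.henonOn (SemiParabolicHenon.lamT lam t) a z) =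
            F a t (φ a t z)) ∧
        (∀ x ∈ Metric.closedBall (0 : ℂ) ρ, ∀ y ∈ Metric.closedBall (0 : ℂ) (r + K * ‖a‖),
          ‖x * h a t (x, y)‖ ≤ M * ‖a‖)) ∧
      -- analytic dependence on the parameters: jointly real-analytic in all variables, and
      -- holomorphic in `(a, z)` for each `t`
      AnalyticOnNhd ℝ (fun s : ℂ × ℝ × (ℂ × ℂ) => φ s.1 s.2.1 s.2.2)
        {s | ‖s.1‖ < δ ∧ |s.2.1| < δ' ∧
          s.2.2 ∈ SemiParabolicHenon.tube (SemiParabolicHenon.lamT lam s.2.1) ρ' r} ∧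
      (∀ t : ℝ, |t| < δ' →
        AnalyticOnNhd ℂ (fun s : ℂ × (ℂ × ℂ) => φ s.1 t s.2)
          (Metric.ball (0 : ℂ) δ ×ˢ
            SemiParabolicHenon.tube (SemiParabolicHenon.lamT lam t) ρ' r)) ∧
      -- the limit as `a → 0`
      TendstoUniformlyOn (fun (a : ℂ) (s : ℝ × (ℂ × ℂ)) => φ a s.1 s.2)
        (fun s : ℝ × (ℂ × ℂ) => (φ₁ s.1 s.2.1, s.2.2)) (nhdsWithin (0 : ℂ) {0}ᶜ)
        {s | |s.1| < δ' ∧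
          s.2 ∈ SemiParabolicHenon.tube (SemiParabolicHenon.lamT lam s.1) ρ' r} ∧
      (∀ t : ℝ, |t| < δ' →
        SemiParabolicHenon.IsNormalizingChart q (SemiParabolicHenon.lamT lam t) (C₁ t) ρ ρ' N
          (φ₁ t)) := by
  have hl1 : ‖lam‖ = 1 := hlam.norm'_eq_one hq.ne'
  have hl0 : lam ≠ 0 := hlam.ne_zero hq.ne'
  -- The construction is carried out over the radius r + 1, so that the images in |y| ≤ r + K|a|
  -- remain in its domain.
  have hs0 : (0 : ℝ) ≤ r + 1 := by linarith
  obtain ⟨Ψ, Φ, F₀, hS⟩ := SemiParabolicHenon.exists_straightening_family hl1 hs0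
  obtain ⟨X, w, C, E, hX⟩ := SemiParabolicHenon.exists_normalForm hS.family hs0 hq hlam
  obtain ⟨Λ, Λ', G, E', h, H⟩ := SemiParabolicHenon.exists_adaptedChart hS hs0 hl0 hX
  obtain ⟨ρ, hρ, M, hM, N, hN, hform⟩ := H.exists_isNormalForm hl0 hs0
  obtain ⟨ε, hε, K, hK, hchart⟩ := H.exists_chart_bounds hs0 hρ
  obtain ⟨d, hd, hloc⟩ := Metric.eventually_nhds_iff_ball.mp
    ((SemiParabolicHenon.eventually_localStrongStable_subset hS hq hl1 hX hr (by linarith)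
      (show (0 : ℝ) < ε / 2 by linarith)).and H.fixedPt)
  -- The bound d serves the local strong stable manifold and the fixed point, and 1/(K + 1) forces
  -- K|a| ≤ 1. The tube has radius ε/2 because its centre λ_t/2 moves by less than ε/2. The same δ
  -- serves for t since |λ_t - λ| = |t|.
  set δ := min (min ρ ε) (min d (1 / (K + 1))) with hδ
  have hδ0 : 0 < δ := by positivity
  -- the parameters and the tubes are in the domains
  have hlt : ∀ t : ℝ, |t| < δ → ‖SemiParabolicHenon.lamT lam t - lam‖ < δ := by
    intro t ht
    have : SemiParabolicHenon.lamT lam t - lam = t * lam := by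
      simp only [SemiParabolicHenon.lamT]; ring
    rwa [this, norm_mul, hl1, mul_one, Complex.norm_real, Real.norm_eq_abs]
  have hδρ : δ ≤ ρ := (min_le_left _ _).trans (min_le_left _ _)
  have hδε : δ ≤ ε := (min_le_left _ _).trans (min_le_right _ _)
  have hδd : δ ≤ d := (min_le_right _ _).trans (min_le_left _ _)
  have hδK : ∀ a : ℂ, ‖a‖ < δ → K * ‖a‖ ≤ 1 := by
    intro a ha
    have h1 : ‖a‖ ≤ 1 / (K + 1) := ha.le.trans ((min_le_right _ _).trans (min_le_right _ _))
    rw [le_div_iff₀ (by linarith)] at h1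
    nlinarith [norm_nonneg a]
  have htube : ∀ t : ℝ, |t| < δ → ∀ x ∈ closedBall (SemiParabolicHenon.lamT lam t / 2) (ε / 2),
      ‖x - lam / 2‖ < ε := by
    intro t ht x hx
    rw [mem_closedBall, dist_eq_norm] at hx
    have h1 : ‖(SemiParabolicHenon.lamT lam t - lam) / 2‖ < ε / 2 := by
      rw [norm_div, Complex.norm_ofNat]
      linarith [hlt t ht]
    have h2 := norm_add_le (x - SemiParabolicHenon.lamT lam t / 2)
      ((SemiParabolicHenon.lamT lam t - lam) / 2)
    rw [show x - SemiParabolicHenon.lamT lam t / 2 + (SemiParabolicHenon.lamT lam t - lam) / 2 =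
      x - lam / 2 by ring] at h2
    linarith
  have hc : ∀ (a : ℂ) (t : ℝ), ‖a‖ < δ → |t| < δ →
      ∀ z ∈ SemiParabolicHenon.tube (SemiParabolicHenon.lamT lam t) (ε / 2) r, _ :=
    fun a t ha ht z hz => hchart a (SemiParabolicHenon.lamT lam t) z.1 z.2 (ha.trans_le hδε)
      ((hlt t ht).trans_le hδε) (htube t ht _ hz.1)
      ((mem_closedBall_zero_iff.mp hz.2).trans (by linarith))
  have hc₁ : ∀ t : ℝ, |t| < δ →
      ∀ x ∈ closedBall (SemiParabolicHenon.lamT lam t / 2) (ε / 2), _ :=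
    fun t ht x hx => hchart 0 (SemiParabolicHenon.lamT lam t) x 0 (by simpa using hε)
      ((hlt t ht).trans_le hδε) (htube t ht _ hx) (by simpa using hs0)
  have hn : ∀ (a : ℂ) (t : ℝ), ‖a‖ < δ → |t| < δ → _ :=
    fun a t ha ht => hform a (SemiParabolicHenon.lamT lam t) (ha.trans_le hδρ)
      ((hlt t ht).trans_le hδρ)
  have hp : ∀ (a : ℂ) (t : ℝ), ‖a‖ < δ → |t| < δ → _ :=
    fun a t ha ht => hloc (a, SemiParabolicHenon.lamT lam t) (by
      rw [mem_ball, Prod.dist_eq, max_lt_iff, dist_zero_right, dist_eq_norm]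
      exact ⟨ha.trans_le hδd, (hlt t ht).trans_le hδd⟩)
  have hmaps : ∀ (a : ℂ) (t : ℝ), ‖a‖ < δ → |t| < δ →
      MapsTo (fun z : ℂ × ℂ => (Λ (a, SemiParabolicHenon.lamT lam t, z)).2.2)
        (SemiParabolicHenon.tube (SemiParabolicHenon.lamT lam t) (ε / 2) r)
        (closedBall (0 : ℂ) ρ ×ˢ closedBall (0 : ℂ) (r + K * ‖a‖)) := by
    intro a t ha ht z hz
    obtain ⟨-, -, -, -, h5, -, h7⟩ := hc a t ha ht z hz
    refine ⟨mem_closedBall_zero_iff.mpr h5.le, mem_closedBall_zero_iff.mpr ?_⟩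
    have h8 := norm_add_le ((Λ (a, SemiParabolicHenon.lamT lam t, z)).2.2.2 - z.2) z.2
    rw [sub_add_cancel] at h8
    have h9 := mem_closedBall_zero_iff.mp hz.2
    exact h8.trans (by linarith)
  -- All families are one germ in (a, l, x, y) with l = λ_t inserted; the one-dimensional chart is
  -- its restriction to a = 0, y = 0.
  refine ⟨δ, hδ0, δ, hδ0, ρ, hρ, ε / 2, by linarith, K, hK, M, hM, N, hN,
    fun a t z => (Λ (a, SemiParabolicHenon.lamT lam t, z)).2.2,
    fun a t z => (G (a, SemiParabolicHenon.lamT lam t, z)).2.2,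
    fun a t z => h (a, SemiParabolicHenon.lamT lam t, z),
    fun a t => C (a, SemiParabolicHenon.lamT lam t),
    fun t x => (Λ (0, SemiParabolicHenon.lamT lam t, x, 0)).2.2.1,
    fun t => C (0, SemiParabolicHenon.lamT lam t), ?_, ?_, ?_, ?_, ?_⟩
  · intro a t ha ht
    have hKa := hδK a ha
    have hsub : closedBall (0 : ℂ) (r + K * ‖a‖) ⊆ closedBall 0 (r + 1) :=
      closedBall_subset_closedBall (by linarith)
    refine ⟨(hp a t ha ht).1, ⟨?_, fun v => (Λ' (a, SemiParabolicHenon.lamT lam t, v)).2.2, ?_, ?_⟩,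
      hmaps a t ha ht, ?_, (hn a t ha ht).1.mono (by linarith), ?_, ?_⟩
    · intro z hz
      have h1 : AnalyticAt ℂ (fun z : ℂ × ℂ => Λ (a, SemiParabolicHenon.lamT lam t, z)) z :=
        AnalyticAt.fun_comp (g := Λ) (f := fun z : ℂ × ℂ => (a, SemiParabolicHenon.lamT lam t, z))
          (hc a t ha ht z hz).1 (by fun_prop)
      exact SemiParabolicHenon.analyticAt_snd_comp (SemiParabolicHenon.analyticAt_snd_comp h1)
    · rintro _ ⟨z, hz, rfl⟩
      have hm := hmaps a t ha ht hz
      have h1 : AnalyticAt ℂ (fun v : ℂ × ℂ => Λ' (a, SemiParabolicHenon.lamT lam t, v))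
          (Λ (a, SemiParabolicHenon.lamT lam t, z)).2.2 :=
        AnalyticAt.fun_comp (g := Λ') (f := fun v : ℂ × ℂ => (a, SemiParabolicHenon.lamT lam t, v))
          ((hn a t ha ht).2 _ hm.1 _ (hsub hm.2)).1 (by fun_prop)
      exact SemiParabolicHenon.analyticAt_snd_comp (SemiParabolicHenon.analyticAt_snd_comp h1)
    · intro z hz
      obtain ⟨-, h2, h3, -⟩ := hc a t ha ht z hz
      rw [h3] at h2
      exact congrArg (fun z : ℂ × ℂ × ℂ × ℂ => z.2.2) h2
    · exact congrArg (fun z : ℂ × ℂ × ℂ × ℂ => z.2.2) (hp a t ha ht).2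
    · intro z hz _
      obtain ⟨-, -, h3, h4, -⟩ := hc a t ha ht z hz
      rw [h3] at h4
      exact congrArg (fun z : ℂ × ℂ × ℂ × ℂ => z.2.2) h4
    · exact fun x hx y hy => ((hn a t ha ht).2 x hx y (hsub hy)).2.1
  -- The chart is complex analytic in (a, l, z), and t enters only through the real-affine map t ↦
  -- λ_t.
  · rintro ⟨a, t, z⟩ ⟨ha, ht, hz⟩
    have h1 : AnalyticAt ℝ Λ (a, SemiParabolicHenon.lamT lam t, z) :=
      (hc a t ha ht z hz).1.restrictScalars
    have h2 : AnalyticAt ℝ (fun v : ℂ × ℝ × (ℂ × ℂ) =>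
        (v.1, SemiParabolicHenon.lamT lam v.2.1, v.2.2)) (a, t, z) := by
      have h3 : AnalyticAt ℝ (fun v : ℂ × ℝ × (ℂ × ℂ) => (v.2.1 : ℂ)) (a, t, z) :=
        (Complex.ofRealCLM.analyticAt _).comp (analyticAt_fst.comp analyticAt_snd)
      exact analyticAt_fst.prod (((analyticAt_const.add h3).mul analyticAt_const).prod
        (analyticAt_snd.comp analyticAt_snd))
    have h3 : AnalyticAt ℝ (fun v : ℂ × ℝ × (ℂ × ℂ) =>
        Λ (v.1, SemiParabolicHenon.lamT lam v.2.1, v.2.2)) (a, t, z) :=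
      AnalyticAt.fun_comp (g := Λ) h1 h2
    exact analyticAt_snd.comp (analyticAt_snd.comp h3)
  · rintro t ht ⟨a, z⟩ ⟨ha, hz⟩
    have h1 : AnalyticAt ℂ (fun v : ℂ × (ℂ × ℂ) => Λ (v.1, SemiParabolicHenon.lamT lam t, v.2))
        (a, z) :=
      AnalyticAt.fun_comp (g := Λ)
        (f := fun v : ℂ × (ℂ × ℂ) => (v.1, SemiParabolicHenon.lamT lam t, v.2))
        (hc a t (mem_ball_zero_iff.mp ha) ht z hz).1 (by fun_prop)
    exact SemiParabolicHenon.analyticAt_snd_comp (SemiParabolicHenon.analyticAt_snd_comp h1)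
  · rw [Metric.tendstoUniformlyOn_iff]
    intro η hη
    have h1 : ∀ᶠ a in 𝓝[≠] (0 : ℂ), ‖a‖ < min δ (η / (K + 1)) := by
      refine nhdsWithin_le_nhds (continuous_norm.continuousAt.eventually_lt_const ?_)
      simp only [norm_zero]
      positivity
    filter_upwards [h1] with a ha
    rintro ⟨t, z⟩ ⟨ht, hz⟩
    obtain ⟨ha1, ha2⟩ := lt_min_iff.mp ha
    obtain ⟨-, -, -, -, -, h6, h7⟩ := hc a t ha1 ht z hz
    rw [lt_div_iff₀ (by linarith)] at ha2
    have h8 : K * ‖a‖ < η := by nlinarith [norm_nonneg a]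
    rw [dist_comm, Prod.dist_eq, max_lt_iff, dist_eq_norm, dist_eq_norm]
    exact ⟨h6.trans_lt h8, h7.trans_lt h8⟩
  · intro t ht
    have h0δ : ‖(0 : ℂ)‖ < δ := by simpa using hδ0
    have hm : ∀ x ∈ closedBall (SemiParabolicHenon.lamT lam t / 2) (ε / 2),
        (x, (0 : ℂ)) ∈ SemiParabolicHenon.tube (SemiParabolicHenon.lamT lam t) (ε / 2) r :=
      fun x hx => ⟨hx, mem_closedBall_self (by linarith)⟩
    -- for `a = 0` the line `y = 0` is invariant under the coordinate change
    have hΛ : ∀ x ∈ closedBall (SemiParabolicHenon.lamT lam t / 2) (ε / 2),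
        Λ (0, SemiParabolicHenon.lamT lam t, x, 0) =
          (0, SemiParabolicHenon.lamT lam t,
            (Λ (0, SemiParabolicHenon.lamT lam t, x, 0)).2.2.1, 0) := by
      intro x hx
      obtain ⟨-, -, h3, -, -, -, h7⟩ := hc₁ t ht x hx
      rw [norm_zero, mul_zero, sub_zero, norm_le_zero_iff] at h7
      exact h3.trans (Prod.ext rfl (Prod.ext rfl (Prod.ext rfl h7)))
    refine ⟨⟨?_, fun v => (Λ' (0, SemiParabolicHenon.lamT lam t, v, 0)).2.2.1, ?_, ?_⟩, ?_, ?_, ?_⟩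
    · intro x hx
      have h1 : AnalyticAt ℂ (fun x : ℂ => Λ (0, SemiParabolicHenon.lamT lam t, x, 0)) x :=
        AnalyticAt.fun_comp (g := Λ)
          (f := fun x : ℂ => ((0 : ℂ), SemiParabolicHenon.lamT lam t, x, (0 : ℂ)))
          (hc₁ t ht x hx).1 (by fun_prop)
      exact SemiParabolicHenon.analyticAt_fst_comp (SemiParabolicHenon.analyticAt_snd_comp
        (SemiParabolicHenon.analyticAt_snd_comp h1))
    · rintro _ ⟨x, hx, rfl⟩
      obtain ⟨-, -, -, -, h5, -⟩ := hc₁ t ht x hx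
      have h1 : AnalyticAt ℂ (fun v : ℂ => Λ' (0, SemiParabolicHenon.lamT lam t, v, 0))
          (Λ (0, SemiParabolicHenon.lamT lam t, x, 0)).2.2.1 :=
        AnalyticAt.fun_comp (g := Λ')
          (f := fun v : ℂ => ((0 : ℂ), SemiParabolicHenon.lamT lam t, v, (0 : ℂ)))
          ((hn 0 t h0δ ht).2 _ (mem_closedBall_zero_iff.mpr h5.le) 0
            (mem_closedBall_self hs0)).1 (by fun_prop)
      exact SemiParabolicHenon.analyticAt_fst_comp (SemiParabolicHenon.analyticAt_snd_comp
        (SemiParabolicHenon.analyticAt_snd_comp h1))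
    · intro x hx
      obtain ⟨-, h2, -⟩ := hc₁ t ht x hx
      rw [hΛ x hx] at h2
      exact congrArg (fun z : ℂ × ℂ × ℂ × ℂ => z.2.2.1) h2
    · exact fun x hx => mem_closedBall_zero_iff.mpr (hc₁ t ht x hx).2.2.2.2.1.le
    · have h1 := congrArg (fun z : ℂ × ℂ × ℂ × ℂ => z.2.2.1) (hp 0 t h0δ ht).2
      simpa [SemiParabolicHenon.fixedPt] using h1
    · intro x hx _
      obtain ⟨-, -, -, h4, h5, -⟩ := hc₁ t ht x hx
      have h6 : SemiParabolicHenon.henonFam (0, SemiParabolicHenon.lamT lam t, x, 0) =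
          (0, SemiParabolicHenon.lamT lam t,
            SemiParabolicHenon.quadPoly (SemiParabolicHenon.lamT lam t) x, 0) := by
        simp only [SemiParabolicHenon.henonFam, SemiParabolicHenon.henonOn,
          SemiParabolicHenon.henon, SemiParabolicHenon.cParam, SemiParabolicHenon.quadPoly]
        refine Prod.ext rfl (Prod.ext rfl (Prod.ext ?_ (zero_mul _)))
        simp only
        ring
      rw [h6, hΛ x hx] at h4
      have h7 := ((hn 0 t h0δ ht).2 _ (mem_closedBall_zero_iff.mpr h5.le) 0
        (mem_closedBall_self hs0)).2.2
      rw [← h4] at h7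
      exact h7
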